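/- **Words.** Let $s_i=(i,i+1)$ for $i\in\mathbb Z$, let $S_{\mathbb Z}=\langle s_i : i\in\mathbb Z\rangle$, and let $\circ$ be the Demazure product on $S_{\mathbb Z}$ (the associative product with $\sigma\circ s_i=\sigma s_i$ if $\sigma(i)<\sigma(i+1)$ and $\sigma\circ s_i=\sigma$ otherwise). An *involution word* for $z$ is an integer word $a=a_1\cdots a_n$ of shortest possible length with $z=s_{a_n}\circ\cdots\circ s_{a_2}\circ s_{a_1}\circ s_{a_2}\circ\cdots\circ s_{a_n}$. An index $k\in[n]$ is a *commutation* in $a$ if $s_{a_k}$ commutes with $s_{a_{k-1}}\circ\cdots\circ s_{a_1}\circ\cdots\circ s_{a_{k-1}}$. Letters are elements of $\mathbb Z\sqcup\mathbb Z'=\tfrac12\mathbb Z$, where $i'=i-\tfrac12$ is the primed form of $i\in\mathbb{Z}$, so $\lceil i'\rceil=\lceil i\rceil=i$. A *primed involution word* $\hat a\in\mathcal R^+_{\mathsf{inv}}(z)$ is formed by adding primes to some letters indexed by commutations in an involution word $a$ for $z$; $a=\mathsf{unprime}(\hat a)$ is its unprimed form. Let $\gamma_k(a)=s_{a_n}\cdots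 s_{a_{k+2}}s_{a_{k+1}}(\{a_k,a_k+1\})$ if $k$ is a commutation in $a$ and $\gamma_k(a)=\emptyset$ otherwise, and let $\mathsf{marked}(\hat a)=\{\gamma_k(a): \hat a_k\in\mathbb Z'\}$. **Insertion.** Tableaux are shifted and drawn in French notation, with boxes $(x,y)$, $1\le x\le y$, in row $x$ and column $y$; the row reading word $\mathsf{row}(T)$ reads each row from left to right, starting with the top row. To insert a letter $u$ into $T$, start by inserting $w=u$ into row $1$. On iteration $i$, the letter $w$ is inserted into row or column $i$ (the current segment). - If some entry of the segment exceeds $\lceil w\rceil$, let $m\le M$ be the smallest entries of the segment with $\lceil w\rceil\le\lceil m\rceil$ and $\lceil w\rceil<\lceil M\rceil$. (a) If $m=M$ is off the main diagonal, then $w$ replaces $m$, and $m$ is inserted into the next row (respectively, column) if the segment is a row (respectively, column). (b) If $m=M$ is on the main diagonal, then $m$ is replaced by $\lceil w\rceil$, and $m$ (if $w\in\mathbb Z$) or $m'$ (if $w\in\mathbb Z'$) is inserted into the next column. (c) If $m\ne M$, then the primes of these two entries are switched (both are reversed if exactly one of the entries is primed, otherwise nothing changes), and $w+1$ is inserted into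 the next column if $m$ is on the main diagonal or the segment is a column, and into the next row otherwise. - Otherwise $w$ is placed in the first empty box $(x,y)$ with $x\le y$ of the segment, and the process stops. If $x=y$, the box receives $\lceil w\rceil$, and the process ends in column insertion exactly when $w$ is primed. If $x<y$, it ends in column insertion exactly when the segment is a column. In all other cases it ends in row insertion. For a primed involution word $\hat a=\hat a_1\cdots\hat a_n$, let $P^{\mathsf O}_{\mathsf{EG}}(\hat a)$ be the result of inserting $\hat a_1,\dots,\hat a_n$ successively into the empty tableau, and let $Q^{\mathsf O}_{\mathsf{EG}}(\hat a)$ be the tableau of the same shape with $k$ (respectively, $k'$) in the box added by the insertion of $\hat a_k$ if this ends in row (respectively, column) insertion. **Cycle sequences.** For a tableau $T$ with integer entries and an integer word $b$ such that $\mathsf{row}(T)b$ is an involution word, let $\gamma_{ij}(T,b)=\gamma_k(\mathsf{row}(T)b)$ if $(i,j)$ is a box of $T$ that contributes the $k$-th letter of $\mathsf{row}(T)$, and $\gamma_{ij}(T,b)=\emptyset$ if $(i,j)$ is not a box of $T$; put $\gamma_{ij}(T)=\gamma_{ij}(T,\emptyset)$. For an involution word $a=a_1\cdots a_n$ and $0\le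 i\le n$ let $T=P^{\mathsf O}_{\mathsf{EG}}(a_1\cdots a_i)$, with $q$ rows, and $b=a_{i+1}\cdots a_n$, and let $\mathsf{cseq}_i(a)$ be the two-line array with columns $(\gamma_{kk}(T,b),T_{kk})$, $k=1,\dots,q$. For $i\in[n]$ define a permutation $\tau_i(a)$ of the set of 2-element subsets of $\mathbb Z$ as follows. If $\mathsf{cseq}_{i-1}(a)$ and $\mathsf{cseq}_i(a)$ are equal or have different lengths, then $\tau_i(a)=1$. Otherwise let their columns be $(\gamma_k,c_k)$ and $(\eta_k,d_k)$, $k\in[q]$, respectively; there is either a unique $j\in[q]$ with $d_j<c_j$ or a unique $j\in[q-1]$ with $\gamma_{j+1}=\eta_j\ne\gamma_j=\eta_{j+1}$, and $\tau_i(a)$ swaps $\eta_j$ and $\gamma_j$ and fixes everything else. Let $\tau(a)=\tau_1(a)\tau_2(a)\cdots\tau_n(a)$ (composed as functions, the rightmost factor being applied first). **Proposition.** Let $\hat a\in\mathcal R^+_{\mathsf{inv}}(z)$ be a primed involution word with $a=\mathsf{unprime}(\hat a)$. Let $(i,j)\in\mathbb Z\times\mathbb Z$ and $\theta=\gamma_{ij}(P^{\mathsf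 O}_{\mathsf{EG}}(a))$. If $i\ne j$ (respectively, $i=j$), then $(i,j)$ is a box of $P^{\mathsf O}_{\mathsf{EG}}(\hat a)$ (respectively, $Q^{\mathsf O}_{\mathsf{EG}}(\hat a)$) with a primed entry if and only if $\theta\ne\emptyset$ and $\tau(a)(\theta)\in\mathsf{marked}(\hat a)$. -/

import Mathlib

namespace ShiftedEG

/-! ### Primed letters and words -/

/-- A letter of the primed alphabet `⋯ < 1' < 1 < 2' < 2 < ⋯`.  The letter `⟨i, false⟩` is the
integer `i`, and `⟨i, true⟩` is the primed number `i' = i - 1/2`; so `num` is the ceiling. -/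
structure Letter where
  num : ℤ
  primed : Bool

/-- Twice the value of the letter as an element of `(1/2)ℤ`; it encodes the order on letters. -/
def Letter.twice (u : Letter) : ℤ := 2 * u.num - (if u.primed then 1 else 0)

/-- The unprimed letter of an integer. -/
def Letter.ofInt (i : ℤ) : Letter := ⟨i, false⟩

/-- The unprimed form of a primed word. -/
def unprime (w : List Letter) : List ℤ := w.map Letter.num

/-- An unprimed word, seen as a primed word. -/
def ofWord (a : List ℤ) : List Letter := a.map Letter.ofInt

/-! ### Involution words -/

/-- The simple transposition `s_i = (i, i + 1)`. -/
def s (i : ℤ) : Equiv.Perm ℤ := Equiv.swap i (i + 1)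

/-- The Demazure product `σ ∘ s_i`. -/
def demazureRight (σ : Equiv.Perm ℤ) (i : ℤ) : Equiv.Perm ℤ :=
  if σ i < σ (i + 1) then σ * s i else σ

/-- The Demazure product `s_i ∘ σ`. -/
def demazureLeft (i : ℤ) (σ : Equiv.Perm ℤ) : Equiv.Perm ℤ :=
  if σ⁻¹ i < σ⁻¹ (i + 1) then s i * σ else σ

/-- The Demazure product `s_{a_n} ∘ ⋯ ∘ s_{a_2} ∘ s_{a_1} ∘ s_{a_2} ∘ ⋯ ∘ s_{a_n}`, bracketed from
the middle outwards (the Demazure product is associative and `s_{a_1} ∘ 1 ∘ s_{a_1} = s_{a_1}`). -/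
def involutionProduct (a : List ℤ) : Equiv.Perm ℤ :=
  a.foldl (fun y i => demazureRight (demazureLeft i y) i) 1

/-- `a` is an involution word for `z`: a word of shortest possible length with
`s_{a_n} ∘ ⋯ ∘ s_{a_1} ∘ ⋯ ∘ s_{a_n} = z`. -/
def IsInvolutionWord (z : Equiv.Perm ℤ) (a : List ℤ) : Prop :=
  involutionProduct a = z ∧ ∀ b : List ℤ, involutionProduct b = z → a.length ≤ b.length

/-- The position `k` (counted from `0`) is a commutation in `a`. -/
def IsCommutation (a : List ℤ) (k : ℕ) : Prop :=
  ∃ h : k < a.length, Commute (s a[k]) (involutionProduct (a.take k))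

/-- `w` is a primed involution word for `z`: its unprimed form is an involution word for `z`, and
only letters at commutations are primed. -/
def IsPrimedInvolutionWord (z : Equiv.Perm ℤ) (w : List Letter) : Prop :=
  IsInvolutionWord z (unprime w) ∧
    ∀ (k : ℕ) (h : k < w.length), w[k].primed = true → IsCommutation (unprime w) k

open Classical in
/-- The set `γ_k(a)`, which is `s_{a_{n-1}} ⋯ s_{a_{k+2}} s_{a_{k+1}} {a_k, a_k + 1}` if `k` is a
commutation in `a`, and `∅` otherwise; letters are counted from `0` to `n - 1` here. -/
noncomputable def gamma (a : List ℤ) (k : ℕ) : Finset ℤ :=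
  if IsCommutation a k then
    (a.drop (k + 1)).foldl (fun S j => S.image (s j)) {a.getD k 0, a.getD k 0 + 1}
  else ∅

/-- The set `marked(w)` of the `γ_k(unprime w)` for the indices `k` of the primed letters of `w`. -/
def marked (w : List Letter) : Set (Finset ℤ) :=
  {θ | ∃ (k : ℕ) (h : k < w.length), w[k].primed = true ∧ gamma (unprime w) k = θ}

/-! ### Tableaux -/

/-- A filling of a finite set of boxes `(row, column)` by letters.  Only the values of `entry` on
`boxes` are meaningful.  The tableaux built below have shifted diagrams as sets of boxes, in French
notation, with rows and columns counted from `1`. -/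
structure Tableau where
  boxes : Finset (ℤ × ℤ)
  entry : ℤ × ℤ → Letter

namespace Tableau

/-- The empty tableau. -/
def empty : Tableau := ⟨∅, fun _ => Letter.ofInt 0⟩

/-- Put the letter `u` in the box `x`, which is added to the tableau if it is not there. -/
def set (T : Tableau) (x : ℤ × ℤ) (u : Letter) : Tableau :=
  ⟨insert x T.boxes, Function.update T.entry x u⟩

/-- The box `x` belongs to `T` and its entry is primed. -/
def IsPrimedAt (T : Tableau) (x : ℤ × ℤ) : Prop :=
  x ∈ T.boxes ∧ (T.entry x).primed = true

/-- The row reading order on boxes: top row (largest row index) first, left to right in each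
row. -/
def ReadsBefore (x y : ℤ × ℤ) : Prop := y.1 < x.1 ∨ (x.1 = y.1 ∧ x.2 ≤ y.2)

instance : DecidableRel ReadsBefore := fun x y => by unfold ReadsBefore; infer_instance

instance : IsTrans (ℤ × ℤ) ReadsBefore :=
  ⟨fun x y w h₁ h₂ => by unfold ReadsBefore at *; omega⟩

instance : Std.Antisymm ReadsBefore :=
  ⟨fun x y h₁ h₂ => by unfold ReadsBefore at *; ext <;> omega⟩

instance : Std.Total ReadsBefore :=
  ⟨fun x y => by unfold ReadsBefore; omega⟩

/-- The boxes of `T` in row reading order. -/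
def readingOrder (T : Tableau) : List (ℤ × ℤ) := T.boxes.sort ReadsBefore

/-- The row reading word of `T`. -/
def row (T : Tableau) : List Letter := T.readingOrder.map T.entry

/-- The number of rows of `T`. -/
def numRows (T : Tableau) : ℕ := (T.boxes.image Prod.fst).card

/-! ### Orthogonal Edelman-Greene insertion -/

/-- The boxes of `T` in column `i` (if `col` is true) or in row `i` (if `col` is false). -/
def segment (T : Tableau) (col : Bool) (i : ℤ) : List (ℤ × ℤ) :=
  T.readingOrder.filter (fun x => (if col then x.2 else x.1) = i)

/-- The box in column `i` or in row `i` that holds the smallest of those entries whose ceiling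
satisfies `p`, if there is such an entry. -/
noncomputable def smallest (T : Tableau) (col : Bool) (i : ℤ) (p : ℤ → Bool) : Option (ℤ × ℤ) :=
  ((T.segment col i).filter (fun x => p (T.entry x).num)).argmin (fun x => (T.entry x).twice)

/-- The first box of column `i` (if `col` is true; the boxes `(1, i), (2, i), …`) or of row `i`
(if `col` is false; the boxes `(i, i), (i, i + 1), …`) that is not in `T`. -/
def firstEmpty (T : Tableau) (col : Bool) (i : ℤ) : ℤ × ℤ :=
  let pos : ℕ → ℤ × ℤ := fun k => if col then ((k : ℤ) + 1, i) else (i, i + (k : ℤ))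
  pos (((List.range (T.boxes.card + 1)).find? (fun k => pos k ∉ T.boxes)).getD 0)

/-- Switch the primes on the entries in two boxes: nothing changes if both are primed or both are
unprimed, and otherwise both primes are reversed. -/
def switchPrimes (T : Tableau) (x y : ℤ × ℤ) : Tableau :=
  (T.set x ⟨(T.entry x).num, (T.entry y).primed⟩).set y ⟨(T.entry y).num, (T.entry x).primed⟩

/-- The result of an insertion: the new tableau, the box added, and whether the process ends in
column insertion (true) or in row insertion (false). -/
structure Result where
  tableau : Tableau
  box : ℤ × ℤ
  endsInColumn : Bool

/-- The final iteration: `w` is placed in the first empty box of the current segment. -/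
def place (T : Tableau) (col : Bool) (i : ℤ) (w : Letter) : Result :=
  let x := T.firstEmpty col i
  if x.1 = x.2 then ⟨T.set x (Letter.ofInt w.num), x, w.primed⟩ else ⟨T.set x w, x, col⟩

/-- The iterations from the `i`-th one on: `w` is inserted into column `i` (if `col` is true) or
into row `i` (if `col` is false).  The first argument bounds the number of non-final iterations. -/
noncomputable def insertLoop : ℕ → Tableau → Bool → ℤ → Letter → Result
  | 0, T, col, i, w => T.place col i w
  | fuel + 1, T, col, i, w =>
    match T.smallest col i (fun e => w.num ≤ e), T.smallest col i (fun e => w.num < e) with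
    | some m, some M =>
      if m = M then
        if m.1 ≠ m.2 then
          insertLoop fuel (T.set m w) col (i + 1) (T.entry m)
        else
          insertLoop fuel (T.set m (Letter.ofInt w.num)) true (i + 1)
            ⟨(T.entry m).num, w.primed⟩
      else
        insertLoop fuel (T.switchPrimes m M) (decide (m.1 = m.2) || col) (i + 1)
          ⟨w.num + 1, w.primed⟩
    | _, _ => T.place col i w

/-- The insertion of `u` into `T`, beginning with row `1`.  In every non-final iteration `i` some
box of `T` has `i` as a coordinate, so that there are at most `2 * T.boxes.card` of them, and
the bound is never felt. -/
noncomputable def insertLetter (T : Tableau) (u : Letter) : Result :=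
  insertLoop (2 * T.boxes.card) T false 1 u

end Tableau

/-- The pair of the insertion tableau and the recording tableau of a primed word. -/
noncomputable def insertionPair (w : List Letter) : Tableau × Tableau :=
  w.zipIdx.foldl
    (fun PQ uk =>
      let r := PQ.1.insertLetter uk.1
      (r.tableau, PQ.2.set r.box ⟨(uk.2 : ℤ) + 1, r.endsInColumn⟩))
    (Tableau.empty, Tableau.empty)

/-- The insertion tableau `P(w)` of orthogonal Edelman-Greene insertion. -/
noncomputable def insertionTableau (w : List Letter) : Tableau := (insertionPair w).1

/-- The recording tableau `Q(w)` of orthogonal Edelman-Greene insertion. -/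
noncomputable def recordingTableau (w : List Letter) : Tableau := (insertionPair w).2

/-! ### Cycle sequences and the permutation `τ` -/

/-- For a tableau `T` with unprimed entries, a word `b` and a box `x`: the set `γ_k(row(T) b)`,
where `k` is the index of the letter of `row(T)` contributed by `x`, and `∅` if `x` is not a box
of `T`. -/
noncomputable def boxGamma (T : Tableau) (b : List ℤ) (x : ℤ × ℤ) : Finset ℤ :=
  if x ∈ T.boxes then gamma (unprime T.row ++ b) (T.readingOrder.idxOf x) else ∅

/-- The cycle sequence of `(T, b)`: the two-line array with columns `γ_{kk}(T, b), T_{kk}` for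
`k = 1, …, q`, where `q` is the number of rows of `T`. -/
noncomputable def cycleSequence (T : Tableau) (b : List ℤ) : List (Finset ℤ × ℤ) :=
  (List.range T.numRows).map fun k =>
    (boxGamma T b ((k : ℤ) + 1, (k : ℤ) + 1), (T.entry ((k : ℤ) + 1, (k : ℤ) + 1)).num)

/-- `cseq_i(a)`, the cycle sequence of `(P(a_1 ⋯ a_i), a_{i+1} ⋯ a_n)`. -/
noncomputable def cseq (a : List ℤ) (i : ℕ) : List (Finset ℤ × ℤ) :=
  cycleSequence (insertionTableau (ofWord (a.take i))) (a.drop i)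

/-- The permutation determined by two successive cycle sequences
`C = [γ_1 ⋯ γ_q; c_1 ⋯ c_q]` and `D = [η_1 ⋯ η_q; d_1 ⋯ d_q]`.  It is trivial if they are equal or
have different lengths; otherwise it swaps `η_j` and `γ_j`, where `j` is the index with `d_j < c_j`
or with `γ_{j+1} = η_j ≠ γ_j = η_{j+1}`.
Permutations of the set of `2`-element subsets of `ℤ` are extended by the identity to the set of
all finite subsets of `ℤ`. -/
noncomputable def cycleSwap (C D : List (Finset ℤ × ℤ)) : Equiv.Perm (Finset ℤ) :=
  if C = D ∨ C.length ≠ D.length then 1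
  else
    let c : ℕ → Finset ℤ × ℤ := fun j => C.getD j (∅, 0)
    let d : ℕ → Finset ℤ × ℤ := fun j => D.getD j (∅, 0)
    match (List.range C.length).find? (fun j =>
        (d j).2 < (c j).2 ∨
          (j + 1 < C.length ∧ (c (j + 1)).1 = (d j).1 ∧ (d j).1 ≠ (c j).1 ∧
            (c j).1 = (d (j + 1)).1)) with
    | some j => Equiv.swap (d j).1 (c j).1
    | none => 1

/-- `τ(a) = τ_1(a) τ_2(a) ⋯ τ_n(a)`, where `τ_i(a)` is determined by `cseq_{i-1}(a)` and
`cseq_i(a)`. -/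
noncomputable def tau (a : List ℤ) : Equiv.Perm (Finset ℤ) :=
  ((List.range a.length).map fun i => cycleSwap (cseq a i) (cseq a (i + 1))).prod

end ShiftedEG

/-!
Every letter of an involution word `a` is given a label, namely its set `γ_k(a)`, and the proof
follows these labels through the insertion.  A commutation `a_k` creates a cycle of the involution,
`γ_k(a)` is what becomes of this cycle at the end of the word, and distinct commutations have
distinct labels (`IsLabelled.pairwise`).  A set of primes on `a` is therefore the same as a set `S`
of labels, and a primed letter is one whose label lies in `S`.

Labels can be transported along the relations of involution words.  Letters that commute trade
places together with their labels (`IsLabelled.swap`).  In a braid relation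
`(a, L₁) (b, L₂) (a, L₃) → (b, L₃) (a, L₂) (b, L₁)` the outer labels trade places, and `L₂ = ∅`
(`IsLabelled.braid`).  The additional relation `a b ⋯ → b a ⋯` for adjacent letters at the beginning
of the word leaves the label at the first position, and the second label is `∅`
(`IsLabelled.swap_first`).

An insertion is a sequence of such relations on the word that consists of the entries of the
tableau, read by rows during row insertion and by columns during column insertion, of the inserted
letter at the appropriate position, and of the letters to come (`RowState`, `ColState`).  Away from
the main diagonal, a bump is a sequence of commutations, and the switch of the primes of two entries
is a braid relation; so the labels move in the same way as the primes do.  On the diagonal,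
where the insertion tableau has no primes, this fails in two cases.

* If a diagonal entry `m` is replaced by a smaller `w` (`RowState.bump_diagonal`), these
  two letters can be read first, so that the word begins with `m w`.  If `m = w + 1`, the label
  stays in its box.  Otherwise the two letters commute, and both of them move with their labels,
  which are cycles; but `m` leaves with the prime of `w`, as if the label had stayed in the box.
* If `w` equals the diagonal entry, then `w, w + 1, w + 2` are consecutive entries of the tableau,
  and after two iterations the cycles of two diagonal boxes are exchanged, although no entry and no
  prime changes (`RowState.cross_diagonal`).

The transposition `σ` of cycles that accounts for the difference is the permutation `τ_i` read off
from the cycle sequences (`DiagonalStep.cycleSwap_eq`), so primes that indicate membership in `S`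
before the insertion indicate membership in the inverse image of `S` under `τ_i` afterwards
(`InsertionSpec`).  At the end, this is the inverse image of the set of marked cycles under `τ(a)`
(`exists_inserted`).  The prime that a diagonal box would have is recorded in the recording tableau
when the box is added.
-/

namespace ShiftedEG

open Tableau

/-! ### Labelled words -/

theorem s_apply (i x : ℤ) : s i x = if x = i then i + 1 else if x = i + 1 then i else x :=
  Equiv.swap_apply_def _ _ _

theorem s_s (i x : ℤ) : s i (s i x) = x := Equiv.swap_apply_self _ _ _

/-- The action of `s_i` in a form suited to linear arithmetic. -/
theorem s_spec (i x : ℤ) : (x = i ∧ s i x = i + 1) ∨ (x = i + 1 ∧ s i x = i) ∨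
    (x ≠ i ∧ x ≠ i + 1 ∧ s i x = x) := by
  rw [s_apply]; split_ifs <;> omega

theorem s_left (i : ℤ) : s i i = i + 1 := Equiv.swap_apply_left _ _

theorem s_right (i : ℤ) : s i (i + 1) = i := Equiv.swap_apply_right _ _

theorem s_succ_self (i : ℤ) : s (i + 1) i = i := by rw [s_apply]; split_ifs <;> omega

theorem s_succ_succ (i : ℤ) : s i (i + 1 + 1) = i + 1 + 1 := by rw [s_apply]; split_ifs <;> omega

theorem s_lt_iff (i u v : ℤ) :
    s i u < s i v ↔ (u < v ∧ ¬(u = i ∧ v = i + 1)) ∨ (u = i + 1 ∧ v = i) := by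
  rw [s_apply, s_apply]; split_ifs <;> omega

theorem s_eq_iff (i u v : ℤ) : s i u = v ↔ u = s i v := by
  constructor
  · rintro rfl; rw [s_s]
  · rintro rfl; rw [s_s]

/-- The successor of the involution `y` when the letter `j` is appended to an involution word
for `y`; it agrees with `s_j ∘ y ∘ s_j` when `y j < y (j + 1)`. -/
def next (y : Equiv.Perm ℤ) (j : ℤ) : Equiv.Perm ℤ :=
  if y j = j ∧ y (j + 1) = j + 1 then y * s j else s j * y * s j

/-- The cycle created by appending the letter `j` to an involution word for `y`, or `∅` if this
letter is not a commutation. -/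
def newCycle (y : Equiv.Perm ℤ) (j : ℤ) : Finset ℤ :=
  if y j = j ∧ y (j + 1) = j + 1 then {j, j + 1} else ∅

/-- The image of the set `L` under the product of simple transpositions that carries a cycle
created just before the letters `v` to a cycle of the final involution. -/
def transport (v : List ℤ) (L : Finset ℤ) : Finset ℤ :=
  v.foldl (fun S j => S.image (s j)) L

/-- `IsLabelled y W` says that the letters of `W`, appended one by one to an involution word for
`y`, increase the length at each step, and that each letter is labelled by its set `γ`.  For
`y = 1` the letters form an involution word. -/
def IsLabelled : Equiv.Perm ℤ → List (ℤ × Finset ℤ) → Prop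
  | _, [] => True
  | y, (j, L) :: W =>
    y j < y (j + 1) ∧ L = transport (W.map Prod.fst) (newCycle y j) ∧ IsLabelled (next y j) W

theorem transport_cons (j : ℤ) (v : List ℤ) (L : Finset ℤ) :
    transport (j :: v) L = transport v (L.image (s j)) := rfl

theorem transport_empty (v : List ℤ) : transport v ∅ = ∅ := by
  induction v with
  | nil => rfl
  | cons j v ih => rw [transport_cons, Finset.image_empty, ih]

theorem transport_injective (v : List ℤ) : Function.Injective (transport v) := by
  induction v with
  | nil => exact fun _ _ h => h
  | cons j v ih =>
    intro L L' h
    rw [transport_cons, transport_cons] at h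
    exact Finset.image_injective (s j).injective (ih h)

theorem next_involutive {y : Equiv.Perm ℤ} (hy : Function.Involutive y) (j : ℤ) :
    Function.Involutive (next y j) := by
  intro x
  unfold next
  split_ifs with h
  · simp only [Equiv.Perm.mul_apply]
    have hj := hy x
    by_cases h1 : x = j
    · subst h1; simp [s_apply, h.1, h.2]
    by_cases h2 : x = j + 1
    · subst h2; simp [s_apply, h.1, h.2]
    have e1 : s j x = x := by simp [s_apply, h1, h2]
    have n1 : y x ≠ j := fun e => h1 (by rw [← hj, e, h.1])
    have n2 : y x ≠ j + 1 := fun e => h2 (by rw [← hj, e, h.2])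
    have e2 : s j (y x) = y x := by simp [s_apply, n1, n2]
    rw [e1, e2, hj]
  · simp only [Equiv.Perm.mul_apply, s_s, hy (s j x)]

/-- Letters that differ by at least `2`. -/
def Far (a b : ℤ) : Prop := a + 2 ≤ b ∨ b + 2 ≤ a

theorem Far.symm {a b : ℤ} (h : Far a b) : Far b a := Or.symm h

theorem s_comm {a b : ℤ} (h : Far a b) : s a * s b = s b * s a := by
  ext x
  simp only [Equiv.Perm.mul_apply, s_apply]
  unfold Far at h
  split_ifs <;> omega

theorem image_comm {a b : ℤ} (h : Far a b) (L : Finset ℤ) :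
    (L.image (s a)).image (s b) = (L.image (s b)).image (s a) := by
  rw [Finset.image_image, Finset.image_image, ← Equiv.Perm.coe_mul, ← Equiv.Perm.coe_mul, s_comm h]

theorem s_braid {a b : ℤ} (h : b = a + 1 ∨ a = b + 1) : s a * s b * s a = s b * s a * s b := by
  have key : ∀ i : ℤ, s i * s (i + 1) * s i = s (i + 1) * s i * s (i + 1) := by
    intro i
    ext x
    simp only [Equiv.Perm.mul_apply]
    have S1 := s_spec i x
    have S2 := s_spec (i + 1) (s i x)
    have S3 := s_spec i (s (i + 1) (s i x))
    have S4 := s_spec (i + 1) x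
    have S5 := s_spec i (s (i + 1) x)
    have S6 := s_spec (i + 1) (s i (s (i + 1) x))
    rcases S1 with S1 | S1 | S1 <;> rcases S4 with S4 | S4 | S4 <;> omega
  rcases h with rfl | rfl
  · exact key a
  · exact (key b).symm

theorem image_braid {a b : ℤ} (h : b = a + 1 ∨ a = b + 1) (L : Finset ℤ) :
    ((L.image (s a)).image (s b)).image (s a) = ((L.image (s b)).image (s a)).image (s b) := by
  simp only [Finset.image_image, ← Equiv.Perm.coe_mul]
  rw [← mul_assoc, ← mul_assoc, s_braid h]

section Commutation

variable {y : Equiv.Perm ℤ} {a b : ℤ}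

theorem next_fixes_iff_of_far (h : Far a b) :
    (next y a b = b ∧ next y a (b + 1) = b + 1) ↔ (y b = b ∧ y (b + 1) = b + 1) := by
  have e1 : s a b = b := by unfold Far at h; rw [s_apply]; split_ifs <;> omega
  have e2 : s a (b + 1) = b + 1 := by unfold Far at h; rw [s_apply]; split_ifs <;> omega
  have key : ∀ x, s a x = x → (s a (y x) = x ↔ y x = x) := fun x hx => by
    constructor
    · intro hh; rw [← s_s a (y x), hh, hx]
    · intro hh; rw [hh, hx]
  unfold next
  split_ifs
  · simp only [Equiv.Perm.mul_apply, e1, e2]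
  · simp only [Equiv.Perm.mul_apply, e1, e2, key b e1, key _ e2]

theorem newCycle_next_of_far (h : Far a b) : newCycle (next y a) b = newCycle y b := by
  unfold newCycle
  simp only [next_fixes_iff_of_far h]

theorem image_newCycle_of_far (h : Far a b) : (newCycle y b).image (s a) = newCycle y b := by
  unfold newCycle
  split_ifs
  · unfold Far at h
    have e1 : s a b = b := by rw [s_apply]; split_ifs <;> omega
    have e2 : s a (b + 1) = b + 1 := by rw [s_apply]; split_ifs <;> omega
    simp [e1, e2]
  · rfl

theorem next_comm (h : Far a b) : next (next y a) b = next (next y b) a := by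
  have h1 := next_fixes_iff_of_far (y := y) h
  have h2 := next_fixes_iff_of_far (y := y) h.symm
  have c := s_comm h
  conv_lhs => rw [next]
  conv_rhs => rw [next]
  simp only [h1, h2]
  unfold next
  split_ifs
  · rw [mul_assoc, c, mul_assoc]
  · simp only [mul_assoc, c]
  · simp only [mul_assoc, c]
  · rw [show s b * (s a * y * s a) * s b = (s b * s a) * y * (s a * s b) by group, c,
      show s a * (s b * y * s b) * s a = (s a * s b) * y * (s b * s a) by group, c]

theorem ascent_of_far (hy : Function.Involutive y) (h : Far a b) (ha : y a < y (a + 1))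
    (hb : next y a b < next y a (b + 1)) : y b < y (b + 1) := by
  have e1 : s a b = b := by unfold Far at h; rw [s_apply]; split_ifs <;> omega
  have e2 : s a (b + 1) = b + 1 := by unfold Far at h; rw [s_apply]; split_ifs <;> omega
  unfold next at hb
  split_ifs at hb with hf
  · simpa only [Equiv.Perm.mul_apply, e1, e2] using hb
  · simp only [Equiv.Perm.mul_apply, e1, e2] at hb
    have i1 := hy b
    have i2 := hy (b + 1)
    rw [s_apply, s_apply] at hb
    split_ifs at hb with c1 c2 c3 c4 c5 c6
    all_goals first
      | omega
      | (exfalso; simp only [*] at i1 i2; omega)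

theorem ascent_next_of_far (hy : Function.Involutive y) (h : Far a b) (ha : y a < y (a + 1))
    (hb : next y a b < next y a (b + 1)) : next y b a < next y b (a + 1) := by
  have e1 : s a b = b := by unfold Far at h; rw [s_apply]; split_ifs <;> omega
  have e2 : s a (b + 1) = b + 1 := by unfold Far at h; rw [s_apply]; split_ifs <;> omega
  have d1 : s b a = a := by unfold Far at h; rw [s_apply]; split_ifs <;> omega
  have d2 : s b (a + 1) = a + 1 := by unfold Far at h; rw [s_apply]; split_ifs <;> omega
  have i1 := hy a
  have i2 := hy (a + 1)
  have hb' := ascent_of_far hy h ha hb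
  by_cases c : y a = b ∧ y (a + 1) = b + 1
  · -- here `y` exchanges `a, b` and `a + 1, b + 1`, so that it loses its ascent at `b`
    exfalso
    rw [c.1] at i1
    rw [c.2] at i2
    have hf : ¬(y a = a ∧ y (a + 1) = a + 1) := by rw [c.1]; unfold Far at h; omega
    unfold next at hb
    rw [if_neg hf] at hb
    simp only [Equiv.Perm.mul_apply, e1, e2, i1, i2] at hb
    simp [s_apply] at hb
  · unfold next
    split_ifs with hf
    · simpa only [Equiv.Perm.mul_apply, d1, d2] using ha
    · simp only [Equiv.Perm.mul_apply, d1, d2]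
      rw [s_apply, s_apply]
      split_ifs <;> omega

end Commutation

section Braid

variable {y : Equiv.Perm ℤ} {i : ℤ}

theorem next_apply_of_fixes (h : y i = i ∧ y (i + 1) = i + 1) (x : ℤ) :
    next y i x = y (s i x) := by
  rw [next, if_pos h, Equiv.Perm.mul_apply]

theorem next_apply_of_not_fixes (h : ¬(y i = i ∧ y (i + 1) = i + 1)) (x : ℤ) :
    next y i x = s i (y (s i x)) := by
  rw [next, if_neg h, Equiv.Perm.mul_apply, Equiv.Perm.mul_apply]

/-- The ways in which an involution can map a set of three consecutive integers to itself,
expressed in a form suited to linear arithmetic. -/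
theorem involutive_triple (hy : Function.Involutive y) (i : ℤ) :
    (y i = i + 1 ↔ y (i + 1) = i) ∧ (y i = i + 1 + 1 ↔ y (i + 1 + 1) = i) ∧
      (y (i + 1) = i + 1 + 1 ↔ y (i + 1 + 1) = i + 1) ∧ y i ≠ y (i + 1) ∧
      y i ≠ y (i + 1 + 1) ∧ y (i + 1) ≠ y (i + 1 + 1) := by
  have key : ∀ u v, y u = v ↔ y v = u :=
    fun u v => ⟨fun h => by rw [← h, hy], fun h => by rw [← h, hy]⟩
  refine ⟨key _ _, key _ _, key _ _, ?_, ?_, ?_⟩ <;> exact fun h => by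
    have := y.injective h
    omega

/-- `i, i + 1, i` can be appended exactly if the values of `y` at `i, i + 1, i + 2` increase
and are not all fixed. -/
theorem ascents_braid_iff (hy : Function.Involutive y) :
    (y i < y (i + 1) ∧ next y i (i + 1) < next y i (i + 1 + 1) ∧
      next (next y i) (i + 1) i < next (next y i) (i + 1) (i + 1)) ↔
    (y i < y (i + 1) ∧ y (i + 1) < y (i + 1 + 1) ∧
      ¬(y i = i ∧ y (i + 1) = i + 1 ∧ y (i + 1 + 1) = i + 1 + 1)) := by
  have ht := involutive_triple hy i
  by_cases F : y i = i ∧ y (i + 1) = i + 1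
  · have G : ¬(next y i (i + 1) = i + 1 ∧ next y i (i + 1 + 1) = i + 1 + 1) := by
      rw [next_apply_of_fixes F, s_right]; omega
    simp only [next_apply_of_not_fixes G, next_apply_of_fixes F, s_left, s_right, s_succ_self,
      s_succ_succ, s_lt_iff]
    clear G
    omega
  · by_cases G : next y i (i + 1) = i + 1 ∧ next y i (i + 1 + 1) = i + 1 + 1
    · have G' := G
      simp only [next_apply_of_not_fixes F, s_right, s_succ_succ, s_eq_iff] at G'
      simp only [next_apply_of_fixes G, next_apply_of_not_fixes F, s_left, s_right, s_succ_self,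
        s_succ_succ, s_lt_iff]
      clear G
      omega
    · simp only [next_apply_of_not_fixes G, next_apply_of_not_fixes F, s_left, s_right,
        s_succ_self, s_succ_succ, s_lt_iff, s_eq_iff]
      clear G
      omega

/-- `i + 1, i, i + 1` can be appended under the same condition as `i, i + 1, i`. -/
theorem ascents_braid_iff' (hy : Function.Involutive y) :
    (y (i + 1) < y (i + 1 + 1) ∧ next y (i + 1) i < next y (i + 1) (i + 1) ∧
      next (next y (i + 1)) i (i + 1) < next (next y (i + 1)) i (i + 1 + 1)) ↔
    (y i < y (i + 1) ∧ y (i + 1) < y (i + 1 + 1) ∧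
      ¬(y i = i ∧ y (i + 1) = i + 1 ∧ y (i + 1 + 1) = i + 1 + 1)) := by
  have ht := involutive_triple hy i
  by_cases F : y (i + 1) = i + 1 ∧ y (i + 1 + 1) = i + 1 + 1
  · have G : ¬(next y (i + 1) i = i ∧ next y (i + 1) (i + 1) = i + 1) := by
      rw [next_apply_of_fixes F, next_apply_of_fixes F, s_left]; omega
    simp only [next_apply_of_not_fixes G, next_apply_of_fixes F, s_left, s_right, s_succ_self,
      s_succ_succ, s_lt_iff]
    clear G
    omega
  · by_cases G : next y (i + 1) i = i ∧ next y (i + 1) (i + 1) = i + 1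
    · have G' := G
      simp only [next_apply_of_not_fixes F, s_left, s_succ_self, s_eq_iff] at G'
      simp only [next_apply_of_fixes G, next_apply_of_not_fixes F, s_left, s_right, s_succ_self,
        s_succ_succ, s_lt_iff]
      clear G
      omega
    · simp only [next_apply_of_not_fixes G, next_apply_of_not_fixes F, s_left, s_right,
        s_succ_self, s_succ_succ, s_lt_iff, s_eq_iff]
      clear G
      omega

/-- When `i, i + 1, i` can be appended, the second letter is not a commutation, and the first and
the last one are commutations in the same cases as the last and the first letter of
`i + 1, i, i + 1`. -/
theorem next_braid (hy : Function.Involutive y)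
    (h : y i < y (i + 1) ∧ y (i + 1) < y (i + 1 + 1) ∧
      ¬(y i = i ∧ y (i + 1) = i + 1 ∧ y (i + 1 + 1) = i + 1 + 1)) :
    newCycle (next y i) (i + 1) = ∅ ∧ newCycle (next y (i + 1)) i = ∅ ∧
      (newCycle (next (next y i) (i + 1)) i =
        if y (i + 1) = i + 1 ∧ y (i + 1 + 1) = i + 1 + 1 then {i, i + 1} else ∅) ∧
      (newCycle (next (next y (i + 1)) i) (i + 1) =
        if y i = i ∧ y (i + 1) = i + 1 then {i + 1, i + 1 + 1} else ∅) ∧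
      next (next (next y i) (i + 1)) i = next (next (next y (i + 1)) i) (i + 1) := by
  have ht := involutive_triple hy i
  have G : ¬(next y i (i + 1) = i + 1 ∧ next y i (i + 1 + 1) = i + 1 + 1) := by
    by_cases F : y i = i ∧ y (i + 1) = i + 1
    · simp only [next_apply_of_fixes F, s_right, s_succ_succ]
      omega
    · simp only [next_apply_of_not_fixes F, s_right, s_succ_succ, s_eq_iff]
      omega
  have G' : ¬(next y (i + 1) i = i ∧ next y (i + 1) (i + 1) = i + 1) := by
    by_cases F : y (i + 1) = i + 1 ∧ y (i + 1 + 1) = i + 1 + 1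
    · simp only [next_apply_of_fixes F, s_left, s_succ_self]
      omega
    · simp only [next_apply_of_not_fixes F, s_left, s_succ_self, s_eq_iff]
      omega
  have H : (next (next y i) (i + 1) i = i ∧ next (next y i) (i + 1) (i + 1) = i + 1) ↔
      y (i + 1) = i + 1 ∧ y (i + 1 + 1) = i + 1 + 1 := by
    by_cases F : y i = i ∧ y (i + 1) = i + 1
    · simp only [next_apply_of_not_fixes G, next_apply_of_fixes F, s_left, s_succ_self,
        s_succ_succ, s_eq_iff]
      omega
    · simp only [next_apply_of_not_fixes G, next_apply_of_not_fixes F, s_left,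
        s_succ_self, s_succ_succ, s_eq_iff]
  have H' : (next (next y (i + 1)) i (i + 1) = i + 1 ∧
      next (next y (i + 1)) i (i + 1 + 1) = i + 1 + 1) ↔ y i = i ∧ y (i + 1) = i + 1 := by
    by_cases F : y (i + 1) = i + 1 ∧ y (i + 1 + 1) = i + 1 + 1
    · simp only [next_apply_of_not_fixes G', next_apply_of_fixes F, s_right, s_succ_self,
        s_succ_succ, s_eq_iff]
      omega
    · simp only [next_apply_of_not_fixes G', next_apply_of_not_fixes F, s_right,
        s_succ_self, s_succ_succ, s_eq_iff]
  refine ⟨if_neg G, if_neg G', ?_, ?_, ?_⟩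
  · unfold newCycle
    simp only [H]
  · unfold newCycle
    simp only [H']
  · have c : s i * s (i + 1) * s i = s (i + 1) * s i * s (i + 1) := s_braid (Or.inl rfl)
    conv_lhs => rw [next]
    conv_rhs => rw [next]
    simp only [H, H']
    rw [show next (next y i) (i + 1) = s (i + 1) * next y i * s (i + 1) from if_neg G,
      show next (next y (i + 1)) i = s i * next y (i + 1) * s i from if_neg G']
    unfold next
    by_cases F : y i = i ∧ y (i + 1) = i + 1 <;>
      by_cases F' : y (i + 1) = i + 1 ∧ y (i + 1 + 1) = i + 1 + 1
    · omega
    · simp only [if_pos F, if_neg F']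
      calc _ = (s i * s (i + 1)) * y * (s i * s (i + 1) * s i) := by group
        _ = _ := by rw [c]; group
    · simp only [if_neg F, if_pos F']
      calc _ = (s (i + 1) * s i) * y * (s i * s (i + 1) * s i) := by group
        _ = _ := by rw [c]; group
    · simp only [if_neg F, if_neg F']
      calc _ = (s i * s (i + 1) * s i) * y * (s i * s (i + 1) * s i) := by group
        _ = _ := by rw [c]; group

theorem image_image_pair (i : ℤ) :
    (({i + 1, i + 1 + 1} : Finset ℤ).image (s i)).image (s (i + 1)) = {i, i + 1} := by
  simp [Finset.image_insert, s_right, s_succ_succ, s_succ_self]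

theorem image_image_pair' (i : ℤ) :
    (({i, i + 1} : Finset ℤ).image (s (i + 1))).image (s i) = {i + 1, i + 1 + 1} := by
  simp [Finset.image_insert, s_left, s_succ_succ, s_succ_self]

end Braid

/-! ### Relations between labelled words -/

section Moves

variable {y : Equiv.Perm ℤ} {a b : ℤ} {L₁ L₂ L₃ : Finset ℤ} {W : List (ℤ × Finset ℤ)}

theorem IsLabelled.swap (hy : Function.Involutive y) (h : Far a b)
    (H : IsLabelled y ((a, L₁) :: (b, L₂) :: W)) : IsLabelled y ((b, L₂) :: (a, L₁) :: W) := by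
  simp only [IsLabelled, List.map_cons, transport_cons] at H ⊢
  obtain ⟨ha, h1, hb, h2, h3⟩ := H
  refine ⟨ascent_of_far hy h ha hb, ?_, ascent_next_of_far hy h ha hb, ?_, ?_⟩
  · rw [h2, newCycle_next_of_far h, image_newCycle_of_far h]
  · rw [h1, newCycle_next_of_far h.symm, image_newCycle_of_far h.symm]
  · rwa [← next_comm h]

theorem IsLabelled.braid (hy : Function.Involutive y) (h : b = a + 1 ∨ a = b + 1)
    (H : IsLabelled y ((a, L₁) :: (b, L₂) :: (a, L₃) :: W)) :
    IsLabelled y ((b, L₃) :: (a, L₂) :: (b, L₁) :: W) := by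
  simp only [IsLabelled, List.map_cons, transport_cons] at H ⊢
  obtain ⟨ha, h1, hb, h2, hc, h3, h4⟩ := H
  rcases h with rfl | rfl
  · have hh := (ascents_braid_iff hy).1 ⟨ha, hb, hc⟩
    have hh' := (ascents_braid_iff' hy).2 hh
    obtain ⟨e1, e2, e3, e4, e5⟩ := next_braid hy hh
    refine ⟨hh'.1, ?_, hh'.2.1, ?_, hh'.2.2, ?_, ?_⟩
    · rw [h3, e3, newCycle]
      split_ifs
      · rw [image_image_pair]
      · simp
    · rw [h2, e1, e2, Finset.image_empty, Finset.image_empty]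
    · rw [h1, e4, newCycle]
      split_ifs
      · rw [image_image_pair']
      · simp
    · rwa [← e5]
  · have hh := (ascents_braid_iff' hy).1 ⟨ha, hb, hc⟩
    have hh' := (ascents_braid_iff hy).2 hh
    obtain ⟨e1, e2, e3, e4, e5⟩ := next_braid hy hh
    refine ⟨hh'.1, ?_, hh'.2.1, ?_, hh'.2.2, ?_, ?_⟩
    · rw [h3, e4, newCycle]
      split_ifs
      · rw [image_image_pair']
      · simp
    · rw [h2, e1, e2, Finset.image_empty, Finset.image_empty]
    · rw [h1, e3, newCycle]
      split_ifs
      · rw [image_image_pair]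
      · simp
    · rwa [e5]

theorem one_involutive : Function.Involutive (1 : Equiv.Perm ℤ) := fun _ => rfl

theorem next_one (a : ℤ) : next 1 a = s a := by simp [next]

theorem newCycle_one (a : ℤ) : newCycle 1 a = {a, a + 1} := by simp [newCycle]

/-- The relation between the first two letters that holds for involution words in addition to the
Coxeter relations.  The cycle of the first letter stays at the first position. -/
theorem IsLabelled.swap_first (h : b = a + 1 ∨ a = b + 1)
    (H : IsLabelled 1 ((a, L₁) :: (b, L₂) :: W)) :
    L₂ = ∅ ∧ IsLabelled 1 ((b, L₁) :: (a, ∅) :: W) := by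
  simp only [IsLabelled, List.map_cons, transport_cons, next_one, newCycle_one] at H ⊢
  obtain ⟨-, h1, -, h2, h3⟩ := H
  have c : newCycle (s a) b = ∅ := by
    rw [newCycle, if_neg]
    rcases h with rfl | rfl
    · rw [s_right]; omega
    · rw [s_left]; omega
  have c' : newCycle (s b) a = ∅ := by
    rw [newCycle, if_neg]
    rcases h with rfl | rfl
    · rw [s_left]; omega
    · rw [s_right]; omega
  rw [c, transport_empty] at h2
  refine ⟨h2, by simp, ?_, ?_, ?_, ?_⟩
  · rw [h1]
    rcases h with rfl | rfl <;>
      simp [Finset.image_insert, s_left, s_right, s_succ_self, s_succ_succ, Finset.pair_comm]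
  · rcases h with rfl | rfl
    · rw [s_succ_self, s_left]; omega
    · rw [s_right, s_succ_succ]; omega
  · rw [c', transport_empty]
  · have e : next (s b) a = next (s a) b := by
      unfold newCycle at c c'
      rw [next, next, if_neg, if_neg, s_braid h]
      · intro hh; rw [if_pos hh] at c; simp at c
      · intro hh; rw [if_pos hh] at c'; simp at c'
    rwa [e]

theorem transport_ne_empty {v : List ℤ} {L : Finset ℤ} (h : L ≠ ∅) : transport v L ≠ ∅ := by
  rw [← transport_empty v]
  exact fun e => h (transport_injective v e)

theorem IsLabelled.first_ne_empty (H : IsLabelled 1 ((a, L₁) :: W)) : L₁ ≠ ∅ := by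
  obtain ⟨-, rfl, -⟩ := H
  exact transport_ne_empty (by simp [newCycle_one])

theorem IsLabelled.not_adjacent_eq : ¬IsLabelled y ((a, L₁) :: (a, L₂) :: W) := by
  rintro ⟨h1, -, h2, -⟩
  by_cases F : y a = a ∧ y (a + 1) = a + 1
  · rw [next_apply_of_fixes F, next_apply_of_fixes F, s_left, s_right] at h2
    omega
  · rw [next_apply_of_not_fixes F, next_apply_of_not_fixes F, s_left, s_right, s_lt_iff] at h2
    omega

/-- Starting from the identity, all of `i, i + 1, i + 2` are fixed, and the third letter does not
increase the length. -/
theorem IsLabelled.not_first_braid (h : b = a + 1 ∨ a = b + 1) :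
    ¬IsLabelled 1 ((a, L₁) :: (b, L₂) :: (a, L₃) :: W) := by
  rintro ⟨h1, -, h2, -, h3, -⟩
  rcases h with rfl | rfl
  · have := (ascents_braid_iff one_involutive).1 ⟨h1, h2, h3⟩
    simp at this
  · have := (ascents_braid_iff' one_involutive).1 ⟨h1, h2, h3⟩
    simp at this

/-- Replacing the labelled word `W` by `W'` is legitimate at the end of any labelled word. -/
def Refines (W W' : List (ℤ × Finset ℤ)) : Prop :=
  transport (W.map Prod.fst) = transport (W'.map Prod.fst) ∧
    ∀ y : Equiv.Perm ℤ, Function.Involutive y → IsLabelled y W → IsLabelled y W'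

theorem Refines.refl (W : List (ℤ × Finset ℤ)) : Refines W W := ⟨rfl, fun _ _ h => h⟩

theorem Refines.trans {W₁ W₂ W₃ : List (ℤ × Finset ℤ)} (h : Refines W₁ W₂) (h' : Refines W₂ W₃) :
    Refines W₁ W₃ := ⟨h.1.trans h'.1, fun y hy H => h'.2 y hy (h.2 y hy H)⟩

theorem Refines.cons {W' : List (ℤ × Finset ℤ)} (h : Refines W W') (u : ℤ × Finset ℤ) :
    Refines (u :: W) (u :: W') := by
  refine ⟨?_, ?_⟩
  · ext1 L
    simp only [List.map_cons, transport_cons, h.1]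
  · rintro y hy ⟨h1, h2, h3⟩
    exact ⟨h1, by rw [← h.1]; exact h2, h.2 _ (next_involutive hy _) h3⟩

theorem Refines.append_left {W' : List (ℤ × Finset ℤ)} (h : Refines W W')
    (U : List (ℤ × Finset ℤ)) : Refines (U ++ W) (U ++ W') := by
  induction U with
  | nil => exact h
  | cons u U ih => exact ih.cons u

theorem Refines.swap {u v : ℤ × Finset ℤ} (h : Far u.1 v.1) :
    Refines (u :: v :: W) (v :: u :: W) := by
  refine ⟨?_, fun y hy H => IsLabelled.swap hy h H⟩
  ext1 L
  simp only [List.map_cons, transport_cons, image_comm h]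

theorem Refines.braid (h : b = a + 1 ∨ a = b + 1) :
    Refines ((a, L₁) :: (b, L₂) :: (a, L₃) :: W) ((b, L₃) :: (a, L₂) :: (b, L₁) :: W) := by
  refine ⟨?_, fun y hy H => IsLabelled.braid hy h H⟩
  ext1 L
  simp only [List.map_cons, transport_cons, image_braid h]

theorem IsLabelled.exists_of_append {U : List (ℤ × Finset ℤ)} (hy : Function.Involutive y)
    (H : IsLabelled y (U ++ W)) :
    ∃ y' : Equiv.Perm ℤ, Function.Involutive y' ∧ IsLabelled y' W := by
  induction U generalizing y with
  | nil => exact ⟨y, hy, H⟩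
  | cons u U ih => exact ih (next_involutive hy _) H.2.2

/-- The second letter could come first, so that it is a commutation. -/
theorem IsLabelled.second_ne_empty (h : Far a b) (H : IsLabelled 1 ((a, L₁) :: (b, L₂) :: W)) :
    L₂ ≠ ∅ :=
  (H.swap one_involutive h).first_ne_empty

/-- The word identity behind an insertion that passes through the diagonal boxes with entries `w`
and `w + 2`: the two cycles are exchanged. -/
theorem IsLabelled.cross_diagonal {w : ℤ} {A B C E : Finset ℤ}
    (H : IsLabelled 1 ((w + 2, A) :: (w, B) :: (w + 1, C) :: (w, E) :: W)) :
    A ≠ ∅ ∧ B ≠ ∅ ∧ C = ∅ ∧ E = ∅ ∧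
      IsLabelled 1 ((w, A) :: (w + 2, B) :: (w + 1, ∅) :: (w + 2, ∅) :: W) := by
  have hA := H.first_ne_empty
  have hB := H.second_ne_empty (Or.inr (le_refl _))
  have H1 := ((Refines.braid (W := W) (L₁ := B) (L₂ := C) (L₃ := E)
    (Or.inl (rfl : w + 1 = w + 1))).cons (w + 2, A)).2 1 one_involutive H
  obtain ⟨rfl, H2⟩ := H1.swap_first (Or.inr (by ring))
  have H3 := ((Refines.swap (u := (w + 2, ∅)) (v := (w, C)) (W := (w + 1, B) :: W)
    (Or.inr (le_refl _))).cons (w + 1, A)).2 1 one_involutive H2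
  obtain ⟨rfl, H4⟩ := H3.swap_first (Or.inr rfl)
  exact ⟨hA, hB, rfl, rfl, ((Refines.braid (W := W) (L₁ := ∅) (L₂ := ∅) (L₃ := B)
    (Or.inl (by ring : w + 2 = w + 1 + 1))).cons (w, A)).2 1 one_involutive H4⟩

/-- The word identity behind a change of the diagonal entry `m` to `w`. -/
theorem IsLabelled.bump_diagonal {w m : ℤ} {G ℓ : Finset ℤ} (h : w < m)
    (H : IsLabelled 1 ((m, G) :: (w, ℓ) :: W)) :
    (ℓ = ∅ ∧ IsLabelled 1 ((w, G) :: (m, ∅) :: W)) ∨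
      (G ≠ ∅ ∧ ℓ ≠ ∅ ∧ IsLabelled 1 ((w, ℓ) :: (m, G) :: W)) := by
  by_cases e : m = w + 1
  · exact Or.inl (H.swap_first (Or.inr e))
  · have f : Far m w := Or.inr (by omega)
    exact Or.inr ⟨H.first_ne_empty, H.second_ne_empty f, H.swap one_involutive f⟩

end Moves

section Labels

variable {y : Equiv.Perm ℤ} {W : List (ℤ × Finset ℤ)}

/-- A cycle of `y` is carried to a cycle that is not created later. -/
theorem IsLabelled.transport_not_mem (hy : Function.Involutive y) (H : IsLabelled y W) {p q : ℤ}
    (hpq : y p = q) (hne : p ≠ q) :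
    ∀ u ∈ W, u.2 ≠ transport (W.map Prod.fst) {p, q} := by
  induction W generalizing y p q with
  | nil => simp
  | cons v W ih =>
    obtain ⟨j, L⟩ := v
    obtain ⟨h1, h2, h3⟩ := H
    have hqp : y q = p := by rw [← hpq, hy]
    have key : next y j (s j p) = s j q ∧ newCycle y j ≠ ({p, q} : Finset ℤ).image (s j) := by
      by_cases F : y j = j ∧ y (j + 1) = j + 1
      · have p1 : p ≠ j := by rintro rfl; omega
        have p2 : p ≠ j + 1 := by rintro rfl; omega
        have q1 : q ≠ j := by rintro rfl; omega
        have q2 : q ≠ j + 1 := by rintro rfl; omega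
        have e1 : s j p = p := by simp [s_apply, p1, p2]
        have e2 : s j q = q := by simp [s_apply, q1, q2]
        rw [next_apply_of_fixes F, s_s, e2, hpq, newCycle, if_pos F]
        refine ⟨rfl, ?_⟩
        simp only [Finset.image_insert, Finset.image_singleton, e1, e2]
        intro e
        have : j ∈ ({p, q} : Finset ℤ) := e ▸ Finset.mem_insert_self _ _
        simp only [Finset.mem_insert, Finset.mem_singleton] at this
        omega
      · rw [next_apply_of_not_fixes F, s_s, hpq, newCycle, if_neg F]
        exact ⟨rfl, fun e => by simpa using e.symm⟩
    intro u hu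
    simp only [List.map_cons, transport_cons]
    rcases List.mem_cons.1 hu with rfl | hu
    · rw [h2]
      exact fun e => key.2 (transport_injective _ e)
    · have := ih (next_involutive hy j) h3 key.1 (fun e => hne ((s j).injective e)) u hu
      simpa only [Finset.image_insert, Finset.image_singleton] using this

/-- Distinct commutations have distinct cycles. -/
theorem IsLabelled.pairwise (hy : Function.Involutive y) (H : IsLabelled y W) :
    W.Pairwise fun u v => u.2 ≠ ∅ → u.2 ≠ v.2 := by
  induction W generalizing y with
  | nil => exact List.Pairwise.nil
  | cons v W ih =>
    obtain ⟨j, L⟩ := v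
    obtain ⟨h1, h2, h3⟩ := H
    refine List.Pairwise.cons (fun u hu hL => ?_) (ih (next_involutive hy j) h3)
    simp only at hL ⊢
    by_cases F : y j = j ∧ y (j + 1) = j + 1
    · rw [newCycle, if_pos F] at h2
      rw [h2]
      refine (h3.transport_not_mem (next_involutive hy j) ?_ (by omega) u hu).symm
      rw [next_apply_of_fixes F, s_left, F.2]
    · rw [newCycle, if_neg F, transport_empty] at h2
      exact absurd h2 hL

end Labels

/-! ### Involution words and their cycles -/

theorem demazure_of_ascent {y : Equiv.Perm ℤ} (hy : Function.Involutive y) {j : ℤ}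
    (h : y j < y (j + 1)) : demazureRight (demazureLeft j y) j = next y j := by
  have hi : y⁻¹ = y := by
    ext x
    rw [Equiv.Perm.inv_eq_iff_eq, hy]
  have ht : (y j = j + 1 ↔ y (j + 1) = j) :=
    ⟨fun h => by rw [← h, hy], fun h => by rw [← hy (j + 1), h]⟩
  rw [demazureLeft, hi, if_pos h, demazureRight, next]
  simp only [Equiv.Perm.mul_apply, s_lt_iff]
  by_cases F : y j = j ∧ y (j + 1) = j + 1
  · rw [if_neg (by omega), if_pos F]
    ext x
    simp only [Equiv.Perm.mul_apply]
    by_cases h1 : x = j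
    · subst h1; rw [F.1, s_left, F.2]
    by_cases h2 : x = j + 1
    · subst h2; rw [F.2, s_right, F.1]
    have e1 : s j x = x := by simp [s_apply, h1, h2]
    have n1 : y x ≠ j := fun e => h1 (by rw [← hy x, e, F.1])
    have n2 : y x ≠ j + 1 := fun e => h2 (by rw [← hy x, e, F.2])
    rw [e1, s_apply, if_neg n1, if_neg n2]
  · rw [if_pos (by omega), if_neg F]

theorem demazure_of_not_ascent {y : Equiv.Perm ℤ} (hy : Function.Involutive y) {j : ℤ}
    (h : ¬y j < y (j + 1)) : demazureRight (demazureLeft j y) j = y := by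
  have hi : y⁻¹ = y := by
    ext x
    rw [Equiv.Perm.inv_eq_iff_eq, hy]
  rw [demazureLeft, hi, if_neg h, demazureRight, if_neg h]

theorem involutionProduct_append (a b : List ℤ) :
    involutionProduct (a ++ b) =
      b.foldl (fun y i => demazureRight (demazureLeft i y) i) (involutionProduct a) :=
  List.foldl_append

theorem involutionProduct_involutive (a : List ℤ) :
    Function.Involutive (involutionProduct a) := by
  induction a using List.reverseRecOn with
  | nil => exact fun _ => rfl
  | append_singleton a j ih =>
    rw [involutionProduct_append]
    simp only [List.foldl_cons, List.foldl_nil]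
    by_cases h : involutionProduct a j < involutionProduct a (j + 1)
    · rw [demazure_of_ascent ih h]
      exact next_involutive ih j
    · rw [demazure_of_not_ascent ih h]
      exact ih

theorem commute_iff_of_ascent {y : Equiv.Perm ℤ} (hy : Function.Involutive y) {j : ℤ}
    (h : y j < y (j + 1)) : Commute (s j) y ↔ y j = j ∧ y (j + 1) = j + 1 := by
  constructor
  · intro hc
    have h1 := congrArg (fun σ : Equiv.Perm ℤ => σ j) hc.eq
    simp only [Equiv.Perm.mul_apply, s_left] at h1
    have := s_spec j (y j)
    omega
  · intro F
    have e := demazure_of_ascent hy h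
    have hi : y⁻¹ = y := by
      ext x
      rw [Equiv.Perm.inv_eq_iff_eq, hy]
    rw [demazureLeft, hi, if_pos h, demazureRight, next, if_pos F, if_neg] at e
    · exact e
    · simp only [Equiv.Perm.mul_apply, s_lt_iff]
      omega

/-- Along a labelled word, `next` computes the partial products of the involution word. -/
theorem IsLabelled.involutionProduct_take {W : List (ℤ × Finset ℤ)} (u : List ℤ)
    (H : IsLabelled (involutionProduct u) W) :
    ∀ (k : ℕ) (h : k < W.length),
      involutionProduct (u ++ (W.map Prod.fst).take k) W[k].1 <
          involutionProduct (u ++ (W.map Prod.fst).take k) (W[k].1 + 1) ∧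
        W[k].2 = transport ((W.map Prod.fst).drop (k + 1))
          (newCycle (involutionProduct (u ++ (W.map Prod.fst).take k)) W[k].1) := by
  induction W generalizing u with
  | nil => intro k h; simp at h
  | cons v W ih =>
    obtain ⟨j, L⟩ := v
    obtain ⟨h1, h2, h3⟩ := H
    intro k h
    cases k with
    | zero => simpa using ⟨h1, h2⟩
    | succ k =>
      have e : next (involutionProduct u) j = involutionProduct (u ++ [j]) := by
        rw [involutionProduct_append]
        exact (demazure_of_ascent (involutionProduct_involutive u) h1).symm
      rw [e] at h3
      have := ih (u ++ [j]) h3 k (by simpa using h)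
      simpa using this

theorem IsLabelled.isCommutation_iff {W : List (ℤ × Finset ℤ)} (H : IsLabelled 1 W) {k : ℕ}
    (h : k < W.length) : IsCommutation (W.map Prod.fst) k ↔ W[k].2 ≠ ∅ := by
  obtain ⟨h1, h2⟩ := IsLabelled.involutionProduct_take [] H k h
  rw [List.nil_append] at h1 h2
  have hc := commute_iff_of_ascent (involutionProduct_involutive _) h1
  rw [h2]
  unfold IsCommutation
  constructor
  · rintro ⟨h', hh⟩
    rw [List.getElem_map] at hh
    apply transport_ne_empty
    rw [newCycle, if_pos (hc.1 hh)]
    simp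
  · intro hh
    refine ⟨by simpa using h, ?_⟩
    rw [List.getElem_map, hc]
    by_contra F
    rw [newCycle, if_neg F, transport_empty] at hh
    exact hh rfl

theorem IsLabelled.gamma_eq {W : List (ℤ × Finset ℤ)} (H : IsLabelled 1 W) {k : ℕ}
    (h : k < W.length) : gamma (W.map Prod.fst) k = W[k].2 := by
  rw [gamma]
  split_ifs with hh
  · have hne := (H.isCommutation_iff h).1 hh
    obtain ⟨h1, h2⟩ := IsLabelled.involutionProduct_take [] H k h
    rw [h2] at hne ⊢
    have e : (W.map Prod.fst).getD k 0 = W[k].1 := by simp [h]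
    by_cases F : involutionProduct ([] ++ (W.map Prod.fst).take k) W[k].1 = W[k].1 ∧
        involutionProduct ([] ++ (W.map Prod.fst).take k) (W[k].1 + 1) = W[k].1 + 1
    · rw [newCycle, if_pos F, e]
      rfl
    · rw [newCycle, if_neg F, transport_empty] at hne
      exact absurd rfl hne
  · rw [H.isCommutation_iff h] at hh
    exact (not_not.1 hh).symm

/-- The labelled form of a word. -/
def label : Equiv.Perm ℤ → List ℤ → List (ℤ × Finset ℤ)
  | _, [] => []
  | y, j :: v => (j, transport v (newCycle y j)) :: label (next y j) v

theorem map_fst_label (y : Equiv.Perm ℤ) (a : List ℤ) : (label y a).map Prod.fst = a := by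
  induction a generalizing y with
  | nil => rfl
  | cons j v ih => simp [label, ih]

/-- A word all of whose letters increase the length carries its labels. -/
theorem isLabelled_label (u a : List ℤ)
    (h : ∀ (v : List ℤ) (j : ℤ) (t : List ℤ), a = v ++ j :: t →
      involutionProduct (u ++ v) j < involutionProduct (u ++ v) (j + 1)) :
    IsLabelled (involutionProduct u) (label (involutionProduct u) a) := by
  induction a generalizing u with
  | nil => trivial
  | cons j t ih =>
    have h1 := h [] j t rfl
    rw [List.append_nil] at h1
    refine ⟨h1, by rw [map_fst_label], ?_⟩
    have e : next (involutionProduct u) j = involutionProduct (u ++ [j]) := by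
      rw [involutionProduct_append]
      exact (demazure_of_ascent (involutionProduct_involutive u) h1).symm
    rw [e]
    refine ih _ fun v k t' ht => ?_
    have := h (j :: v) k t' (by rw [ht]; rfl)
    simpa using this

/-- An involution word, being of minimal length, gets longer with each letter. -/
theorem IsInvolutionWord.isLabelled {z : Equiv.Perm ℤ} {a : List ℤ} (h : IsInvolutionWord z a) :
    IsLabelled 1 (label 1 a) := by
  refine isLabelled_label [] a fun v j t ht => ?_
  by_contra hn
  rw [List.nil_append] at hn
  have := h.2 (v ++ t) (by
    rw [← h.1, ht, involutionProduct_append, involutionProduct_append, List.foldl_cons,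
      demazure_of_not_ascent (involutionProduct_involutive v) hn])
  rw [ht] at this
  simp at this

/-! ### Arrangements of cells -/

/-- The strict row reading order on positions. -/
def Precedes (x y : ℤ × ℤ) : Prop := y.1 < x.1 ∨ (x.1 = y.1 ∧ x.2 < y.2)

theorem Precedes.trans {x y z : ℤ × ℤ} (h : Precedes x y) (h' : Precedes y z) : Precedes x z := by
  unfold Precedes at *; omega

theorem Precedes.irrefl (x : ℤ × ℤ) : ¬Precedes x x := by
  unfold Precedes; omega

theorem Precedes.asymm {x y : ℤ × ℤ} (h : Precedes x y) : ¬Precedes y x := by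
  unfold Precedes at *; omega

theorem precedes_or_of_ne {x y : ℤ × ℤ} (h : x ≠ y) : Precedes x y ∨ Precedes y x := by
  unfold Precedes
  by_contra hn
  exact h (by ext <;> omega)

/-- The cells of an insertion in progress: the boxes of the tableau, and `none` for the letter
that is being inserted. -/
abbrev Cell := Option (ℤ × ℤ)

/-- `l` lists the cells in `B` in the reading order of their positions `p`. -/
def Arranged (B : Finset Cell) (p : Cell → ℤ × ℤ) (l : List Cell) : Prop :=
  l.Pairwise (fun u v => Precedes (p u) (p v)) ∧ ∀ u, u ∈ l ↔ u ∈ B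

/-- The contents `f` (letters with labels) of the cells in `B`, read in the order of the positions
`p` and followed by `b`, form an involution word with its cycles as labels. -/
def Spells (B : Finset Cell) (p : Cell → ℤ × ℤ) (f : Cell → ℤ × Finset ℤ)
    (b : List (ℤ × Finset ℤ)) : Prop :=
  ∃ l, Arranged B p l ∧ IsLabelled 1 (l.map f ++ b)

section Arranged

variable {B : Finset Cell} {p p' : Cell → ℤ × ℤ} {l : List Cell} {f f' : Cell → ℤ × Finset ℤ}
  {b : List (ℤ × Finset ℤ)}

theorem Arranged.nodup (h : Arranged B p l) : l.Nodup :=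
  h.1.imp fun {u v} huv (e : u = v) => Precedes.irrefl _ (e ▸ huv)

theorem exists_arranged (hp : Set.InjOn p B) : ∃ l, Arranged B p l := by
  classical
  let le : Cell → Cell → Bool := fun u v => decide (Precedes (p u) (p v) ∨ p u = p v)
  have h1 : (B.toList.mergeSort le).Pairwise (fun u v => le u v = true) := by
    refine List.pairwise_mergeSort (fun u v w h h' => ?_) (fun u v => ?_) _
    · simp only [le, decide_eq_true_eq] at *
      rcases h with h | h <;> rcases h' with h' | h'
      · exact Or.inl (h.trans h')
      · exact Or.inl (h' ▸ h)
      · exact Or.inl (h ▸ h')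
      · exact Or.inr (h.trans h')
    · simp only [le, Bool.or_eq_true, decide_eq_true_eq]
      by_cases e : p u = p v
      · exact Or.inl (Or.inr e)
      · rcases precedes_or_of_ne e with h | h
        · exact Or.inl (Or.inl h)
        · exact Or.inr (Or.inl h)
  have hm : ∀ u, u ∈ B.toList.mergeSort le ↔ u ∈ B := fun u => by
    rw [List.mem_mergeSort, Finset.mem_toList]
  have hn : (B.toList.mergeSort le).Nodup :=
    (List.mergeSort_perm _ _).nodup_iff.2 B.nodup_toList
  refine ⟨_, ?_, hm⟩
  refine (List.Pairwise.and hn h1).imp_of_mem fun {u v} hu hv h => ?_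
  obtain ⟨h, h'⟩ := h
  simp only [le, decide_eq_true_eq] at h'
  rcases h' with h' | h'
  · exact h'
  · exact absurd (hp ((hm u).1 hu) ((hm v).1 hv) h') h

theorem Refines.move_front (f : Cell → ℤ × Finset ℤ) (x : Cell) (A C : List Cell)
    (h : ∀ u ∈ A, Far (f u).1 (f x).1) (b : List (ℤ × Finset ℤ)) :
    Refines ((A ++ x :: C).map f ++ b) ((x :: (A ++ C)).map f ++ b) := by
  induction A with
  | nil => exact Refines.refl _
  | cons u A ih =>
    refine ((ih fun v hv => h v (List.mem_cons_of_mem _ hv)).cons (f u)).trans ?_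
    exact Refines.swap (h u List.mem_cons_self)

/-- Two arrangements of the same cells are related by commutations if all pairs of cells that occur
in different orders have letters that commute. -/
theorem Refines.reorder (f : Cell → ℤ × Finset ℤ) {r r' : Cell → Cell → Prop} (l' : List Cell) :
    ∀ l : List Cell, l.Perm l' → l.Pairwise r → l'.Pairwise r' →
      (∀ u ∈ l, ∀ v ∈ l, r u v → r' v u → Far (f u).1 (f v).1) →
      ∀ b, Refines (l.map f ++ b) (l'.map f ++ b) := by
  induction l' with
  | nil =>
    intro l hl _ _ _ b
    rw [List.perm_nil.1 hl]
    exact Refines.refl _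
  | cons x t ih =>
    intro l hl hr hr' hf b
    have hx : x ∈ l := hl.mem_iff.2 List.mem_cons_self
    obtain ⟨A, C, rfl⟩ := List.append_of_mem hx
    have hp : (A ++ C).Perm t :=
      (List.perm_cons x).1 ((List.perm_middle.symm).trans hl)
    rw [List.pairwise_cons] at hr'
    refine (Refines.move_front f x A C (fun u hu => ?_) b).trans ?_
    · refine hf u (List.mem_append_left _ hu) x (by simp) ?_ ?_
      · exact (List.pairwise_append.1 hr).2.2 u hu x List.mem_cons_self
      · exact hr'.1 u (hp.mem_iff.1 (List.mem_append_left _ hu))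
    · refine (ih (A ++ C) hp ?_ hr'.2 (fun u hu v hv => hf u ?_ v ?_) b).cons (f x)
      · exact hr.sublist (List.Sublist.append_left (List.sublist_cons_self _ _) _)
      · simp only [List.mem_append, List.mem_cons] at hu ⊢; tauto
      · simp only [List.mem_append, List.mem_cons] at hv ⊢; tauto

/-- Cells can be rearranged as long as no two cells with letters that do not commute change their
order. -/
theorem Spells.reorder (H : Spells B p f b) (hp' : Set.InjOn p' B)
    (hf : ∀ u ∈ B, ∀ v ∈ B, Precedes (p u) (p v) → Precedes (p' v) (p' u) →
      Far (f u).1 (f v).1) : Spells B p' f b := by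
  obtain ⟨l, hl, H⟩ := H
  obtain ⟨l', hl'⟩ := exists_arranged hp'
  have hperm : l.Perm l' := (List.perm_ext_iff_of_nodup hl.nodup hl'.nodup).2 fun u => by
    rw [hl.2, hl'.2]
  refine ⟨l', hl', (Refines.reorder f l' l hperm hl.1 hl'.1 ?_ b).2 1 one_involutive H⟩
  exact fun u hu v hv => hf u ((hl.2 u).1 hu) v ((hl.2 v).1 hv)

theorem Spells.congr (H : Spells B p f b) (hp : ∀ u ∈ B, p' u = p u)
    (hf : ∀ u ∈ B, f' u = f u) : Spells B p' f' b := by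
  obtain ⟨l, hl, H⟩ := H
  refine ⟨l, ⟨hl.1.imp_of_mem fun {u v} hu hv h => ?_, hl.2⟩, ?_⟩
  · rw [hp u ((hl.2 u).1 hu), hp v ((hl.2 v).1 hv)]
    exact h
  · rwa [List.map_congr_left fun u hu => hf u ((hl.2 u).1 hu)]

/-- Renaming the cells. -/
theorem Spells.transfer (H : Spells B p f b) {B' : Finset Cell} (g : Cell → Cell)
    (hB : ∀ v, v ∈ B' ↔ ∃ u ∈ B, g u = v) (hg : ∀ u ∈ B, p' (g u) = p u ∧ f' (g u) = f u) :
    Spells B' p' f' b := by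
  obtain ⟨l, hl, H⟩ := H
  refine ⟨l.map g, ⟨?_, fun v => ?_⟩, ?_⟩
  · rw [List.pairwise_map]
    refine hl.1.imp_of_mem fun {u v} hu hv h => ?_
    rw [(hg u ((hl.2 u).1 hu)).1, (hg v ((hl.2 v).1 hv)).1]
    exact h
  · rw [hB, List.mem_map]
    simp only [hl.2]
  · rw [List.map_map, List.map_congr_left (f := f' ∘ g) (g := f) fun u hu =>
      (hg u ((hl.2 u).1 hu)).2]
    exact H

/-- The cell `y` is read directly after `x` if no position lies in between. -/
theorem Arranged.eq_cons_of_append {A C : List Cell} {x y : Cell}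
    (h : Arranged B p (A ++ x :: C)) (hy : y ∈ B) (hxy : Precedes (p x) (p y))
    (hb : ∀ u ∈ B, Precedes (p x) (p u) → Precedes (p u) (p y) → False) :
    ∃ C', C = y :: C' := by
  have hp := List.pairwise_append.1 h.1
  have hyl := (h.2 y).2 hy
  rw [List.mem_append, List.mem_cons] at hyl
  have hyC : y ∈ C := by
    rcases hyl with hA | rfl | hC
    · exact absurd (hp.2.2 y hA x List.mem_cons_self) hxy.asymm
    · exact absurd hxy (Precedes.irrefl _)
    · exact hC
  cases C with
  | nil => simp at hyC
  | cons v C =>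
    have h2 := hp.2.1
    rw [List.pairwise_cons, List.pairwise_cons] at h2
    rcases List.mem_cons.1 hyC with rfl | hyC
    · exact ⟨C, rfl⟩
    · exact (hb v ((h.2 v).1 (by simp)) (h2.1 v List.mem_cons_self) (h2.2.1 y hyC)).elim

/-- Two cells that are read consecutively have different letters, since the word is reduced. -/
theorem Spells.not_adjacent_eq {x y : Cell} (H : Spells B p f b) (hx : x ∈ B) (hy : y ∈ B)
    (hxy : Precedes (p x) (p y))
    (hb : ∀ u ∈ B, Precedes (p x) (p u) → Precedes (p u) (p y) → False)
    (he : (f y).1 = (f x).1) : False := by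
  obtain ⟨l, hl, H⟩ := H
  obtain ⟨A, C, rfl⟩ := List.append_of_mem ((hl.2 x).2 hx)
  obtain ⟨C, rfl⟩ := hl.eq_cons_of_append hy hxy hb
  rw [List.map_append, List.append_assoc] at H
  obtain ⟨y', -, H⟩ := H.exists_of_append one_involutive
  have e : f y = ((f x).1, (f y).2) := Prod.ext he rfl
  simp only [List.map_cons, List.cons_append] at H
  rw [e] at H
  exact H.not_adjacent_eq

/-- A braid relation on three cells `x, y, z` that are read consecutively.  The cells
`x', y', z'` are the same ones in the order in which they are read afterwards. -/
theorem Spells.braid {x y z x' y' z' : Cell} (H : Spells B p f b) (hx : x ∈ B) (hy : y ∈ B)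
    (hz : z ∈ B) (hxy : Precedes (p x) (p y)) (hyz : Precedes (p y) (p z))
    (hb : ∀ u ∈ B, Precedes (p x) (p u) → Precedes (p u) (p y) → False)
    (hb' : ∀ u ∈ B, Precedes (p y) (p u) → Precedes (p u) (p z) → False)
    (hab : (f y).1 = (f x).1 + 1 ∨ (f x).1 = (f y).1 + 1) (hac : (f z).1 = (f x).1)
    (hperm : ∀ u, (u = x' ∨ u = y' ∨ u = z') ↔ (u = x ∨ u = y ∨ u = z))
    (hp : ∀ u, u ≠ x → u ≠ y → u ≠ z → p' u = p u ∧ f' u = f u)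
    (hpx : p' x' = p x) (hpy : p' y' = p y) (hpz : p' z' = p z)
    (hfx : f' x' = ((f y).1, (f z).2)) (hfy : f' y' = ((f x).1, (f y).2))
    (hfz : f' z' = ((f y).1, (f x).2)) : Spells B p' f' b := by
  obtain ⟨l, hl, H⟩ := H
  obtain ⟨A, C, rfl⟩ := List.append_of_mem ((hl.2 x).2 hx)
  obtain ⟨C, rfl⟩ := hl.eq_cons_of_append hy hxy hb
  have hl2 : Arranged B p ((A ++ [x]) ++ y :: C) := by simpa using hl
  obtain ⟨C, rfl⟩ := hl2.eq_cons_of_append hz hyz hb'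
  have hn := hl.nodup
  have hA : ∀ u ∈ A, u ≠ x ∧ u ≠ y ∧ u ≠ z := by
    intro u hu
    rw [List.nodup_append] at hn
    exact ⟨hn.2.2 u hu x (by simp), hn.2.2 u hu y (by simp), hn.2.2 u hu z (by simp)⟩
  have hC : ∀ u ∈ C, u ≠ x ∧ u ≠ y ∧ u ≠ z := by
    intro u hu
    have hn := (List.nodup_append.1 hn).2.1
    simp only [List.nodup_cons, List.mem_cons] at hn
    refine ⟨?_, ?_, ?_⟩ <;> rintro rfl <;> tauto
  have mA : ∀ {α : Type} (g g' : Cell → α), (∀ u, u ≠ x → u ≠ y → u ≠ z → g' u = g u) →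
      A.map g' = A.map g := fun g g' h =>
    List.map_congr_left fun u hu => h u (hA u hu).1 (hA u hu).2.1 (hA u hu).2.2
  have mC : ∀ {α : Type} (g g' : Cell → α), (∀ u, u ≠ x → u ≠ y → u ≠ z → g' u = g u) →
      C.map g' = C.map g := fun g g' h =>
    List.map_congr_left fun u hu => h u (hC u hu).1 (hC u hu).2.1 (hC u hu).2.2
  refine ⟨A ++ x' :: y' :: z' :: C, ⟨?_, fun u => ?_⟩, ?_⟩
  · have h1 := List.pairwise_map.2 hl.1
    refine (List.pairwise_map (f := p') (R := Precedes)).1 ?_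
    simp only [List.map_append, List.map_cons, hpx, hpy, hpz] at h1 ⊢
    rwa [mA p p' fun u h h' h'' => (hp u h h' h'').1, mC p p' fun u h h' h'' => (hp u h h' h'').1]
  · rw [← hl.2 u]
    have e : ∀ v₁ v₂ v₃ : Cell, (u ∈ A ++ v₁ :: v₂ :: v₃ :: C) ↔
        (u ∈ A ∨ (u = v₁ ∨ u = v₂ ∨ u = v₃) ∨ u ∈ C) := fun v₁ v₂ v₃ => by
      simp only [List.mem_append, List.mem_cons, or_assoc]
    rw [e, e, hperm u]
  · have h2 : f z = ((f x).1, (f z).2) := Prod.ext hac rfl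
    simp only [List.map_append, List.map_cons, List.append_assoc, List.cons_append, hfx, hfy,
      hfz] at H ⊢
    rw [mA f f' fun u h h' h'' => (hp u h h' h'').2, mC f f' fun u h h' h'' => (hp u h h' h'').2]
    rw [h2] at H
    exact ((Refines.braid (L₁ := (f x).2) (L₂ := (f y).2) (L₃ := (f z).2) hab).append_left _).2
      1 one_involutive H

theorem Arranged.eq_cons {x : Cell} (h : Arranged B p l) (hx : x ∈ B)
    (hf : ∀ u ∈ B, u ≠ x → Precedes (p x) (p u)) :
    ∃ C, l = x :: C ∧ Arranged (B.erase x) p C := by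
  obtain ⟨A, C, rfl⟩ := List.append_of_mem ((h.2 x).2 hx)
  have hn := h.nodup
  cases A with
  | nil =>
    refine ⟨C, rfl, (List.pairwise_cons.1 h.1).2, fun u => ?_⟩
    have := h.2 u
    simp only [List.nil_append, List.mem_cons, List.nodup_cons, Finset.mem_erase] at *
    constructor
    · intro hu
      exact ⟨fun e => hn.1 (e ▸ hu), this.1 (Or.inr hu)⟩
    · rintro ⟨h1, h2⟩
      exact (this.2 h2).resolve_left h1
  | cons v A =>
    have h1 := (List.pairwise_cons.1 h.1).1 x (by simp)
    have h2 : v ≠ x := by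
      rintro rfl
      exact Precedes.irrefl _ h1
    exact (h1.asymm (hf v ((h.2 v).1 (by simp)) h2)).elim

/-- The first two cells `x, y` can be given new contents whenever the relations of involution
words allow it. -/
theorem Spells.front_two {x y : Cell} (H : Spells B p f b) (hx : x ∈ B) (hy : y ∈ B) (hxy : x ≠ y)
    (h1 : ∀ u ∈ B, u ≠ x → Precedes (p x) (p u))
    (h2 : ∀ u ∈ B, u ≠ x → u ≠ y → Precedes (p y) (p u)) :
    ∃ W, IsLabelled 1 (f x :: f y :: W) ∧ ∀ f' : Cell → _,
      (∀ u, u ≠ x → u ≠ y → f' u = f u) → IsLabelled 1 (f' x :: f' y :: W) →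
      Spells B p f' b := by
  obtain ⟨l, hl, H⟩ := H
  obtain ⟨C, rfl, hC⟩ := hl.eq_cons hx h1
  obtain ⟨C, rfl, hC'⟩ := hC.eq_cons (Finset.mem_erase.2 ⟨hxy.symm, hy⟩) fun u hu huy =>
    h2 u (Finset.mem_of_mem_erase hu) (Finset.ne_of_mem_erase hu) huy
  refine ⟨C.map f ++ b, H, fun f' hf H' => ⟨x :: y :: C, hl, ?_⟩⟩
  have hmem : ∀ u ∈ C, u ≠ x ∧ u ≠ y := fun u hu => by
    have := (hC'.2 u).1 hu
    simp only [Finset.mem_erase] at this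
    tauto
  simp only [List.map_cons, List.cons_append]
  rwa [List.map_congr_left fun u hu => hf u (hmem u hu).1 (hmem u hu).2]

/-- A variant of `Spells.front_two` for the first four cells, of which the first two are
exchanged. -/
theorem Spells.front_four {x y z t : Cell} (H : Spells B p f b) (hx : x ∈ B) (hy : y ∈ B)
    (hz : z ∈ B) (ht : t ∈ B) (hn : [x, y, z, t].Nodup)
    (h1 : ∀ u ∈ B, u ≠ x → Precedes (p x) (p u))
    (h2 : ∀ u ∈ B, u ≠ x → u ≠ y → Precedes (p y) (p u))
    (h3 : ∀ u ∈ B, u ≠ x → u ≠ y → u ≠ z → Precedes (p z) (p u))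
    (h4 : ∀ u ∈ B, u ≠ x → u ≠ y → u ≠ z → u ≠ t → Precedes (p t) (p u)) :
    ∃ W, IsLabelled 1 (f x :: f y :: f z :: f t :: W) ∧ ∀ f' p' : Cell → _,
      (∀ u, u ≠ x → u ≠ y → u ≠ z → u ≠ t → p' u = p u ∧ f' u = f u) →
      p' x = p y → p' y = p x → p' z = p z → p' t = p t →
      IsLabelled 1 (f' y :: f' x :: f' z :: f' t :: W) → Spells B p' f' b := by
  simp only [List.nodup_cons, List.mem_cons, List.not_mem_nil, or_false, not_or] at hn
  obtain ⟨l, hl, H⟩ := H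
  obtain ⟨C, rfl, hC₁⟩ := hl.eq_cons hx h1
  obtain ⟨C, rfl, hC₂⟩ := hC₁.eq_cons (x := y) (by simp only [Finset.mem_erase]; tauto)
    fun u hu huy => by
      simp only [Finset.mem_erase] at hu
      exact h2 u (by tauto) (by tauto) (by tauto)
  obtain ⟨C, rfl, hC₃⟩ := hC₂.eq_cons (x := z) (by simp only [Finset.mem_erase]; tauto)
    fun u hu huy => by
      simp only [Finset.mem_erase] at hu
      exact h3 u (by tauto) (by tauto) (by tauto) (by tauto)
  obtain ⟨C, rfl, hC⟩ := hC₃.eq_cons (x := t) (by simp only [Finset.mem_erase]; tauto)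
    fun u hu huy => by
      simp only [Finset.mem_erase] at hu
      exact h4 u (by tauto) (by tauto) (by tauto) (by tauto) (by tauto)
  refine ⟨C.map f ++ b, H, fun f' p' hfp hpx hpy hpz hpt H' => ?_⟩
  have hmem : ∀ u ∈ C, p' u = p u ∧ f' u = f u := fun u hu => by
    have := (hC.2 u).1 hu
    simp only [Finset.mem_erase] at this
    exact hfp u (by tauto) (by tauto) (by tauto) (by tauto)
  refine ⟨y :: x :: z :: t :: C, ⟨?_, fun u => ?_⟩, ?_⟩
  · have h1 := List.pairwise_map.2 hl.1
    refine (List.pairwise_map (f := p') (R := Precedes)).1 ?_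
    simp only [List.map_cons, hpx, hpy, hpz, hpt] at h1 ⊢
    rwa [List.map_congr_left fun u hu => (hmem u hu).1]
  · rw [← hl.2 u]
    simp only [List.mem_cons]
    tauto
  · simp only [List.map_cons, List.cons_append]
    rwa [List.map_congr_left fun u hu => (hmem u hu).2]

/-- The cells that are read first cannot have the letters `w, w + 1, w`. -/
theorem Spells.not_first_braid {x y z : Cell} (H : Spells B p f b) (hx : x ∈ B) (hy : y ∈ B)
    (hz : z ∈ B) (hn : [x, y, z].Nodup)
    (h1 : ∀ u ∈ B, u ≠ x → Precedes (p x) (p u))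
    (h2 : ∀ u ∈ B, u ≠ x → u ≠ y → Precedes (p y) (p u))
    (h3 : ∀ u ∈ B, u ≠ x → u ≠ y → u ≠ z → Precedes (p z) (p u))
    (hab : (f y).1 = (f x).1 + 1) (hac : (f z).1 = (f x).1) : False := by
  simp only [List.nodup_cons, List.mem_cons, List.not_mem_nil, or_false, not_or] at hn
  obtain ⟨l, hl, H⟩ := H
  obtain ⟨C, rfl, hC₁⟩ := hl.eq_cons hx h1
  obtain ⟨C, rfl, hC₂⟩ := hC₁.eq_cons (x := y) (by simp only [Finset.mem_erase]; tauto)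
    fun u hu huy => by
      simp only [Finset.mem_erase] at hu
      exact h2 u (by tauto) (by tauto) (by tauto)
  obtain ⟨C, rfl, hC₃⟩ := hC₂.eq_cons (x := z) (by simp only [Finset.mem_erase]; tauto)
    fun u hu huy => by
      simp only [Finset.mem_erase] at hu
      exact h3 u (by tauto) (by tauto) (by tauto) (by tauto)
  have e : f z = ((f x).1, (f z).2) := Prod.ext hac rfl
  simp only [List.map_cons, List.cons_append] at H
  rw [e] at H
  exact H.not_first_braid (Or.inl hab)

theorem Spells.labels_ne {u v : Cell} (H : Spells B p f b) (hu : u ∈ B) (hv : v ∈ B) (huv : u ≠ v)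
    (h : (f u).2 ≠ ∅) : (f u).2 ≠ (f v).2 := by
  obtain ⟨l, hl, H⟩ := H
  have h1 := List.pairwise_map.1
    (List.pairwise_append.1 (IsLabelled.pairwise one_involutive H)).1
  have h2 : l.Pairwise fun u v => u ≠ v → (f u).2 = (f v).2 → (f u).2 = ∅ :=
    h1.imp fun {u v} h _ e => by
      by_contra h'
      exact h h' e
  have hs : Std.Symm fun u v : Cell => u ≠ v → (f u).2 = (f v).2 → (f u).2 = ∅ :=
    ⟨fun u v h h' e => by rw [e]; exact h h'.symm e.symm⟩
  exact fun e => h (h2.forall_of_forall (fun x _ h' => absurd rfl h') ((hl.2 u).2 hu)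
    ((hl.2 v).2 hv) huv e)

/-- The cycle of a cell is not the label of any letter to come. -/
theorem Spells.labels_ne_tail {u : Cell} (H : Spells B p f b) (hu : u ∈ B)
    (h : (f u).2 ≠ ∅) : ∀ v ∈ b, v.2 ≠ (f u).2 := by
  obtain ⟨l, hl, H⟩ := H
  intro v hv
  have h1 := (List.pairwise_append.1 (IsLabelled.pairwise one_involutive H)).2.2 (f u)
    (List.mem_map.2 ⟨u, (hl.2 u).2 hu, rfl⟩) v hv
  exact (h1 h).symm

end Arranged

/-! ### Shifted diagrams -/

/-- `B` is the set of boxes of a shifted diagram, on which the numbers `N` increase strictly along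
rows and columns.  The inequality is the one that follows from walking down and then left. -/
def IsShifted (B : Finset (ℤ × ℤ)) (N : ℤ × ℤ → ℤ) : Prop :=
  ∀ r c, (r, c) ∈ B → 1 ≤ r ∧ r ≤ c ∧ ∀ r' c', 1 ≤ r' → r' ≤ r → r' ≤ c' → c' ≤ c →
    (r', c') ∈ B ∧ N (r', c') + (r - r') + (c - c') ≤ N (r, c)

section IsShifted

variable {B : Finset (ℤ × ℤ)} {N : ℤ × ℤ → ℤ}

theorem IsShifted.mem (S : IsShifted B N) {r c r' c' : ℤ} (h : (r, c) ∈ B) (h1 : 1 ≤ r')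
    (h2 : r' ≤ r) (h3 : r' ≤ c') (h4 : c' ≤ c) : (r', c') ∈ B :=
  ((S r c h).2.2 r' c' h1 h2 h3 h4).1

/-- Monotonicity as a disjunction, for use in linear arithmetic. -/
theorem IsShifted.le_or (S : IsShifted B N) {r c r' c' : ℤ} (h : (r, c) ∈ B) (h' : (r', c') ∈ B) :
    1 ≤ r ∧ r ≤ c ∧ 1 ≤ r' ∧ r' ≤ c' ∧
      (r < r' ∨ c < c' ∨ N (r', c') + (r - r') + (c - c') ≤ N (r, c)) := by
  have h1 := S r c h
  have h2 := S r' c' h'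
  refine ⟨h1.1, h1.2.1, h2.1, h2.2.1, ?_⟩
  by_cases h3 : r < r'
  · exact Or.inl h3
  by_cases h4 : c < c'
  · exact Or.inr (Or.inl h4)
  exact Or.inr (Or.inr (h1.2.2 r' c' h2.1 (by omega) h2.2.1 (by omega)).2)

/-- It suffices to compare each box with its neighbours to the left and below. -/
theorem isShifted_of_local (h : ∀ r c, (r, c) ∈ B → 1 ≤ r ∧ r ≤ c ∧
    (r < c → (r, c - 1) ∈ B ∧ N (r, c - 1) < N (r, c)) ∧
    (1 < r → (r - 1, c) ∈ B ∧ N (r - 1, c) < N (r, c))) : IsShifted B N := by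
  intro r c hrc
  refine ⟨(h r c hrc).1, (h r c hrc).2.1, ?_⟩
  have key : ∀ n : ℕ, ∀ r c : ℤ, (r, c) ∈ B → ∀ r' c', 1 ≤ r' → r' ≤ r → r' ≤ c' → c' ≤ c →
      (r - r') + (c - c') = n → (r', c') ∈ B ∧ N (r', c') + (r - r') + (c - c') ≤ N (r, c) := by
    intro n
    induction n with
    | zero =>
      intro r c hrc r' c' h1 h2 h3 h4 h5
      obtain rfl : r' = r := by omega
      obtain rfl : c' = c := by omega
      exact ⟨hrc, by omega⟩
    | succ n ih =>
      intro r c hrc r' c' h1 h2 h3 h4 h5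
      obtain ⟨g1, g2, g3, g4⟩ := h r c hrc
      by_cases e : r' = r
      · obtain ⟨k1, k2⟩ := g3 (by omega)
        obtain ⟨k3, k4⟩ := ih r (c - 1) k1 r' c' h1 h2 h3 (by omega) (by omega)
        exact ⟨k3, by omega⟩
      · obtain ⟨k1, k2⟩ := g4 (by omega)
        obtain ⟨k3, k4⟩ := ih (r - 1) c k1 r' c' h1 (by omega) h3 (by omega) (by omega)
        exact ⟨k3, by omega⟩
  intro r' c' h1 h2 h3 h4
  exact key ((r - r') + (c - c')).toNat r c hrc r' c' h1 h2 h3 h4 (by omega)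

/-- Putting `v` into a box whose neighbours allow it. -/
theorem IsShifted.set (S : IsShifted B N) {r c v : ℤ} (hr : 1 ≤ r) (hrc : r ≤ c)
    (hl : r < c → (r, c - 1) ∈ B ∧ N (r, c - 1) < v)
    (hd : 1 < r → (r - 1, c) ∈ B ∧ N (r - 1, c) < v)
    (hright : (r, c + 1) ∈ B → v < N (r, c + 1)) (hu : (r + 1, c) ∈ B → v < N (r + 1, c)) :
    IsShifted (insert (r, c) B) (Function.update N (r, c) v) := by
  refine isShifted_of_local fun r' c' h => ?_
  have upd : ∀ x : ℤ × ℤ, Function.update N (r, c) v x = if x = (r, c) then v else N x :=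
    fun x => Function.update_apply _ _ _ _
  simp only [upd, Finset.mem_insert, Prod.mk.injEq] at h ⊢
  by_cases e : r' = r ∧ c' = c
  · obtain ⟨rfl, rfl⟩ := e
    refine ⟨hr, hrc, fun h1 => ?_, fun h1 => ?_⟩
    · rw [if_neg (by omega), if_pos (by omega)]
      exact ⟨Or.inr (hl h1).1, (hl h1).2⟩
    · rw [if_neg (by omega), if_pos (by omega)]
      exact ⟨Or.inr (hd h1).1, (hd h1).2⟩
  · have hB := h.resolve_left e
    obtain ⟨h1, h2, h3⟩ := S r' c' hB
    refine ⟨h1, h2, fun h4 => ?_, fun h4 => ?_⟩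
    · rw [if_neg e]
      obtain ⟨h5, h6⟩ := h3 r' (c' - 1) h1 le_rfl (by omega) (by omega)
      refine ⟨Or.inr h5, ?_⟩
      split_ifs with e'
      · obtain ⟨rfl, rfl⟩ := e'
        have := hright (by simpa using hB)
        simpa using this
      · omega
    · rw [if_neg e]
      obtain ⟨h5, h6⟩ := h3 (r' - 1) c' (by omega) (by omega) (by omega) le_rfl
      refine ⟨Or.inr h5, ?_⟩
      split_ifs with e'
      · obtain ⟨rfl, rfl⟩ := e'
        have := hu (by simpa using hB)
        simpa using this
      · omega

theorem IsShifted.col_le_card (S : IsShifted B N) {r c : ℤ} (h : (r, c) ∈ B) : c ≤ B.card := by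
  obtain ⟨h1, h2, -⟩ := S r c h
  have hsub : (Finset.Icc 1 c).image (fun k => ((1 : ℤ), k)) ⊆ B := by
    intro x hx
    obtain ⟨k, hk, rfl⟩ := Finset.mem_image.1 hx
    rw [Finset.mem_Icc] at hk
    exact S.mem h le_rfl h1 hk.1 hk.2
  have := Finset.card_le_card hsub
  rw [Finset.card_image_of_injective _ fun a b h => (Prod.mk.inj h).2, Int.card_Icc] at this
  omega

end IsShifted

/-! ### States of an insertion -/

/-- The positions for reading by rows; the inserted letter is at `q`.  Coordinates of boxes are
doubled, so that odd coordinates lie between them. -/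
def rowPos (q : ℤ × ℤ) : Cell → ℤ × ℤ
  | none => q
  | some x => (2 * x.1, 2 * x.2)

/-- The positions for reading by columns from left to right, each one from top to bottom; the
inserted letter is at `q`. -/
def colPos (q : ℤ × ℤ) : Cell → ℤ × ℤ
  | none => q
  | some x => (-2 * x.2, -2 * x.1)

theorem rowPos_injective {q : ℤ × ℤ} (h : q.1 % 2 = 1 ∨ q.2 % 2 = 1) :
    Function.Injective (rowPos q) := by
  rintro (_ | ⟨r, c⟩) (_ | ⟨r', c'⟩) e <;> simp only [rowPos, Prod.ext_iff] at e
  · rfl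
  · omega
  · omega
  · simp only [Option.some.injEq, Prod.mk.injEq]
    omega

theorem colPos_injective {q : ℤ × ℤ} (h : q.1 % 2 = 1 ∨ q.2 % 2 = 1) :
    Function.Injective (colPos q) := by
  rintro (_ | ⟨r, c⟩) (_ | ⟨r', c'⟩) e <;> simp only [colPos, Prod.ext_iff] at e
  · rfl
  · omega
  · omega
  · simp only [Option.some.injEq, Prod.mk.injEq]
    omega

/-- The integers in the boxes. -/
def num (f : Cell → ℤ × Finset ℤ) (x : ℤ × ℤ) : ℤ := (f (some x)).1

/-- The inserted letter trades places with the content of the box `x`. -/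
def exchange (f : Cell → ℤ × Finset ℤ) (x : ℤ × ℤ) : Cell → ℤ × Finset ℤ :=
  f ∘ Equiv.swap none (some x)

/-- The labels in the boxes `x, y` are switched, and the inserted letter increases by `1`. -/
def switch (f : Cell → ℤ × Finset ℤ) (x y : ℤ × ℤ) : Cell → ℤ × Finset ℤ
  | none => ((f none).1 + 1, (f none).2)
  | some z => if z = x then (num f x, (f (some y)).2) else
      if z = y then (num f y, (f (some x)).2) else f (some z)

/-- The box `x` receives the inserted letter. -/
def fill (f : Cell → ℤ × Finset ℤ) (x : ℤ × ℤ) : Cell → ℤ × Finset ℤ :=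
  Function.update f (some x) (f none)

theorem swap_none_some (x z : ℤ × ℤ) :
    Equiv.swap none (some x) (some z) = if z = x then none else some z := by
  rw [Equiv.swap_apply_def]
  simp

theorem exchange_none (f : Cell → ℤ × Finset ℤ) (x : ℤ × ℤ) : exchange f x none = f (some x) := by
  simp [exchange]

theorem exchange_some (f : Cell → ℤ × Finset ℤ) (x z : ℤ × ℤ) :
    exchange f x (some z) = if z = x then f none else f (some z) := by
  simp only [exchange, Function.comp, swap_none_some]
  split_ifs <;> rfl

theorem num_exchange (f : Cell → ℤ × Finset ℤ) (x : ℤ × ℤ) :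
    num (exchange f x) = Function.update (num f) x (f none).1 := by
  ext z
  rw [num, exchange_some, Function.update_apply]
  split_ifs <;> rfl

theorem num_switch (f : Cell → ℤ × Finset ℤ) (x y : ℤ × ℤ) : num (switch f x y) = num f := by
  ext z
  simp only [num, switch]
  split_ifs with h h' <;> simp [*]

theorem num_fill (f : Cell → ℤ × Finset ℤ) (x : ℤ × ℤ) :
    num (fill f x) = Function.update (num f) x (f none).1 := by
  ext z
  rw [num, fill, Function.update_apply, Function.update_apply]
  simp only [Option.some.injEq]
  split_ifs <;> rfl

/-- The cells of a tableau with boxes `B` and a letter that is being inserted. -/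
abbrev cells (B : Finset (ℤ × ℤ)) : Finset Cell := Finset.insertNone B

/-- The boxes `B` as cells. -/
abbrev boxCells (B : Finset (ℤ × ℤ)) : Finset Cell := B.map Function.Embedding.some

/-- The state of an insertion before the inserted letter enters row `i`.  The word is read by
rows, with the inserted letter after row `i`.  The last field describes the box `(i - 1, c₀)` from
which the letter comes. -/
structure RowState (B : Finset (ℤ × ℤ)) (f : Cell → ℤ × Finset ℤ) (b : List (ℤ × Finset ℤ))
    (i : ℤ) : Prop where
  shifted : IsShifted B (num f)
  spells : Spells (cells B) (rowPos (2 * i - 1, 0)) f b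
  one_le : 1 ≤ i
  path : i = 1 ∨ ∃ c₀, i ≤ c₀ ∧ (i - 1, c₀) ∈ B ∧ num f (i - 1, c₀) < (f none).1 ∧
    ((i, c₀) ∈ B → (f none).1 ≤ num f (i, c₀))

/-- The state of an insertion before the inserted letter enters column `j`.  The word is read by
columns, with the inserted letter before column `j`.  The last field describes the box
`(r₀, j - 1)` from which the letter comes, and ensures that it cannot enter the diagonal. -/
structure ColState (B : Finset (ℤ × ℤ)) (f : Cell → ℤ × Finset ℤ) (b : List (ℤ × Finset ℤ))
    (j : ℤ) : Prop where
  shifted : IsShifted B (num f)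
  spells : Spells (cells B) (colPos (1 - 2 * j, 0)) f b
  path : ∃ r₀, (r₀, j - 1) ∈ B ∧ num f (r₀, j - 1) < (f none).1 ∧
    ((r₀, j) ∈ B → (f none).1 ≤ num f (r₀, j)) ∧
    ((j - 1, j) ∈ B → (f none).1 < num f (j - 1, j))

/-- The state between two insertions.  There is no inserted letter, so that the parameter `q` of
`rowPos` is immaterial. -/
structure Finished (B : Finset (ℤ × ℤ)) (f : Cell → ℤ × Finset ℤ) (b : List (ℤ × Finset ℤ)) :
    Prop where
  shifted : IsShifted B (num f)
  spells : ∀ q, Spells (boxCells B) (rowPos q) f b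

/-- The inserted letter and the content of a box can trade places as long as only letters that
commute change their order. -/
theorem Spells.exchange {B : Finset (ℤ × ℤ)} {p p' : Cell → ℤ × ℤ} {f : Cell → ℤ × Finset ℤ}
    {b : List (ℤ × Finset ℤ)} {x : ℤ × ℤ} (H : Spells (cells B) p f b) (hx : x ∈ B)
    (hp' : Function.Injective p')
    (hf : ∀ u ∈ cells B, ∀ v ∈ cells B, Precedes (p u) (p v) →
      Precedes (p' (Equiv.swap none (some x) v)) (p' (Equiv.swap none (some x) u)) →
      Far (f u).1 (f v).1) : Spells (cells B) p' (exchange f x) b := by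
  refine (H.reorder (p' := p' ∘ Equiv.swap none (some x))
    ((hp'.comp (Equiv.injective _)).injOn) hf).transfer (Equiv.swap none (some x)) (fun v => ?_)
    fun u _ => ?_
  · have key : ∀ u, u ∈ cells B → Equiv.swap none (some x) u ∈ cells B := by
      rintro (_ | z) hu
      · simpa using hx
      · rw [swap_none_some]
        split_ifs
        · simp
        · exact hu
    constructor
    · exact fun hv => ⟨_, key v hv, Equiv.swap_apply_self _ _ _⟩
    · rintro ⟨u, hu, rfl⟩
      exact key u hu
  · simp [ShiftedEG.exchange, Function.comp]

/-! ### Row insertion -/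

section Row

variable {B : Finset (ℤ × ℤ)} {f : Cell → ℤ × Finset ℤ} {b : List (ℤ × Finset ℤ)} {i c : ℤ}

/-- The insertion path moves weakly to the left. -/
theorem RowState.below (H : RowState B f b i) (hic : i ≤ c)
    (hc : ∀ c', (i, c') ∈ B → c' < c → num f (i, c') < (f none).1)
    (hn : ∀ c', i ≤ c' → c' < c → (i, c') ∈ B) (h1 : 1 < i) :
    (i - 1, c) ∈ B ∧ num f (i - 1, c) < (f none).1 := by
  have S := H.shifted
  rcases H.path with h | ⟨c₀, h2, h3, h4, h5⟩
  · omega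
  have hcc : c ≤ c₀ := by
    by_contra hlt
    have hm := hn c₀ h2 (by omega)
    have := hc c₀ hm (by omega)
    have := h5 hm
    omega
  have hm : (i - 1, c) ∈ B := S.mem h3 (by omega) le_rfl (by omega) hcc
  refine ⟨hm, ?_⟩
  have := S.le_or h3 hm
  omega

/-- The word is changed by commutations only: `w` moves to the left past the entries of row `i` that
exceed the bumped entry `m`, and then `m` moves to the left past those that are smaller than `w`. -/
theorem RowState.bump (H : RowState B f b i) (hm : (i, c) ∈ B) (hic : i < c)
    (hc : ∀ c', (i, c') ∈ B → c' < c → num f (i, c') < (f none).1)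
    (hw : (f none).1 < num f (i, c)) : RowState B (exchange f (i, c)) b (i + 1) := by
  have S := H.shifted
  have hi := H.one_le
  have S' : IsShifted B (num (exchange f (i, c))) := by
    rw [num_exchange, ← Finset.insert_eq_of_mem hm]
    refine S.set hi hic.le (fun _ => ?_) (fun h1 => ?_) (fun h => ?_) (fun h => ?_)
    · have hm' := S.mem hm hi le_rfl (c' := c - 1) (by omega) (by omega)
      exact ⟨hm', hc _ hm' (by omega)⟩
    · exact H.below hic.le hc (fun c' h h' => S.mem hm hi le_rfl h h'.le) h1
    · have := S.le_or h hm
      omega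
    · have := S.le_or h hm
      omega
  refine ⟨S', ?_, by omega, Or.inr ⟨c, by omega, by simpa using hm, ?_, ?_⟩⟩
  · refine H.spells.exchange hm (rowPos_injective (Or.inl (by simp only; omega))) ?_
    rintro (_ | ⟨r, k⟩) hu (_ | ⟨r', k'⟩) hv h h'
    · exact absurd h (Precedes.irrefl _)
    · rw [Finset.some_mem_insertNone] at hv
      have e1 := S.le_or hv hm
      rw [swap_none_some, Equiv.swap_apply_left] at h'
      unfold num at *
      simp only [Prod.mk.injEq] at h'
      split_ifs at h' with e
      · simp only [rowPos, Precedes] at h h'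
        unfold Far
        omega
      · simp only [rowPos, Precedes] at h h'
        unfold Far
        omega
    · rw [Finset.some_mem_insertNone] at hu
      have e1 := S.le_or hu hm
      rw [swap_none_some, Equiv.swap_apply_left] at h'
      unfold num at *
      simp only [Prod.mk.injEq] at h'
      split_ifs at h' with e
      · simp only [rowPos, Precedes] at h h'
        unfold Far
        omega
      · simp only [rowPos, Precedes] at h h'
        unfold Far
        omega
    · rw [Finset.some_mem_insertNone] at hu hv
      have e1 := S.le_or hu hm
      have e2 := hc k
      have e3 := hc k'
      have e4 := S.le_or hv hm
      rw [swap_none_some, swap_none_some] at h'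
      unfold num at *
      simp only [Prod.mk.injEq] at h'
      by_cases g : r = i ∧ k = c <;> by_cases g' : r' = i ∧ k' = c
      · simp only [rowPos, Precedes] at h
        omega
      · obtain ⟨rfl, rfl⟩ := g
        simp only [if_neg g', and_self, if_true, rowPos, Precedes] at h h'
        unfold Far
        omega
      · obtain ⟨rfl, rfl⟩ := g'
        simp only [if_neg g, and_self, if_true, rowPos, Precedes] at h h'
        by_cases hr : r = r'
        · subst hr
          have := e2 hu (by omega)
          unfold Far
          omega
        · omega
      · simp only [if_neg g, if_neg g', rowPos, Precedes] at h h'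
        omega
  · rw [num_exchange, exchange_none]
    simpa [num] using hw
  · intro h
    have := S.le_or h hm
    rw [num_exchange, exchange_none, Function.update_of_ne (by simp)]
    unfold num at *
    omega

/-- An entry of row `i` equal to the inserted letter `w` is followed by `w + 1`, since the word is
reduced. -/
theorem RowState.succ_mem (H : RowState B f b i) (hm : (i, c) ∈ B)
    (hw : num f (i, c) = (f none).1) : (i, c + 1) ∈ B ∧ num f (i, c + 1) = (f none).1 + 1 := by
  have S := H.shifted
  by_contra hn
  have h2 : ∀ k, (i, k) ∈ B → c < k → (f none).1 + 2 ≤ num f (i, k) := by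
    intro k hk hck
    have hi := (S i c hm)
    have hk' : (i, c + 1) ∈ B := S.mem hk hi.1 le_rfl (by omega) (by omega)
    have e1 := S.le_or hk' hm
    have e2 := S.le_or hk hk'
    have : num f (i, c + 1) ≠ (f none).1 + 1 := fun e => hn ⟨hk', e⟩
    omega
  have H2 : Spells (cells B) (rowPos (2 * i, 2 * c + 1)) f b := by
    refine H.spells.reorder (rowPos_injective (Or.inr (by simp only; omega))).injOn ?_
    rintro (_ | ⟨r, k⟩) hu (_ | ⟨r', k'⟩) hv h h'
    · exact absurd h (Precedes.irrefl _)
    · simp only [rowPos, Precedes] at h h'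
      omega
    · rw [Finset.some_mem_insertNone] at hu
      simp only [rowPos, Precedes] at h h'
      obtain rfl : r = i := by omega
      have := h2 k hu (by omega)
      unfold num at this
      unfold Far
      omega
    · simp only [rowPos, Precedes] at h h'
      omega
  refine H2.not_adjacent_eq (x := some (i, c)) (y := none) (by simpa using hm) (by simp)
    (by simp only [rowPos, Precedes, true_and]; omega) ?_ (by rw [← hw]; rfl)
  rintro (_ | ⟨r, k⟩) hu h h'
  · exact Precedes.irrefl _ h'
  · simp only [rowPos, Precedes] at h h'
    omega

/-- The inserted letter `w` meets entries `w, w + 1`.  The braid relation `w, w + 1, w → w + 1, w, w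
+ 1` leaves the entries as they are, switches their labels, and makes `w + 1` the letter to be
inserted next. -/
theorem RowState.switch (H : RowState B f b i) (hm : (i, c) ∈ B) (hic : i < c)
    (hw : num f (i, c) = (f none).1) :
    RowState B (ShiftedEG.switch f (i, c) (i, c + 1)) b (i + 1) := by
  have S := H.shifted
  have hi := H.one_le
  obtain ⟨hM, hw'⟩ := H.succ_mem hm hw
  refine ⟨by rw [num_switch]; exact S, ?_, by omega,
    Or.inr ⟨c, by omega, by simpa using hm, ?_, ?_⟩⟩
  · have H2 : Spells (cells B) (rowPos (2 * i, 2 * c + 3)) f b := by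
      refine H.spells.reorder (rowPos_injective (Or.inr (by simp only; omega))).injOn ?_
      rintro (_ | ⟨r, k⟩) hu (_ | ⟨r', k'⟩) hv h h'
      · exact absurd h (Precedes.irrefl _)
      · simp only [rowPos, Precedes] at h h'
        omega
      · rw [Finset.some_mem_insertNone] at hu
        simp only [rowPos, Precedes] at h h'
        have := S.le_or hu hM
        unfold num at *
        unfold Far
        omega
      · simp only [rowPos, Precedes] at h h'
        omega
    -- the three consecutive letters `w, w + 1, w` become `w + 1, w, w + 1`
    have H3 : Spells (cells B) (fun u => if u = none then (2 * i, 2 * c) else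
        if u = some (i, c) then (2 * i, 2 * c + 2) else
        if u = some (i, c + 1) then (2 * i, 2 * c + 3) else rowPos (0, 0) u)
        (ShiftedEG.switch f (i, c) (i, c + 1)) b := by
      refine H2.braid (x := some (i, c)) (y := some (i, c + 1)) (z := none) (x' := none)
        (y' := some (i, c)) (z' := some (i, c + 1)) (by simpa using hm) (by simpa using hM)
        (by simp) ?_ ?_ ?_ ?_ (Or.inl ?_) hw.symm (fun u => by tauto) ?_ ?_ ?_ ?_ ?_ ?_ ?_
      · simp only [rowPos, Precedes, true_and]; omega
      · simp only [rowPos, Precedes, true_and]; omega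
      · rintro (_ | ⟨r, k⟩) hu h h' <;> simp only [rowPos, Precedes] at h h' <;> omega
      · rintro (_ | ⟨r, k⟩) hu h h' <;> simp only [rowPos, Precedes] at h h' <;> omega
      · unfold num at *; omega
      · rintro (_ | z) h1 h2 h3
        · exact absurd rfl h3
        · rw [ne_eq, Option.some.injEq] at h1 h2
          simp only [reduceCtorEq, if_false, Option.some.injEq, if_neg h1, if_neg h2,
            ShiftedEG.switch, rowPos, and_self]
      · simp [rowPos]
      · simp [rowPos]; ring
      · simp [rowPos]
      · unfold num at *
        simp only [ShiftedEG.switch, hw']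
      · simp [ShiftedEG.switch, num]
      · simp [ShiftedEG.switch, num]
    refine H3.reorder (rowPos_injective (Or.inl (by simp only; omega))).injOn ?_
    rintro (_ | ⟨r, k⟩) hu (_ | ⟨r', k'⟩) hv h h'
    · exact absurd h (Precedes.irrefl _)
    · simp only [reduceCtorEq, if_true, if_false, Option.some.injEq, Prod.mk.injEq] at h
      split_ifs at h <;> simp only [rowPos, Precedes] at h h' <;> omega
    · rw [Finset.some_mem_insertNone] at hu
      have e1 := S.le_or hm hu
      have e2 : (ShiftedEG.switch f (i, c) (i, c + 1) (some (r, k))).1 = num f (r, k) := by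
        rw [← num_switch f (i, c) (i, c + 1)]; rfl
      have e3 : (ShiftedEG.switch f (i, c) (i, c + 1) none).1 = (f none).1 + 1 := rfl
      rw [e2, e3]
      simp only [reduceCtorEq, if_true, if_false, Option.some.injEq, Prod.mk.injEq] at h
      unfold Far
      split_ifs at h <;> simp only [rowPos, Precedes] at h h' <;> omega
    · simp only [reduceCtorEq, if_false, Option.some.injEq, Prod.mk.injEq] at h
      split_ifs at h <;> simp only [rowPos, Precedes] at h h' <;> omega
  · rw [num_switch]
    have : (i : ℤ) + 1 - 1 = i := by ring
    simp only [this, hw, ShiftedEG.switch]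
    omega
  · intro h
    rw [num_switch]
    have := S.le_or h hm
    simp only [ShiftedEG.switch]
    omega

theorem Spells.fill {p : Cell → ℤ × ℤ} {x : ℤ × ℤ} (H : Spells (cells B) p f b) (hx : x ∉ B)
    {p' : Cell → ℤ × ℤ} (hpx : p' (some x) = p none) (hp : ∀ z, z ≠ x → p' (some z) = p (some z)) :
    Spells (boxCells (insert x B)) p' (ShiftedEG.fill f x) b := by
  refine H.transfer (fun u => some (u.getD x)) (fun v => ?_) ?_
  · simp only [Finset.mem_map, Function.Embedding.some_apply, Finset.mem_insert]
    constructor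
    · rintro ⟨z, rfl | hz, rfl⟩
      · exact ⟨none, by simp, rfl⟩
      · exact ⟨some z, by simpa using hz, rfl⟩
    · rintro ⟨_ | z, hu, rfl⟩
      · exact ⟨x, Or.inl rfl, rfl⟩
      · exact ⟨z, Or.inr (by simpa using hu), rfl⟩
  · rintro (_ | z) hu
    · simp [ShiftedEG.fill, hpx]
    · rw [Finset.some_mem_insertNone] at hu
      have hz : z ≠ x := fun e => hx (e ▸ hu)
      simp [ShiftedEG.fill, hp z hz, hz]

theorem RowState.place (H : RowState B f b i) (hic : i ≤ c) (hx : (i, c) ∉ B)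
    (hn : ∀ c', i ≤ c' → c' < c → (i, c') ∈ B)
    (hc : ∀ c', (i, c') ∈ B → num f (i, c') < (f none).1) :
    Finished (insert (i, c) B) (fill f (i, c)) b := by
  have S := H.shifted
  have hi := H.one_le
  refine ⟨?_, fun q => ?_⟩
  · rw [num_fill]
    refine S.set hi hic (fun h => ?_) (fun h1 => ?_) (fun h => ?_) (fun h => ?_)
    · have := hn (c - 1) (by omega) (by omega)
      exact ⟨this, hc _ this⟩
    · exact H.below hic (fun c' h _ => hc c' h) hn h1
    · exact absurd (S.mem h hi le_rfl hic (by omega)) hx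
    · exact absurd (S.mem h hi (by omega) hic le_rfl) hx
  · have H2 : Spells (cells B) (rowPos (2 * i, 2 * c)) f b := by
      refine H.spells.reorder ?_ ?_
      · rintro (_ | ⟨r, k⟩) hu (_ | ⟨r', k'⟩) hv h <;>
          simp only [rowPos, Prod.mk.injEq] at h
        · rfl
        · refine absurd (Finset.some_mem_insertNone.1 hv) ?_
          obtain rfl : r' = i := by omega
          obtain rfl : k' = c := by omega
          exact hx
        · refine absurd (Finset.some_mem_insertNone.1 hu) ?_
          obtain rfl : r = i := by omega
          obtain rfl : k = c := by omega
          exact hx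
        · simp only [Option.some.injEq, Prod.mk.injEq]
          omega
      · rintro (_ | ⟨r, k⟩) hu (_ | ⟨r', k'⟩) hv h h'
        · exact absurd h (Precedes.irrefl _)
        · simp only [rowPos, Precedes] at h h'
          omega
        · simp only [rowPos, Precedes] at h h'
          rw [Finset.some_mem_insertNone] at hu
          obtain rfl : r = i := by omega
          exact absurd (S.mem hu hi le_rfl hic (by omega)) hx
        · simp only [rowPos, Precedes] at h h'
          omega
    exact H2.fill hx rfl fun z _ => rfl

end Row

/-! ### Column insertion -/

section Column

variable {B : Finset (ℤ × ℤ)} {f : Cell → ℤ × Finset ℤ} {b : List (ℤ × Finset ℤ)} {j r : ℤ}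

/-- The insertion path moves weakly down and stays off the diagonal. -/
theorem ColState.left (H : ColState B f b j)
    (hc : ∀ r', (r', j) ∈ B → r' < r → num f (r', j) < (f none).1) (h1 : 1 ≤ r)
    (hn : ∀ r', 1 ≤ r' → r' < r → (r', j) ∈ B) :
    r < j ∧ (r, j - 1) ∈ B ∧ num f (r, j - 1) < (f none).1 := by
  have S := H.shifted
  obtain ⟨r₀, h3, h4, h5, -⟩ := H.path
  have hr := S _ _ h3
  have hrr : r ≤ r₀ := by
    by_contra hlt
    have hm := hn r₀ hr.1 (by omega)
    have := hc r₀ hm (by omega)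
    have := h5 hm
    omega
  have hm : (r, j - 1) ∈ B := S.mem h3 h1 hrr (by omega) le_rfl
  refine ⟨by omega, hm, ?_⟩
  have := S.le_or h3 hm
  omega

/-- The word is changed by commutations only, as in `RowState.bump`. -/
theorem ColState.bump (H : ColState B f b j) (hm : (r, j) ∈ B)
    (hc : ∀ r', (r', j) ∈ B → r' < r → num f (r', j) < (f none).1)
    (hw : (f none).1 < num f (r, j)) : r < j ∧ ColState B (exchange f (r, j)) b (j + 1) := by
  have S := H.shifted
  have hr := S _ _ hm
  obtain ⟨hrj, hl, hlw⟩ := H.left hc hr.1 fun r' h h' => S.mem hm h h'.le (by omega) le_rfl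
  have S' : IsShifted B (num (exchange f (r, j))) := by
    rw [num_exchange, ← Finset.insert_eq_of_mem hm]
    refine S.set hr.1 hrj.le (fun _ => ⟨hl, hlw⟩) (fun h1 => ?_) (fun h => ?_) (fun h => ?_)
    · have hm' := S.mem hm (r' := r - 1) (c' := j) (by omega) (by omega) (by omega) le_rfl
      exact ⟨hm', hc _ hm' (by omega)⟩
    · have := S.le_or h hm
      omega
    · have := S.le_or h hm
      omega
  refine ⟨hrj, S', ?_, r, by simpa using hm, ?_, ?_, ?_⟩
  · refine H.spells.exchange hm (colPos_injective (Or.inl (by simp only; omega))) ?_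
    rintro (_ | ⟨r₁, k⟩) hu (_ | ⟨r', k'⟩) hv h h'
    · exact absurd h (Precedes.irrefl _)
    · rw [Finset.some_mem_insertNone] at hv
      have e1 := S.le_or hv hm
      rw [swap_none_some, Equiv.swap_apply_left] at h'
      unfold num at *
      simp only [Prod.mk.injEq] at h'
      split_ifs at h' with e
      · simp only [colPos, Precedes] at h h'
        unfold Far
        omega
      · simp only [colPos, Precedes] at h h'
        unfold Far
        omega
    · rw [Finset.some_mem_insertNone] at hu
      have e1 := S.le_or hu hm
      rw [swap_none_some, Equiv.swap_apply_left] at h'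
      unfold num at *
      simp only [Prod.mk.injEq] at h'
      split_ifs at h' with e
      · simp only [colPos, Precedes] at h h'
        unfold Far
        omega
      · simp only [colPos, Precedes] at h h'
        unfold Far
        omega
    · rw [Finset.some_mem_insertNone] at hu hv
      have e1 := S.le_or hu hm
      have e2 := hc r₁
      have e3 := hc r'
      have e4 := S.le_or hv hm
      rw [swap_none_some, swap_none_some] at h'
      unfold num at *
      simp only [Prod.mk.injEq] at h'
      by_cases g : r₁ = r ∧ k = j <;> by_cases g' : r' = r ∧ k' = j
      · simp only [colPos, Precedes] at h
        omega
      · obtain ⟨rfl, rfl⟩ := g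
        simp only [if_neg g', and_self, if_true, colPos, Precedes] at h h'
        by_cases hk : k = k'
        · subst hk
          have := e3 hv (by omega)
          unfold Far
          omega
        · omega
      · obtain ⟨rfl, rfl⟩ := g'
        simp only [if_neg g, and_self, if_true, colPos, Precedes] at h h'
        omega
      · simp only [if_neg g, if_neg g', colPos, Precedes] at h h'
        omega
  · rw [num_exchange, exchange_none]
    simpa [num] using hw
  · intro h
    have := S.le_or h hm
    rw [num_exchange, exchange_none, Function.update_of_ne (by simp)]
    unfold num at *
    omega
  · intro h
    have := S.le_or h hm
    rw [num_exchange, exchange_none, Function.update_of_ne (by simp)]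
    unfold num at *
    have : j + 1 - 1 = j := by ring
    simp only [this] at *
    omega

/-- An entry of column `j` equal to the inserted letter `w` is followed by `w + 1`, since the word
is reduced. -/
theorem ColState.succ_mem (H : ColState B f b j) (hm : (r, j) ∈ B)
    (hw : num f (r, j) = (f none).1) : (r + 1, j) ∈ B ∧ num f (r + 1, j) = (f none).1 + 1 := by
  have S := H.shifted
  by_contra hn
  have h2 : ∀ k, (k, j) ∈ B → r < k → (f none).1 + 2 ≤ num f (k, j) := by
    intro k hk hck
    have hi := S _ _ hm
    have hi' := S _ _ hk
    have hk' : (r + 1, j) ∈ B := S.mem hk (by omega) (by omega) (by omega) le_rfl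
    have e1 := S.le_or hk' hm
    have e2 := S.le_or hk hk'
    have : num f (r + 1, j) ≠ (f none).1 + 1 := fun e => hn ⟨hk', e⟩
    omega
  have H2 : Spells (cells B) (colPos (-2 * j, -2 * r - 1)) f b := by
    refine H.spells.reorder (colPos_injective (Or.inr (by simp only; omega))).injOn ?_
    rintro (_ | ⟨r₁, k⟩) hu (_ | ⟨r', k'⟩) hv h h'
    · exact absurd h (Precedes.irrefl _)
    · rw [Finset.some_mem_insertNone] at hv
      simp only [colPos, Precedes] at h h'
      obtain rfl : k' = j := by omega
      have := h2 r' hv (by omega)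
      unfold num at this
      unfold Far
      omega
    · simp only [colPos, Precedes] at h h'
      omega
    · simp only [colPos, Precedes] at h h'
      omega
  refine H2.not_adjacent_eq (x := none) (y := some (r, j)) (by simp) (by simpa using hm)
    (by simp only [colPos, Precedes, true_and]; omega) ?_ (by rw [← hw]; rfl)
  rintro (_ | ⟨r₁, k⟩) hu h h'
  · exact Precedes.irrefl _ h
  · simp only [colPos, Precedes] at h h'
    omega

/-- The braid relation `w, w + 1, w → w + 1, w, w + 1` as in `RowState.switch`; the inserted letter
is the first of the three here. -/
theorem ColState.switch (H : ColState B f b j) (hm : (r, j) ∈ B)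
    (hc : ∀ r', (r', j) ∈ B → r' < r → num f (r', j) < (f none).1)
    (hw : num f (r, j) = (f none).1) :
    r + 1 < j ∧ ColState B (ShiftedEG.switch f (r, j) (r + 1, j)) b (j + 1) := by
  have S := H.shifted
  have hr := S _ _ hm
  obtain ⟨hM, hw'⟩ := H.succ_mem hm hw
  obtain ⟨hrj, hl, hlw⟩ := H.left hc hr.1 fun r' h h' => S.mem hm h h'.le (by omega) le_rfl
  have hrj' : r + 1 < j := by
    obtain ⟨-, -, -, -, h6⟩ := H.path
    by_contra hlt
    obtain rfl : r = j - 1 := by omega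
    have := h6 hm
    omega
  refine ⟨hrj', by rw [num_switch]; exact S, ?_, r, by simpa using hm, ?_, ?_, ?_⟩
  · have H2 : Spells (cells B) (colPos (-2 * j, -2 * r - 3)) f b := by
      refine H.spells.reorder (colPos_injective (Or.inr (by simp only; omega))).injOn ?_
      rintro (_ | ⟨r₁, k⟩) hu (_ | ⟨r', k'⟩) hv h h'
      · exact absurd h (Precedes.irrefl _)
      · rw [Finset.some_mem_insertNone] at hv
        simp only [colPos, Precedes] at h h'
        have := S.le_or hv hM
        unfold num at *
        unfold Far
        omega
      · simp only [colPos, Precedes] at h h'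
        omega
      · simp only [colPos, Precedes] at h h'
        omega
    -- the three consecutive letters `w, w + 1, w` become `w + 1, w, w + 1`
    have H3 : Spells (cells B) (fun u => if u = none then (-2 * j, -2 * r) else
        if u = some (r, j) then (-2 * j, -2 * r - 2) else
        if u = some (r + 1, j) then (-2 * j, -2 * r - 3) else colPos (0, 0) u)
        (ShiftedEG.switch f (r, j) (r + 1, j)) b := by
      refine H2.braid (x := none) (y := some (r + 1, j)) (z := some (r, j))
        (x' := some (r + 1, j)) (y' := some (r, j)) (z' := none) (by simp) (by simpa using hM)
        (by simpa using hm) ?_ ?_ ?_ ?_ (Or.inl ?_) hw (fun u => by tauto) ?_ ?_ ?_ ?_ ?_ ?_ ?_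
      · simp only [colPos, Precedes, true_and]; omega
      · simp only [colPos, Precedes, true_and]; omega
      · rintro (_ | ⟨r, k⟩) hu h h' <;> simp only [colPos, Precedes] at h h' <;> omega
      · rintro (_ | ⟨r, k⟩) hu h h' <;> simp only [colPos, Precedes] at h h' <;> omega
      · unfold num at *; omega
      · rintro (_ | z) h1 h2 h3
        · exact absurd rfl h1
        · rw [ne_eq, Option.some.injEq] at h2 h3
          simp only [reduceCtorEq, if_false, Option.some.injEq, if_neg h3, if_neg h2,
            ShiftedEG.switch, colPos, and_self]
      · simp [colPos]
      · simp [colPos]; ring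
      · simp [colPos]
      · simp [ShiftedEG.switch, num]
      · unfold num at *
        simp [ShiftedEG.switch, num, hw]
      · unfold num at *
        simp [ShiftedEG.switch, hw']
    refine H3.reorder (colPos_injective (Or.inl (by simp only; omega))).injOn ?_
    rintro (_ | ⟨r₁, k⟩) hu (_ | ⟨r', k'⟩) hv h h'
    · exact absurd h (Precedes.irrefl _)
    · rw [Finset.some_mem_insertNone] at hv
      have e1 := S.le_or hm hv
      have e2 : (ShiftedEG.switch f (r, j) (r + 1, j) (some (r', k'))).1 = num f (r', k') := by
        rw [← num_switch f (r, j) (r + 1, j)]; rfl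
      have e3 : (ShiftedEG.switch f (r, j) (r + 1, j) none).1 = (f none).1 + 1 := rfl
      rw [e2, e3]
      simp only [reduceCtorEq, if_true, if_false, Option.some.injEq, Prod.mk.injEq] at h
      unfold Far
      split_ifs at h <;> simp only [colPos, Precedes] at h h' <;> omega
    · simp only [reduceCtorEq, if_true, if_false, Option.some.injEq, Prod.mk.injEq] at h
      split_ifs at h <;> simp only [colPos, Precedes] at h h' <;> omega
    · simp only [reduceCtorEq, if_false, Option.some.injEq, Prod.mk.injEq] at h
      split_ifs at h <;> simp only [colPos, Precedes] at h h' <;> omega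
  · rw [num_switch]
    have : j + 1 - 1 = j := by ring
    simp only [this, hw, ShiftedEG.switch]
    omega
  · intro h
    rw [num_switch]
    have := S.le_or h hm
    simp only [ShiftedEG.switch]
    omega
  · intro h
    rw [num_switch]
    have := S.le_or h hm
    simp only [ShiftedEG.switch]
    have : j + 1 - 1 = j := by ring
    simp only [this] at *
    omega

/-- On a shifted tableau, the words read by rows and by columns differ by commutations. -/
theorem Spells.row_of_col {q q' : ℤ × ℤ} (S : IsShifted B (num f))
    (H : Spells (boxCells B) (colPos q) f b) : Spells (boxCells B) (rowPos q') f b := by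
  refine H.reorder ?_ ?_
  · rintro (_ | ⟨r, k⟩) hu (_ | ⟨r', k'⟩) hv h
    · rfl
    · simp at hu
    · simp at hv
    · simp only [rowPos, Prod.mk.injEq] at h
      simp only [Option.some.injEq, Prod.mk.injEq]
      omega
  · rintro (_ | ⟨r, k⟩) hu (_ | ⟨r', k'⟩) hv h h'
    · simp at hu
    · simp at hu
    · simp at hv
    · have e1 := S.le_or (r := r) (c := k) (by simpa using hu) (r' := r') (c' := k')
        (by simpa using hv)
      have e2 := S.le_or (r := r') (c := k') (by simpa using hv) (r' := r) (c' := k)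
        (by simpa using hu)
      simp only [rowPos, colPos, Precedes] at h h'
      unfold num at *
      unfold Far
      omega

theorem ColState.place (H : ColState B f b j) (hr : 1 ≤ r) (hx : (r, j) ∉ B)
    (hn : ∀ r', 1 ≤ r' → r' < r → (r', j) ∈ B)
    (hc : ∀ r', (r', j) ∈ B → num f (r', j) < (f none).1) :
    r < j ∧ Finished (insert (r, j) B) (fill f (r, j)) b := by
  have S := H.shifted
  obtain ⟨hrj, hl, hlw⟩ := H.left (fun r' h _ => hc r' h) hr hn
  have S' : IsShifted (insert (r, j) B) (num (ShiftedEG.fill f (r, j))) := by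
    rw [num_fill]
    refine S.set hr hrj.le (fun h => ⟨hl, hlw⟩) (fun h1 => ?_) (fun h => ?_) (fun h => ?_)
    · have := hn (r - 1) (by omega) (by omega)
      exact ⟨this, hc _ this⟩
    · exact absurd (S.mem h hr le_rfl hrj.le (by omega)) hx
    · exact absurd (S.mem h hr (by omega) hrj.le le_rfl) hx
  refine ⟨hrj, S', fun q => ?_⟩
  have H2 : Spells (cells B) (colPos (-2 * j, -2 * r)) f b := by
    refine H.spells.reorder ?_ ?_
    · rintro (_ | ⟨r₁, k⟩) hu (_ | ⟨r', k'⟩) hv h <;>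
        simp only [colPos, Prod.mk.injEq] at h
      · rfl
      · refine absurd (Finset.some_mem_insertNone.1 hv) ?_
        obtain rfl : r' = r := by omega
        obtain rfl : k' = j := by omega
        exact hx
      · refine absurd (Finset.some_mem_insertNone.1 hu) ?_
        obtain rfl : r₁ = r := by omega
        obtain rfl : k = j := by omega
        exact hx
      · simp only [Option.some.injEq, Prod.mk.injEq]
        omega
    · rintro (_ | ⟨r₁, k⟩) hu (_ | ⟨r', k'⟩) hv h h'
      · exact absurd h (Precedes.irrefl _)
      · simp only [colPos, Precedes] at h h'
        rw [Finset.some_mem_insertNone] at hv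
        obtain rfl : k' = j := by omega
        exact absurd (S.mem hv hr (by omega) hrj.le le_rfl) hx
      · simp only [colPos, Precedes] at h h'
        omega
      · simp only [colPos, Precedes] at h h'
        omega
  exact (H2.fill (p' := colPos (0, 0)) hx rfl fun z _ => rfl).row_of_col S'

end Column

/-! ### Insertion into the main diagonal -/

section Diagonal

variable {B : Finset (ℤ × ℤ)} {f : Cell → ℤ × Finset ℤ} {b : List (ℤ × Finset ℤ)} {i : ℤ}

/-- The inserted letter `w` replaces the larger diagonal entry `m`, which leaves for the next
column.  Either `m = w + 1` and the label of the diagonal box is kept, or the labels move with the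
letters, and both are cycles. -/
theorem RowState.bump_diagonal (H : RowState B f b i) (hm : (i, i) ∈ B)
    (hw : (f none).1 < num f (i, i)) : ∃ f', ColState B f' b (i + 1) ∧
      num f' = Function.update (num f) (i, i) (f none).1 ∧ (f' none).1 = num f (i, i) ∧
      (∀ z, z ≠ (i, i) → f' (some z) = f (some z)) ∧
      (((f none).2 = ∅ ∧ (f' none).2 = ∅ ∧ (f' (some (i, i))).2 = (f (some (i, i))).2) ∨
        ((f none).2 ≠ ∅ ∧ (f (some (i, i))).2 ≠ ∅ ∧ (f' none).2 = (f (some (i, i))).2 ∧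
          (f' (some (i, i))).2 = (f none).2)) := by
  have S := H.shifted
  have hi := H.one_le
  have S' : IsShifted B (Function.update (num f) (i, i) (f none).1) := by
    rw [← Finset.insert_eq_of_mem hm]
    refine S.set hi le_rfl (fun h => absurd h (lt_irrefl _)) (fun h1 => ?_) (fun h => ?_)
      (fun h => ?_)
    · refine H.below le_rfl (fun c' h h' => ?_) (fun c' h h' => ?_) h1
      · have := S _ _ h
        omega
      · omega
    · have := S.le_or h hm
      omega
    · have := S.le_or h hm
      omega
  -- cells with positions close to `K`, which is above all rows, are read first; they can be moved
  -- there, since the letters that they pass are larger than theirs by at least `2`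
  let K : ℤ := 2 * B.card + 4
  have hK : ∀ r c, (r, c) ∈ B → 2 * r + 4 ≤ K := by
    intro r c h
    have := S _ _ h
    have := S.col_le_card h
    omega
  let p : Cell → ℤ × ℤ := fun u => if u = none then (K - 1, 0) else
    if u = some (i, i) then (K, 0) else rowPos (0, 0) u
  have H2 : Spells (cells B) p f b := by
    refine H.spells.reorder ?_ ?_
    · rintro (_ | ⟨r, k⟩) hu (_ | ⟨r', k'⟩) hv h
      · rfl
      · rw [Finset.mem_coe, Finset.some_mem_insertNone] at hv
        have := hK _ _ hv
        simp only [p, if_true, if_false, reduceCtorEq, Option.some.injEq, Prod.mk.injEq] at h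
        split_ifs at h <;> simp only [rowPos, Prod.mk.injEq] at h <;> omega
      · rw [Finset.mem_coe, Finset.some_mem_insertNone] at hu
        have := hK _ _ hu
        simp only [p, if_true, if_false, reduceCtorEq, Option.some.injEq, Prod.mk.injEq] at h
        split_ifs at h <;> simp only [rowPos, Prod.mk.injEq] at h <;> omega
      · rw [Finset.mem_coe, Finset.some_mem_insertNone] at hu hv
        have := hK _ _ hu
        have := hK _ _ hv
        simp only [p, if_false, reduceCtorEq, Option.some.injEq, Prod.mk.injEq] at h ⊢
        split_ifs at h <;> simp only [rowPos, Prod.mk.injEq] at h <;> omega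
    · rintro (_ | ⟨r, k⟩) hu (_ | ⟨r', k'⟩) hv h h'
      · exact absurd h (Precedes.irrefl _)
      · simp only [p, if_true, if_false, reduceCtorEq, Option.some.injEq, Prod.mk.injEq] at h'
        split_ifs at h' with e <;> simp only [rowPos, Precedes] at h h'
        · omega
        · rw [Finset.some_mem_insertNone] at hv
          have := hK _ _ hv
          omega
      · rw [Finset.some_mem_insertNone] at hu
        have := S.le_or hu hm
        unfold num at *
        simp only [p, if_true, if_false, reduceCtorEq, Option.some.injEq, Prod.mk.injEq] at h'
        unfold Far
        split_ifs at h' with e <;> simp only [rowPos, Precedes] at h h' <;> omega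
      · rw [Finset.some_mem_insertNone] at hu hv
        have e1 := S.le_or hu hm
        have e3 := hK _ _ hv
        simp only [p, if_false, reduceCtorEq, Option.some.injEq, Prod.mk.injEq] at h'
        unfold num at *
        unfold Far
        by_cases g' : r' = i ∧ k' = i
        · obtain ⟨rfl, rfl⟩ := g'
          split_ifs at h' with e <;> simp only [rowPos, Precedes] at h h' <;> omega
        · split_ifs at h' with e <;> simp only [rowPos, Precedes] at h h' <;> omega
  obtain ⟨W, hW, hback⟩ := H2.front_two (x := some (i, i)) (y := none) (by simpa using hm)
    (by simp) (by simp)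
    (by
      rintro (_ | ⟨r, k⟩) hu h
      · simp only [p, if_true, if_false, reduceCtorEq, Precedes]
        omega
      · rw [Finset.some_mem_insertNone] at hu
        have := hK _ _ hu
        simp only [ne_eq, Option.some.injEq] at h
        simp only [p, if_true, if_false, reduceCtorEq, Precedes, Option.some.injEq, if_neg h,
          rowPos]
        omega)
    (by
      rintro (_ | ⟨r, k⟩) hu h h'
      · exact absurd rfl h'
      · rw [Finset.some_mem_insertNone] at hu
        have := hK _ _ hu
        simp only [ne_eq, Option.some.injEq] at h
        simp only [p, if_true, if_false, reduceCtorEq, Precedes, Option.some.injEq, if_neg h,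
          rowPos]
        omega)
  -- from the word with `w` in front to the word read by columns
  have key : ∀ G ℓ : Finset ℤ, IsLabelled 1 (((f none).1, G) :: (num f (i, i), ℓ) :: W) →
      ∃ f', ColState B f' b (i + 1) ∧
      num f' = Function.update (num f) (i, i) (f none).1 ∧ (f' none).1 = num f (i, i) ∧
      (∀ z, z ≠ (i, i) → f' (some z) = f (some z)) ∧ (f' none).2 = ℓ ∧
      (f' (some (i, i))).2 = G := by
    intro G ℓ hG
    let f' : Cell → ℤ × Finset ℤ := fun u => if u = none then (num f (i, i), ℓ) else
      if u = some (i, i) then ((f none).1, G) else f u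
    have hf1 : f' (some (i, i)) = ((f none).1, G) := by simp [f']
    have hf2 : f' none = (num f (i, i), ℓ) := by simp [f']
    have hf3 : ∀ z, z ≠ (i, i) → f' (some z) = f (some z) := fun z hz => by simp [f', hz]
    have hnum : num f' = Function.update (num f) (i, i) (f none).1 := by
      ext z
      rw [Function.update_apply, num]
      split_ifs with e
      · rw [e, hf1]
      · rw [hf3 z e]
        rfl
    have H3 : Spells (cells B) p f' b := by
      refine hback f' (fun u hu hu' => ?_) (by rw [hf1, hf2]; exact hG)
      simp only [f', if_neg hu, if_neg hu']
    rw [← hnum] at S'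
    have hii : num f' (i, i) = (f none).1 := by rw [num, hf1]
    refine ⟨f', ⟨S', ?_, i, by simpa using hm, ?_, ?_, ?_⟩, hnum, by rw [hf2], hf3,
      by rw [hf2], by rw [hf1]⟩
    · refine H3.reorder (colPos_injective (Or.inl (by simp only; omega))).injOn ?_
      rintro (_ | ⟨r, k⟩) hu (_ | ⟨r', k'⟩) hv h h'
      · exact absurd h (Precedes.irrefl _)
      · rw [Finset.some_mem_insertNone] at hv
        have e1 := S'.le_or hm hv
        rw [hf2]
        rw [hii] at e1
        unfold num at *
        simp only [p, if_true, if_false, reduceCtorEq, Option.some.injEq, Prod.mk.injEq] at h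
        unfold Far
        split_ifs at h with e <;> simp only [colPos, rowPos, Precedes] at h h' <;> omega
      · rw [Finset.some_mem_insertNone] at hu
        have := hK _ _ hu
        simp only [p, if_true, if_false, reduceCtorEq, Option.some.injEq, Prod.mk.injEq] at h
        split_ifs at h with e <;> simp only [colPos, rowPos, Precedes] at h h' <;> omega
      · rw [Finset.some_mem_insertNone] at hu hv
        have e1 := S'.le_or hu hv
        have e2 := S'.le_or hv hu
        have e3 := hK _ _ hu
        have e4 := hK _ _ hv
        simp only [p, if_false, reduceCtorEq, Option.some.injEq, Prod.mk.injEq] at h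
        unfold num at *
        unfold Far
        split_ifs at h with e e' e' <;> simp only [colPos, rowPos, Precedes] at h h' <;> omega
    · rw [show i + 1 - 1 = i by ring, hii, hf2]
      exact hw
    · intro h
      have := S.le_or h hm
      rw [hf2, hnum, Function.update_of_ne (by simp)]
      simp only
      omega
    · intro h
      rw [show i + 1 - 1 = i by ring] at h ⊢
      have := S.le_or h hm
      rw [hf2, hnum, Function.update_of_ne (by simp)]
      simp only
      omega
  rcases IsLabelled.bump_diagonal (G := (f (some (i, i))).2) (ℓ := (f none).2) hw hW with
    ⟨h1, h2⟩ | ⟨h1, h2, h3⟩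
  · obtain ⟨f', g1, g2, g3, g4, g5, g6⟩ := key _ _ h2
    exact ⟨f', g1, g2, g3, g4, Or.inl ⟨h1, g5, g6⟩⟩
  · obtain ⟨f', g1, g2, g3, g4, g5, g6⟩ := key _ _ h3
    exact ⟨f', g1, g2, g3, g4, Or.inr ⟨h2, h1, g5, g6⟩⟩

/-- Positions stay distinct when some of the cells, among them the inserted letter, are moved to
distinct rows given by `F` above all others, so that they are read first. -/
theorem rowPos_override_injOn {F : Cell → Option ℤ} {K : ℤ} (hK : ∀ r c, (r, c) ∈ B → 2 * r < K)
    (hF : ∀ u k, F u = some k → K ≤ k) (hF' : ∀ u v k, F u = some k → F v = some k → u = v)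
    (hn : F none ≠ none) :
    Set.InjOn (fun u => (F u).elim (rowPos (0, 0) u) fun k => (k, 0)) (cells B) := by
  intro u hu v hv h
  rw [Finset.mem_coe] at hu hv
  cases hFu : F u with
  | none =>
    cases hFv : F v with
    | none =>
      simp only [hFu, hFv, Option.elim] at h
      cases u with
      | none => exact absurd hFu hn
      | some x =>
        cases v with
        | none => exact absurd hFv hn
        | some y =>
          simp only [rowPos, Prod.mk.injEq] at h
          rw [Option.some.injEq]
          ext <;> omega
    | some k =>
      simp only [hFu, hFv, Option.elim] at h
      cases u with
      | none => exact absurd hFu hn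
      | some x =>
        have h1 := hK x.1 x.2 (Finset.some_mem_insertNone.1 hu)
        have h2 := hF v k hFv
        simp only [rowPos, Prod.mk.injEq] at h
        omega
  | some k =>
    cases hFv : F v with
    | none =>
      simp only [hFu, hFv, Option.elim] at h
      cases v with
      | none => exact absurd hFv hn
      | some x =>
        have h1 := hK x.1 x.2 (Finset.some_mem_insertNone.1 hv)
        have h2 := hF u k hFu
        simp only [rowPos, Prod.mk.injEq] at h
        omega
    | some k' =>
      simp only [hFu, hFv, Option.elim, Prod.mk.injEq] at h
      exact hF' u v k hFu (by rw [hFv, h.1])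

/-- If the inserted letter `w` equals the diagonal entry of row `i`, then the next diagonal entry
is `w + 2`, since `w, w + 1, w` cannot be the beginning of an involution word. -/
theorem RowState.diagonal_succ_mem (H : RowState B f b i) (hm : (i, i) ∈ B)
    (hw : num f (i, i) = (f none).1) :
    (i + 1, i + 1) ∈ B ∧ num f (i + 1, i + 1) = (f none).1 + 2 := by
  have S := H.shifted
  have hi := H.one_le
  obtain ⟨hM, hw'⟩ := H.succ_mem hm hw
  by_contra hn
  have h2 : ∀ r k, (r, k) ∈ B → i < r → (f none).1 + 3 ≤ num f (r, k) := by
    intro r k hk hr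
    have h1 := S _ _ hk
    have hk' : (i + 1, i + 1) ∈ B := S.mem hk (by omega) (by omega) (by omega) (by omega)
    have e1 := S.le_or hk' hM
    have e2 := S.le_or hk hk'
    have : num f (i + 1, i + 1) ≠ (f none).1 + 2 := fun e => hn ⟨hk', e⟩
    omega
  -- cells with positions close to `K`, which is above all rows, are read first; they can be moved
  -- there, since the letters that they pass are larger than theirs by at least `2`
  let K : ℤ := 2 * B.card + 4
  have hK : ∀ r c, (r, c) ∈ B → 2 * r + 4 ≤ K := by
    intro r c h
    have := S _ _ h
    have := S.col_le_card h
    omega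
  let F : Cell → Option ℤ := fun u => if u = none then some K else
    if u = some (i, i) then some (K + 2) else if u = some (i, i + 1) then some (K + 1) else none
  let p : Cell → ℤ × ℤ := fun u => (F u).elim (rowPos (0, 0) u) fun k => (k, 0)
  have p1 : p none = (K, 0) := by simp [p, F]
  have p2 : p (some (i, i)) = (K + 2, 0) := by simp [p, F]
  have p3 : p (some (i, i + 1)) = (K + 1, 0) := by simp [p, F]
  have p4 : ∀ z, z ≠ (i, i) → z ≠ (i, i + 1) → p (some z) = rowPos (0, 0) (some z) := by
    intro z h h'
    simp [p, F, h, h']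
  have hcases : ∀ z : ℤ × ℤ, z = (i, i) ∨ z = (i, i + 1) ∨ (z ≠ (i, i) ∧ z ≠ (i, i + 1)) := by
    intro z; tauto
  have H2 : Spells (cells B) p f b := by
    refine H.spells.reorder (rowPos_override_injOn (K := K) (fun r c h => by
      have := hK r c h; omega) ?_ ?_ (by simp [F])) ?_
    · intro u k h
      simp only [F] at h
      split_ifs at h <;> simp only [Option.some.injEq] at h <;> omega
    · intro u v k h h'
      simp only [F] at h h'
      split_ifs at h h' <;> simp only [Option.some.injEq] at h h' <;>
        first | omega | simp [*]
    · rintro (_ | ⟨r, k⟩) hu (_ | ⟨r', k'⟩) hv h h'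
      · exact absurd h (Precedes.irrefl _)
      · rw [Finset.some_mem_insertNone] at hv
        have := hK _ _ hv
        rw [p1] at h'
        rcases hcases (r', k') with e | e | ⟨e, e'⟩
        · rw [e] at h; simp only [rowPos, Precedes] at h; omega
        · rw [e] at h; simp only [rowPos, Precedes] at h; omega
        · rw [p4 _ e e'] at h'
          simp only [rowPos, Precedes] at h h'
          omega
      · rw [Finset.some_mem_insertNone] at hu
        have e1 := S.le_or hu hM
        have e2 := h2 _ _ hu
        rw [p1] at h'
        unfold Far
        rcases hcases (r, k) with e | e | ⟨e, e'⟩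
        · rw [e, p2] at h'; simp only [Precedes] at h'; omega
        · rw [e, p3] at h'; simp only [Precedes] at h'; omega
        · simp only [ne_eq, Prod.mk.injEq] at e e'
          have := S.le_or hu hm
          unfold num at *
          simp only [rowPos, Precedes] at h
          omega
      · rw [Finset.some_mem_insertNone] at hu hv
        have e1 := S.le_or hu hM
        have e2 := h2 _ _ hu
        have e3 := hK _ _ hu
        have e4 := hK _ _ hv
        have e5 := S.le_or hu hm
        unfold Far
        rcases hcases (r', k') with e | e | ⟨e, e'⟩
        · rw [e] at h h' ⊢
          rw [p2] at h'
          rcases hcases (r, k) with g | g | ⟨g, g'⟩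
          · rw [g] at h; exact absurd h (Precedes.irrefl _)
          · rw [g] at h; simp only [rowPos, Precedes] at h; omega
          · simp only [rowPos, Precedes] at h
            unfold num at *
            omega
        · rw [e] at h h' ⊢
          rw [p3] at h'
          rcases hcases (r, k) with g | g | ⟨g, g'⟩
          · rw [g, p2] at h'; simp only [Precedes] at h'; omega
          · rw [g] at h; exact absurd h (Precedes.irrefl _)
          · simp only [rowPos, Precedes] at h
            simp only [ne_eq, Prod.mk.injEq] at g g'
            unfold num at *
            omega
        · rw [p4 _ e e'] at h'
          rcases hcases (r, k) with g | g | ⟨g, g'⟩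
          · rw [g, p2] at h'; simp only [rowPos, Precedes] at h'; omega
          · rw [g, p3] at h'; simp only [rowPos, Precedes] at h'; omega
          · rw [p4 _ g g'] at h'
            simp only [rowPos, Precedes] at h h'
            omega
  refine H2.not_first_braid (x := some (i, i)) (y := some (i, i + 1)) (z := none)
    (by simpa using hm) (by simpa using hM) (by simp) (by simp) ?_ ?_ ?_ ?_ hw.symm
  · rintro (_ | z) hu h
    · rw [p1, p2]; simp only [Precedes]; omega
    · have := hK z.1 z.2 (Finset.some_mem_insertNone.1 hu)
      rw [p2]
      rcases hcases z with e | e | ⟨e, e'⟩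
      · rw [e] at h; exact absurd rfl h
      · rw [e, p3]; simp only [Precedes]; omega
      · rw [p4 _ e e']; simp only [rowPos, Precedes]; omega
  · rintro (_ | z) hu h h'
    · rw [p1, p3]; simp only [Precedes]; omega
    · have := hK z.1 z.2 (Finset.some_mem_insertNone.1 hu)
      rw [p3]
      rcases hcases z with e | e | ⟨e, e'⟩
      · rw [e] at h; exact absurd rfl h
      · rw [e] at h'; exact absurd rfl h'
      · rw [p4 _ e e']; simp only [rowPos, Precedes]; omega
  · rintro (_ | z) hu h h' h''
    · exact absurd rfl h''
    · have := hK z.1 z.2 (Finset.some_mem_insertNone.1 hu)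
      rw [p1]
      rcases hcases z with e | e | ⟨e, e'⟩
      · rw [e] at h; exact absurd rfl h
      · rw [e] at h'; exact absurd rfl h'
      · rw [p4 _ e e']; simp only [rowPos, Precedes]; omega
  · unfold num at *
    omega

/-- The inserted letter `w` equals the diagonal entry of row `i`.  The iterations for row `i` and
column `i + 1` turn it into `w + 2` and leave all entries unchanged, but the cycles of the diagonal
boxes of columns `i` and `i + 1` are exchanged. -/
theorem RowState.cross_diagonal (H : RowState B f b i) (hm : (i, i) ∈ B)
    (hw : num f (i, i) = (f none).1) : ∃ f', ColState B f' b (i + 2) ∧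
      num f' = num f ∧ f' none = ((f none).1 + 2, ∅) ∧
      (∀ z, z ≠ (i, i) → z ≠ (i + 1, i + 1) → f' (some z) = f (some z)) ∧
      (f (some (i, i))).2 ≠ ∅ ∧ (f (some (i + 1, i + 1))).2 ≠ ∅ ∧ (f none).2 = ∅ ∧
      (f (some (i, i + 1))).2 = ∅ ∧
      (f' (some (i, i))).2 = (f (some (i + 1, i + 1))).2 ∧
      (f' (some (i + 1, i + 1))).2 = (f (some (i, i))).2 := by
  have S := H.shifted
  have hi := H.one_le
  obtain ⟨hM, hw'⟩ := H.succ_mem hm hw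
  obtain ⟨hD, hw''⟩ := H.diagonal_succ_mem hm hw
  -- cells with positions close to `K`, which is above all rows, are read first; they can be moved
  -- there, since the letters that they pass are larger than theirs by at least `2`
  let K : ℤ := 2 * B.card + 4
  have hK : ∀ r c, (r, c) ∈ B → 2 * r + 4 ≤ K := by
    intro r c h
    have := S _ _ h
    have := S.col_le_card h
    omega
  let F : Cell → Option ℤ := fun u => if u = none then some K else
    if u = some (i, i) then some (K + 2) else if u = some (i, i + 1) then some (K + 1) else
    if u = some (i + 1, i + 1) then some (K + 3) else none
  let p : Cell → ℤ × ℤ := fun u => (F u).elim (rowPos (0, 0) u) fun k => (k, 0)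
  have p1 : p none = (K, 0) := by simp [p, F]
  have p2 : p (some (i, i)) = (K + 2, 0) := by simp [p, F]
  have p3 : p (some (i, i + 1)) = (K + 1, 0) := by simp [p, F]
  have p4 : p (some (i + 1, i + 1)) = (K + 3, 0) := by simp [p, F]
  have p5 : ∀ z, z ≠ (i, i) → z ≠ (i, i + 1) → z ≠ (i + 1, i + 1) →
      p (some z) = rowPos (0, 0) (some z) := by
    intro z h h' h''
    simp [p, F, h, h', h'']
  have hcases : ∀ z : ℤ × ℤ, z = (i, i) ∨ z = (i, i + 1) ∨ z = (i + 1, i + 1) ∨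
      (z ≠ (i, i) ∧ z ≠ (i, i + 1) ∧ z ≠ (i + 1, i + 1)) := by
    intro z; tauto
  have H2 : Spells (cells B) p f b := by
    refine H.spells.reorder (rowPos_override_injOn (K := K) (fun r c h => by
      have := hK r c h; omega) ?_ ?_ (by simp [F])) ?_
    · intro u k h
      simp only [F] at h
      split_ifs at h <;> simp only [Option.some.injEq] at h <;> omega
    · intro u v k h h'
      simp only [F] at h h'
      split_ifs at h h' <;> simp only [Option.some.injEq] at h h' <;>
        first | omega | simp [*]
    · rintro (_ | ⟨r, k⟩) hu (_ | ⟨r', k'⟩) hv h h'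
      · exact absurd h (Precedes.irrefl _)
      · rw [Finset.some_mem_insertNone] at hv
        have := hK _ _ hv
        rw [p1] at h'
        rcases hcases (r', k') with e | e | e | ⟨e, e', e''⟩
        · rw [e] at h; simp only [rowPos, Precedes] at h; omega
        · rw [e] at h; simp only [rowPos, Precedes] at h; omega
        · rw [e] at h; simp only [rowPos, Precedes] at h; omega
        · rw [p5 _ e e' e''] at h'
          simp only [rowPos, Precedes] at h h'
          omega
      · rw [Finset.some_mem_insertNone] at hu
        have e1 := S.le_or hu hM
        have e2 := S.le_or hu hD
        rw [p1] at h'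
        unfold Far
        rcases hcases (r, k) with e | e | e | ⟨e, e', e''⟩
        · rw [e, p2] at h'; simp only [Precedes] at h'; omega
        · rw [e, p3] at h'; simp only [Precedes] at h'; omega
        · rw [e, p4] at h'; simp only [Precedes] at h'; omega
        · simp only [ne_eq, Prod.mk.injEq] at e e' e''
          unfold num at *
          simp only [rowPos, Precedes] at h
          omega
      · rw [Finset.some_mem_insertNone] at hu hv
        have e1 := S.le_or hu hM
        have e2 := S.le_or hu hD
        have e3 := hK _ _ hu
        have e4 := hK _ _ hv
        have e5 := S.le_or hu hm
        unfold Far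
        rcases hcases (r', k') with e | e | e | ⟨e, e', e''⟩
        · rw [e] at h h' ⊢
          rw [p2] at h'
          rcases hcases (r, k) with g | g | g | ⟨g, g', g''⟩
          · rw [g] at h; exact absurd h (Precedes.irrefl _)
          · rw [g] at h; simp only [rowPos, Precedes] at h; omega
          · rw [g]; unfold num at *; omega
          · simp only [rowPos, Precedes] at h
            simp only [ne_eq, Prod.mk.injEq] at g g' g''
            unfold num at *
            omega
        · rw [e] at h h' ⊢
          rw [p3] at h'
          rcases hcases (r, k) with g | g | g | ⟨g, g', g''⟩
          · rw [g, p2] at h'; simp only [Precedes] at h'; omega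
          · rw [g] at h; exact absurd h (Precedes.irrefl _)
          · rw [g, p4] at h'; simp only [Precedes] at h'; omega
          · simp only [rowPos, Precedes] at h
            simp only [ne_eq, Prod.mk.injEq] at g g' g''
            unfold num at *
            omega
        · rw [e] at h h' ⊢
          rw [p4] at h'
          rcases hcases (r, k) with g | g | g | ⟨g, g', g''⟩
          · rw [g] at h; simp only [rowPos, Precedes] at h; omega
          · rw [g] at h; simp only [rowPos, Precedes] at h; omega
          · rw [g] at h; exact absurd h (Precedes.irrefl _)
          · simp only [rowPos, Precedes] at h
            simp only [ne_eq, Prod.mk.injEq] at g g' g''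
            unfold num at *
            omega
        · rw [p5 _ e e' e''] at h'
          rcases hcases (r, k) with g | g | g | ⟨g, g', g''⟩
          · rw [g, p2] at h'; simp only [rowPos, Precedes] at h'; omega
          · rw [g, p3] at h'; simp only [rowPos, Precedes] at h'; omega
          · rw [g, p4] at h'; simp only [rowPos, Precedes] at h'; omega
          · rw [p5 _ g g' g''] at h'
            simp only [rowPos, Precedes] at h h'
            omega
  obtain ⟨W, hW, hback⟩ := H2.front_four (x := some (i + 1, i + 1)) (y := some (i, i))
    (z := some (i, i + 1)) (t := none) (by simpa using hD) (by simpa using hm)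
    (by simpa using hM) (by simp) (by simp)
    (by
      rintro (_ | z) hu h
      · rw [p1, p4]; simp only [Precedes]; omega
      · have := hK z.1 z.2 (Finset.some_mem_insertNone.1 hu)
        rw [p4]
        rcases hcases z with e | e | e | ⟨e, e', e''⟩
        · rw [e, p2]; simp only [Precedes]; omega
        · rw [e, p3]; simp only [Precedes]; omega
        · rw [e] at h; exact absurd rfl h
        · rw [p5 _ e e' e'']; simp only [rowPos, Precedes]; omega)
    (by
      rintro (_ | z) hu h h'
      · rw [p1, p2]; simp only [Precedes]; omega
      · have := hK z.1 z.2 (Finset.some_mem_insertNone.1 hu)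
        rw [p2]
        rcases hcases z with e | e | e | ⟨e, e', e''⟩
        · rw [e] at h'; exact absurd rfl h'
        · rw [e, p3]; simp only [Precedes]; omega
        · rw [e] at h; exact absurd rfl h
        · rw [p5 _ e e' e'']; simp only [rowPos, Precedes]; omega)
    (by
      rintro (_ | z) hu h h' h''
      · rw [p1, p3]; simp only [Precedes]; omega
      · have := hK z.1 z.2 (Finset.some_mem_insertNone.1 hu)
        rw [p3]
        rcases hcases z with e | e | e | ⟨e, e', e''⟩
        · rw [e] at h'; exact absurd rfl h'
        · rw [e] at h''; exact absurd rfl h''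
        · rw [e] at h; exact absurd rfl h
        · rw [p5 _ e e' e'']; simp only [rowPos, Precedes]; omega)
    (by
      rintro (_ | z) hu h h' h'' h₃
      · exact absurd rfl h₃
      · have := hK z.1 z.2 (Finset.some_mem_insertNone.1 hu)
        rw [p1]
        rcases hcases z with e | e | e | ⟨e, e', e''⟩
        · rw [e] at h'; exact absurd rfl h'
        · rw [e] at h''; exact absurd rfl h''
        · rw [e] at h; exact absurd rfl h
        · rw [p5 _ e e' e'']; simp only [rowPos, Precedes]; omega)
  set w := (f none).1 with hwdef
  have c1 : f (some (i + 1, i + 1)) = (w + 2, (f (some (i + 1, i + 1))).2) := Prod.ext hw'' rfl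
  have c2 : f (some (i, i)) = (w, (f (some (i, i))).2) := Prod.ext hw rfl
  have c3 : f (some (i, i + 1)) = (w + 1, (f (some (i, i + 1))).2) := Prod.ext hw' rfl
  have c4 : f none = (w, (f none).2) := rfl
  rw [c1, c2, c3, c4] at hW
  obtain ⟨hA, hB, hC, hE, hW'⟩ := hW.cross_diagonal
  let f' : Cell → ℤ × Finset ℤ := fun u => if u = none then (w + 2, ∅) else
    if u = some (i, i) then (w, (f (some (i + 1, i + 1))).2) else
    if u = some (i + 1, i + 1) then (w + 2, (f (some (i, i))).2) else f u
  have f1 : f' none = (w + 2, ∅) := by simp [f']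
  have f2 : f' (some (i, i)) = (w, (f (some (i + 1, i + 1))).2) := by simp [f']
  have f3 : f' (some (i + 1, i + 1)) = (w + 2, (f (some (i, i))).2) := by simp [f']
  have f4 : ∀ z, z ≠ (i, i) → z ≠ (i + 1, i + 1) → f' (some z) = f (some z) :=
    fun z h h' => by simp [f', h, h']
  have hnum : num f' = num f := by
    ext z
    by_cases e : z = (i, i)
    · rw [e, num, f2, hw]
    by_cases e' : z = (i + 1, i + 1)
    · rw [e', num, f3, hw'']
    · rw [num, f4 z e e', num]
  let p' : Cell → ℤ × ℤ := fun u => if u = some (i, i) then (K + 3, 0) else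
    if u = some (i + 1, i + 1) then (K + 2, 0) else p u
  have q1 : p' none = (K, 0) := by simp [p', p1]
  have q2 : p' (some (i, i)) = (K + 3, 0) := by simp [p']
  have q3 : p' (some (i, i + 1)) = (K + 1, 0) := by simp [p', p3]
  have q4 : p' (some (i + 1, i + 1)) = (K + 2, 0) := by simp [p']
  have q5 : ∀ z, z ≠ (i, i) → z ≠ (i, i + 1) → z ≠ (i + 1, i + 1) →
      p' (some z) = rowPos (0, 0) (some z) := by
    intro z h h' h''
    simp [p', h, h'', p5 z h h' h'']
  have H3 : Spells (cells B) p' f' b := by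
    refine hback f' p' ?_ (by rw [q4, p2]) (by rw [q2, p4]) (by rw [q3, p3]) (by rw [q1, p1]) ?_
    · rintro (_ | z) h h' h'' h₃
      · exact absurd rfl h₃
      · simp only [ne_eq, Option.some.injEq] at h h' h''
        rw [q5 z h' h'' h, p5 z h' h'' h, f4 z h' h]
        exact ⟨rfl, rfl⟩
    · rw [f2, f3, f1, f4 _ (by simp) (by simp), c3, hC]
      exact hW'
  have S' : IsShifted B (num f') := by rw [hnum]; exact S
  refine ⟨f', ⟨S', ?_, i, ?_, ?_, ?_, ?_⟩, hnum, f1, f4, hB, hA, hE, hC, by rw [f2], by rw [f3]⟩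
  · refine H3.reorder (colPos_injective (Or.inl (by simp only; omega))).injOn ?_
    rintro (_ | ⟨r, k⟩) hu (_ | ⟨r', k'⟩) hv h h'
    · exact absurd h (Precedes.irrefl _)
    · rw [Finset.some_mem_insertNone] at hv
      rw [q1] at h
      rw [f1]
      unfold Far
      rcases hcases (r', k') with e | e | e | ⟨e, e', e''⟩
      · rw [e, q2] at h; simp only [Precedes] at h; omega
      · rw [e, q3] at h; simp only [Precedes] at h; omega
      · rw [e, q4] at h; simp only [Precedes] at h; omega
      · have e1 := S.le_or hM hv
        have e2 := S.le_or hv hM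
        rw [f4 _ e e'']
        simp only [ne_eq, Prod.mk.injEq] at e e' e''
        simp only [colPos, Precedes] at h'
        unfold num at *
        omega
    · rw [Finset.some_mem_insertNone] at hu
      have e3 := hK _ _ hu
      rw [q1] at h
      rcases hcases (r, k) with e | e | e | ⟨e, e', e''⟩
      · rw [e] at h'; simp only [colPos, Precedes] at h'; omega
      · rw [e] at h'; simp only [colPos, Precedes] at h'; omega
      · rw [e] at h'; simp only [colPos, Precedes] at h'; omega
      · rw [q5 _ e e' e''] at h
        simp only [rowPos, Precedes] at h
        omega
    · rw [Finset.some_mem_insertNone] at hu hv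
      have e1 := S'.le_or hu hv
      have e2 := S'.le_or hv hu
      have e3 := hK _ _ hu
      have e4 := hK _ _ hv
      have e5 : Far (num f' (r, k)) (num f' (r', k')) := by
        unfold Far
        rcases hcases (r, k) with g | g | g | ⟨g, g', g''⟩
        · simp only [Prod.mk.injEq] at g
          simp only [colPos, Precedes] at h'
          omega
        · simp only [Prod.mk.injEq] at g
          simp only [colPos, Precedes] at h'
          rcases hcases (r', k') with e | e | e | ⟨e, e', e''⟩
          · rw [e, q2, g.1, g.2, q3] at h; simp only [Precedes] at h; omega
          · rw [e, g.1, g.2] at h; exact absurd h (Precedes.irrefl _)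
          · rw [e, q4, g.1, g.2, q3] at h; simp only [Precedes] at h; omega
          · simp only [ne_eq, Prod.mk.injEq] at e e' e''
            omega
        · simp only [Prod.mk.injEq] at g
          simp only [colPos, Precedes] at h'
          rcases hcases (r', k') with e | e | e | ⟨e, e', e''⟩
          · rw [e, q2, g.1, g.2, q4] at h; simp only [Precedes] at h; omega
          · simp only [Prod.mk.injEq] at e; omega
          · rw [e, g.1, g.2] at h; exact absurd h (Precedes.irrefl _)
          · simp only [ne_eq, Prod.mk.injEq] at e e' e''
            omega
        · rw [q5 _ g g' g''] at h
          rcases hcases (r', k') with e | e | e | ⟨e, e', e''⟩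
          · rw [e, q2] at h; simp only [rowPos, Precedes] at h; omega
          · rw [e, q3] at h; simp only [rowPos, Precedes] at h; omega
          · rw [e, q4] at h; simp only [rowPos, Precedes] at h; omega
          · rw [q5 _ e e' e''] at h
            simp only [rowPos, Precedes] at h
            simp only [colPos, Precedes] at h'
            omega
      exact e5
  · rw [show i + 2 - 1 = i + 1 by ring]
    exact hM
  · rw [show i + 2 - 1 = i + 1 by ring, hnum, f1]
    simp only
    omega
  · intro h
    have := S.le_or h hM
    rw [hnum, f1]
    simp only
    omega
  · rw [show i + 2 - 1 = i + 1 by ring]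
    intro h
    have := S.le_or h hM
    rw [hnum, f1]
    simp only
    omega

end Diagonal

/-! ### Iterations of the insertion loop -/

section Segments

theorem mem_segment {T : Tableau} {col : Bool} {i : ℤ} {x : ℤ × ℤ} :
    x ∈ T.segment col i ↔ x ∈ T.boxes ∧ (if col then x.2 else x.1) = i := by
  simp [Tableau.segment, readingOrder]

theorem twice_lt_twice {u v : Letter} (h : u.num < v.num) : u.twice < v.twice := by
  unfold Letter.twice
  split_ifs <;> omega

theorem smallest_eq_some {T : Tableau} {col : Bool} {i : ℤ} {p : ℤ → Bool} {x : ℤ × ℤ}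
    (hx : x ∈ T.segment col i) (hp : p (T.entry x).num = true)
    (hmin : ∀ y ∈ T.segment col i, p (T.entry y).num = true → y ≠ x →
      (T.entry x).num < (T.entry y).num) : T.smallest col i p = some x := by
  have hx' : x ∈ (T.segment col i).filter (fun x => p (T.entry x).num) :=
    List.mem_filter.2 ⟨hx, hp⟩
  unfold smallest
  cases h : ((T.segment col i).filter (fun x => p (T.entry x).num)).argmin
      (fun x => (T.entry x).twice) with
  | none =>
    rw [List.argmin_eq_none.1 h] at hx'
    simp at hx'
  | some y =>
    have hy := List.mem_filter.1 (List.argmin_mem h)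
    have hle := List.le_of_mem_argmin hx' h
    by_contra hne
    have := twice_lt_twice (hmin y hy.1 hy.2 fun e => hne (by rw [e]))
    omega

theorem smallest_eq_none {T : Tableau} {col : Bool} {i : ℤ} {p : ℤ → Bool}
    (h : ∀ y ∈ T.segment col i, ¬p (T.entry y).num = true) : T.smallest col i p = none := by
  unfold smallest
  rw [List.argmin_eq_none, List.filter_eq_nil_iff]
  exact h

theorem exists_find_empty (B : Finset (ℤ × ℤ)) {pos : ℕ → ℤ × ℤ} (hpos : Function.Injective pos) :
    ∃ k, pos k ∉ B ∧ (∀ k' < k, pos k' ∈ B) ∧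
      ((List.range (B.card + 1)).find? (fun k => pos k ∉ B)).getD 0 = k := by
  have hex : ∃ k, pos k ∉ B := by
    by_contra hn
    push Not at hn
    have hsub : (Finset.range (B.card + 1)).image pos ⊆ B := by
      intro x hx
      obtain ⟨k, -, rfl⟩ := Finset.mem_image.1 hx
      exact hn k
    have := Finset.card_le_card hsub
    rw [Finset.card_image_of_injective _ hpos, Finset.card_range] at this
    omega
  classical
  have hlt : ∀ k' < Nat.find hex, pos k' ∈ B := fun k' hk => not_not.1 (Nat.find_min hex hk)
  have hle : Nat.find hex ≤ B.card := by
    have hsub : (Finset.range (Nat.find hex)).image pos ⊆ B := by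
      intro x hx
      obtain ⟨k, hk, rfl⟩ := Finset.mem_image.1 hx
      exact hlt k (Finset.mem_range.1 hk)
    have := Finset.card_le_card hsub
    rwa [Finset.card_image_of_injective _ hpos, Finset.card_range] at this
  refine ⟨Nat.find hex, Nat.find_spec hex, hlt, ?_⟩
  have : (List.range (B.card + 1)).find? (fun k => pos k ∉ B) = some (Nat.find hex) := by
    rw [List.find?_range_eq_some]
    refine ⟨by simpa using Nat.find_spec hex, List.mem_range.2 (by omega), fun k hk => ?_⟩
    simpa using hlt k hk
  rw [this]
  rfl

theorem exists_firstEmpty_row (B : Finset (ℤ × ℤ)) (i : ℤ) : ∃ c, i ≤ c ∧ (i, c) ∉ B ∧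
    (∀ c', i ≤ c' → c' < c → (i, c') ∈ B) ∧
      ∀ T : Tableau, T.boxes = B → T.firstEmpty false i = (i, c) := by
  obtain ⟨k, h1, h2, h3⟩ := exists_find_empty B (pos := fun k : ℕ => (i, i + (k : ℤ)))
    fun a b h => by simpa using h
  refine ⟨i + k, by omega, h1, fun c' hc hc' => ?_, ?_⟩
  · have := h2 (c' - i).toNat (by omega)
    have e : i + ((c' - i).toNat : ℤ) = c' := by omega
    rwa [e] at this
  · rintro T rfl
    unfold firstEmpty
    simp only [Bool.false_eq_true, if_false]
    rw [h3]

theorem exists_firstEmpty_col (B : Finset (ℤ × ℤ)) (j : ℤ) : ∃ r, 1 ≤ r ∧ (r, j) ∉ B ∧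
    (∀ r', 1 ≤ r' → r' < r → (r', j) ∈ B) ∧
      ∀ T : Tableau, T.boxes = B → T.firstEmpty true j = (r, j) := by
  obtain ⟨k, h1, h2, h3⟩ := exists_find_empty B (pos := fun k : ℕ => ((k : ℤ) + 1, j))
    fun a b h => by simpa using h
  refine ⟨k + 1, by omega, h1, fun r' hr hr' => ?_, ?_⟩
  · have := h2 (r' - 1).toNat (by omega)
    have e : ((r' - 1).toNat : ℤ) + 1 = r' := by omega
    rwa [e] at this
  · rintro T rfl
    unfold firstEmpty
    simp only [if_true]
    rw [h3]

/-- The first box along a row or column that satisfies `P`, if there is any. -/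
theorem exists_first (B : Finset (ℤ × ℤ)) (pos : ℤ → ℤ × ℤ) (hpos : Function.Injective pos)
    (P : ℤ × ℤ → Prop) :
    (∃ c, pos c ∈ B ∧ P (pos c) ∧ ∀ k, pos k ∈ B → k < c → ¬P (pos k)) ∨
      ∀ c, pos c ∈ B → ¬P (pos c) := by
  classical
  by_cases h : ∃ c, pos c ∈ B ∧ P (pos c)
  · left
    have hfin : {c | pos c ∈ B ∧ P (pos c)}.Finite :=
      (B.finite_toSet.preimage hpos.injOn).subset fun c hc => hc.1
    obtain ⟨c, hc, hmin⟩ := hfin.toFinset.exists_min_image id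
      ((Set.Finite.toFinset_nonempty hfin).2 h)
    rw [Set.Finite.mem_toFinset] at hc
    refine ⟨c, hc.1, hc.2, fun k hk hkc hP => ?_⟩
    have := hmin k ((Set.Finite.mem_toFinset hfin).2 ⟨hk, hP⟩)
    simp only [id] at this
    omega
  · right
    exact fun c hc hP => h ⟨c, hc, hP⟩

end Segments

section Steps

variable {fuel : ℕ} {T : Tableau} {col : Bool} {i : ℤ} {w : Letter} {m M : ℤ × ℤ}

theorem insertLoop_place (h : T.smallest col i (fun e => w.num < e) = none) :
    insertLoop fuel T col i w = T.place col i w := by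
  cases fuel with
  | zero => rfl
  | succ n =>
    rw [insertLoop, h]
    split <;> simp_all

theorem insertLoop_bump (h : T.smallest col i (fun e => w.num ≤ e) = some m)
    (h' : T.smallest col i (fun e => w.num < e) = some m) (hm : m.1 ≠ m.2) :
    insertLoop (fuel + 1) T col i w = insertLoop fuel (T.set m w) col (i + 1) (T.entry m) := by
  rw [insertLoop, h, h']
  simp only [if_true, if_pos hm]

theorem insertLoop_diagonal (h : T.smallest col i (fun e => w.num ≤ e) = some m)
    (h' : T.smallest col i (fun e => w.num < e) = some m) (hm : m.1 = m.2) :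
    insertLoop (fuel + 1) T col i w = insertLoop fuel (T.set m (Letter.ofInt w.num)) true (i + 1)
      ⟨(T.entry m).num, w.primed⟩ := by
  rw [insertLoop, h, h']
  simp [hm]

theorem insertLoop_switch (h : T.smallest col i (fun e => w.num ≤ e) = some m)
    (h' : T.smallest col i (fun e => w.num < e) = some M) (hm : m ≠ M) :
    insertLoop (fuel + 1) T col i w = insertLoop fuel (T.switchPrimes m M)
      (decide (m.1 = m.2) || col) (i + 1) ⟨w.num + 1, w.primed⟩ := by
  rw [insertLoop, h, h']
  simp only [if_neg hm]

end Steps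

/-! ### Primes and labels -/

/-- The tableau `T` has the boxes `B` and the numbers of `f`, and the primes off the main diagonal
indicate whether the labels belong to `S`. -/
structure Agrees (T : Tableau) (B : Finset (ℤ × ℤ)) (f : Cell → ℤ × Finset ℤ)
    (S : Set (Finset ℤ)) : Prop where
  boxes : T.boxes = B
  num_eq : ∀ x ∈ B, (T.entry x).num = num f x
  primed_iff : ∀ x ∈ B, (T.entry x).primed = true ↔ x.1 ≠ x.2 ∧ (f (some x)).2 ∈ S

/-- The letter `w` has the number `u.1`, and its prime indicates whether the label `u.2` belongs
to `S`. -/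
def LetterAgrees (w : Letter) (u : ℤ × Finset ℤ) (S : Set (Finset ℤ)) : Prop :=
  w.num = u.1 ∧ (w.primed = true ↔ u.2 ∈ S)

section Agrees

variable {T : Tableau} {B : Finset (ℤ × ℤ)} {f : Cell → ℤ × Finset ℤ} {S : Set (Finset ℤ)}
  {w : Letter} {i j r c : ℤ}

theorem Agrees.smallest_row (A : Agrees T B f S) (hS : IsShifted B (num f)) {p : ℤ → Bool}
    (hm : (i, c) ∈ B) (hp : p (num f (i, c)) = true)
    (hlt : ∀ k, (i, k) ∈ B → k < c → ¬p (num f (i, k)) = true) :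
    T.smallest false i p = some (i, c) := by
  refine smallest_eq_some (mem_segment.2 ⟨by rwa [A.boxes], rfl⟩) (by rwa [A.num_eq _ hm]) ?_
  rintro ⟨r, k⟩ hy hpy hne
  obtain ⟨h1, h2⟩ := mem_segment.1 hy
  obtain rfl : r = i := by simpa using h2
  rw [A.boxes] at h1
  rw [A.num_eq _ h1] at hpy ⊢
  rw [A.num_eq _ hm]
  have h3 : ¬k < c := fun h => hlt k h1 h hpy
  have := hS.le_or h1 hm
  have : k ≠ c := fun e => hne (by rw [e])
  omega

theorem Agrees.smallest_col (A : Agrees T B f S) (hS : IsShifted B (num f)) {p : ℤ → Bool}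
    (hm : (r, j) ∈ B) (hp : p (num f (r, j)) = true)
    (hlt : ∀ k, (k, j) ∈ B → k < r → ¬p (num f (k, j)) = true) :
    T.smallest true j p = some (r, j) := by
  refine smallest_eq_some (mem_segment.2 ⟨by rwa [A.boxes], rfl⟩) (by rwa [A.num_eq _ hm]) ?_
  rintro ⟨k, c⟩ hy hpy hne
  obtain ⟨h1, h2⟩ := mem_segment.1 hy
  obtain rfl : c = j := by simpa using h2
  rw [A.boxes] at h1
  rw [A.num_eq _ h1] at hpy ⊢
  rw [A.num_eq _ hm]
  have h3 : ¬k < r := fun h => hlt k h1 h hpy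
  have := hS.le_or h1 hm
  have : k ≠ r := fun e => hne (by rw [e])
  omega

theorem Agrees.smallest_row_none (A : Agrees T B f S) {p : ℤ → Bool}
    (h : ∀ k, (i, k) ∈ B → ¬p (num f (i, k)) = true) : T.smallest false i p = none := by
  refine smallest_eq_none ?_
  rintro ⟨r, k⟩ hy
  obtain ⟨h1, h2⟩ := mem_segment.1 hy
  obtain rfl : r = i := by simpa using h2
  rw [A.boxes] at h1
  rw [A.num_eq _ h1]
  exact h k h1

theorem Agrees.smallest_col_none (A : Agrees T B f S) {p : ℤ → Bool}
    (h : ∀ k, (k, j) ∈ B → ¬p (num f (k, j)) = true) : T.smallest true j p = none := by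
  refine smallest_eq_none ?_
  rintro ⟨k, c⟩ hy
  obtain ⟨h1, h2⟩ := mem_segment.1 hy
  obtain rfl : c = j := by simpa using h2
  rw [A.boxes] at h1
  rw [A.num_eq _ h1]
  exact h k h1

theorem Agrees.exchange (A : Agrees T B f S) {m : ℤ × ℤ} (hm : m ∈ B) (hd : m.1 ≠ m.2)
    (hw : LetterAgrees w (f none) S) : Agrees (T.set m w) B (exchange f m) S ∧
      LetterAgrees (T.entry m) (ShiftedEG.exchange f m none) S := by
  refine ⟨⟨?_, fun x hx => ?_, fun x hx => ?_⟩, ?_⟩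
  · simp only [Tableau.set, A.boxes, Finset.insert_eq_of_mem hm]
  · rw [num_exchange]
    by_cases e : x = m
    · subst e
      simpa [Tableau.set] using hw.1
    · simpa [Tableau.set, e] using A.num_eq x hx
  · rw [exchange_some]
    by_cases e : x = m
    · subst e
      simpa [Tableau.set, hd] using hw.2
    · simpa [Tableau.set, e] using A.primed_iff x hx
  · rw [exchange_none]
    exact ⟨A.num_eq m hm, by simpa [hd] using A.primed_iff m hm⟩

theorem Agrees.switch (A : Agrees T B f S) {m M : ℤ × ℤ} (hm : m ∈ B) (hM : M ∈ B) (hne : m ≠ M)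
    (hd : m.1 ≠ m.2) (hD : M.1 ≠ M.2) : Agrees (T.switchPrimes m M) B (switch f m M) S := by
  refine ⟨?_, fun x hx => ?_, fun x hx => ?_⟩
  · simp only [switchPrimes, Tableau.set, A.boxes, Finset.insert_eq_of_mem hm,
      Finset.insert_eq_of_mem hM]
  · rw [num_switch]
    by_cases e : x = M
    · subst e
      simpa [switchPrimes, Tableau.set] using A.num_eq x hx
    by_cases e' : x = m
    · subst e'
      simpa [switchPrimes, Tableau.set, e] using A.num_eq x hx
    · simpa [switchPrimes, Tableau.set, e, e'] using A.num_eq x hx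
  · by_cases e : x = M
    · subst e
      simpa [switchPrimes, Tableau.set, ShiftedEG.switch, hne.symm, hd, hD] using A.primed_iff m hm
    by_cases e' : x = m
    · subst e'
      simpa [switchPrimes, Tableau.set, e, ShiftedEG.switch, hd, hD] using A.primed_iff M hM
    · simpa [switchPrimes, Tableau.set, e, e', ShiftedEG.switch] using A.primed_iff x hx

theorem Agrees.fill (A : Agrees T B f S) {x : ℤ × ℤ} {v : Letter} (hv : v.num = (f none).1)
    (hv' : v.primed = true ↔ x.1 ≠ x.2 ∧ (f none).2 ∈ S) :
    Agrees (T.set x v) (insert x B) (fill f x) S := by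
  refine ⟨by simp only [Tableau.set, A.boxes], fun y hy => ?_, fun y hy => ?_⟩
  · rw [num_fill]
    by_cases e : y = x
    · subst e
      simpa [Tableau.set] using hv
    · simpa [Tableau.set, e] using A.num_eq y (Finset.mem_of_mem_insert_of_ne hy e)
  · by_cases e : y = x
    · subst e
      simpa [Tableau.set, ShiftedEG.fill] using hv'
    · simpa [Tableau.set, e, ShiftedEG.fill] using
        A.primed_iff y (Finset.mem_of_mem_insert_of_ne hy e)

end Agrees

section Loops

variable {b : List (ℤ × Finset ℤ)}

/-- From column `j` on, the insertion carries labels and primes along and does not change the main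
diagonal. -/
theorem insertLoop_column (fuel : ℕ) : ∀ {B : Finset (ℤ × ℤ)} {f : Cell → ℤ × Finset ℤ} {j : ℤ},
    ColState B f b j → (B.card : ℤ) + 1 ≤ fuel + j →
    ∃ f' x, x ∉ B ∧ x.1 ≠ x.2 ∧ Finished (insert x B) f' b ∧
      (∀ d, f' (some (d, d)) = f (some (d, d))) ∧
      ∀ (S : Set (Finset ℤ)) (T : Tableau) (w : Letter), Agrees T B f S →
        LetterAgrees w (f none) S → (insertLoop fuel T true j w).box = x ∧
        Agrees (insertLoop fuel T true j w).tableau (insert x B) f' S := by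
  induction fuel with
  | zero =>
    intro B f j H hfuel
    obtain ⟨r, h1, h2, h3, h4⟩ := exists_firstEmpty_col B j
    have hc : ∀ r', (r', j) ∉ B := fun r' h => by
      have := H.shifted.col_le_card h
      push_cast at hfuel
      omega
    obtain ⟨hrj, hF⟩ := H.place h1 h2 h3 fun r' h => absurd h (hc r')
    refine ⟨_, _, h2, hrj.ne, hF, fun d => ?_, fun S T w A hw => ?_⟩
    · rw [fill, Function.update_of_ne]
      simp only [ne_eq, Option.some.injEq, Prod.mk.injEq]
      omega
    · rw [insertLoop, place, h4 T A.boxes]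
      simp only [if_neg hrj.ne]
      exact ⟨trivial, A.fill hw.1 (by rw [hw.2]; simp [hrj.ne])⟩
  | succ n ih =>
    intro B f j H hfuel
    rcases exists_first B (fun r => (r, j)) (fun a b h => (Prod.mk.inj h).1)
      (fun x => (f none).1 ≤ num f x) with ⟨r, hm, hw, hlt⟩ | hlt
    · have hlt' : ∀ k, (k, j) ∈ B → k < r → num f (k, j) < (f none).1 :=
        fun k hk hkr => not_le.1 (hlt k hk hkr)
      by_cases e : num f (r, j) = (f none).1
      · obtain ⟨hrj, H'⟩ := H.switch hm hlt' e
        obtain ⟨hM, hw'⟩ := H.succ_mem hm e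
        obtain ⟨f', x, h1, h2, h3, h4, h5⟩ := ih H' (by push_cast at hfuel; omega)
        refine ⟨f', x, h1, h2, h3, fun d => ?_, fun S T w A hl => ?_⟩
        · rw [h4, switch, if_neg, if_neg] <;> simp only [Prod.mk.injEq] <;> omega
        · rw [insertLoop_switch (m := (r, j)) (M := (r + 1, j)), Bool.or_true]
          · refine h5 S _ _ (A.switch hm hM (by simp) (by simp only; omega) (by simp only; omega))
              ⟨?_, hl.2⟩
            simp only [switch, hl.1]
          · refine A.smallest_col H.shifted hm (by simpa [hl.1] using hw) fun k hk hkr => ?_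
            simpa [hl.1] using hlt' k hk hkr
          · refine A.smallest_col H.shifted hM (by simp [hl.1, hw']) fun k hk hkr => ?_
            have := H.shifted.le_or hm hk
            simp only [hl.1, decide_eq_true_eq]
            omega
          · simp
      · have hw' : (f none).1 < num f (r, j) := lt_of_le_of_ne hw (Ne.symm e)
        obtain ⟨hrj, H'⟩ := H.bump hm hlt' hw'
        obtain ⟨f', x, h1, h2, h3, h4, h5⟩ := ih H' (by push_cast at hfuel; omega)
        refine ⟨f', x, h1, h2, h3, fun d => ?_, fun S T w A hl => ?_⟩
        · rw [h4, exchange_some, if_neg]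
          simp only [Prod.mk.injEq]
          omega
        · obtain ⟨A', hl'⟩ := A.exchange hm hrj.ne hl
          rw [insertLoop_bump (m := (r, j)) _ _ hrj.ne]
          · exact h5 S _ _ A' hl'
          · refine A.smallest_col H.shifted hm (by simpa [hl.1] using hw) fun k hk hkr => ?_
            simpa [hl.1] using hlt' k hk hkr
          · refine A.smallest_col H.shifted hm (by simpa [hl.1] using hw') fun k hk hkr => ?_
            simpa [hl.1] using (hlt' k hk hkr).le
    · have hlt' : ∀ k, (k, j) ∈ B → num f (k, j) < (f none).1 := fun k hk => not_le.1 (hlt k hk)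
      obtain ⟨r, h1, h2, h3, h4⟩ := exists_firstEmpty_col B j
      obtain ⟨hrj, hF⟩ := H.place h1 h2 h3 hlt'
      refine ⟨_, _, h2, hrj.ne, hF, fun d => ?_, fun S T w A hw => ?_⟩
      · rw [fill, Function.update_of_ne]
        simp only [ne_eq, Option.some.injEq, Prod.mk.injEq]
        omega
      · rw [insertLoop_place (A.smallest_col_none fun k hk => by
          simpa [hw.1] using (hlt' k hk).le), place, h4 T A.boxes]
        simp only [if_neg hrj.ne]
        exact ⟨trivial, A.fill hw.1 (by rw [hw.2]; simp [hrj.ne])⟩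

end Loops

/-! ### Insertion of a letter -/

/-- How an insertion that adds the box `x` and turns the contents `f` into `f'` changes the main
diagonal, together with the permutation `σ` of cycles that accounts for the change: nothing
happens (`same`), a diagonal box is added (`new`), the entry of one diagonal box decreases
(`lower`), or the cycles of two consecutive diagonal boxes are exchanged (`cross`). -/
inductive DiagonalStep (B : Finset (ℤ × ℤ)) (f f' : Cell → ℤ × Finset ℤ) (x : ℤ × ℤ) :
    Equiv.Perm (Finset ℤ) → Prop
  | same (hx : x.1 ≠ x.2) (h : ∀ d, f' (some (d, d)) = f (some (d, d))) :
      DiagonalStep B f f' x 1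
  | new (hx : x.1 = x.2) (h : ∀ d, (d, d) ∈ B → f' (some (d, d)) = f (some (d, d))) :
      DiagonalStep B f f' x 1
  | lower (j : ℤ) (hx : x.1 ≠ x.2) (hj : (j, j) ∈ B)
      (h : ∀ d, d ≠ j → f' (some (d, d)) = f (some (d, d)))
      (hlt : num f' (j, j) < num f (j, j)) :
      DiagonalStep B f f' x (Equiv.swap (f' (some (j, j))).2 (f (some (j, j))).2)
  | cross (j : ℤ) (hx : x.1 ≠ x.2) (hj : (j, j) ∈ B) (hj' : (j + 1, j + 1) ∈ B)
      (h : ∀ d, d ≠ j → d ≠ j + 1 → f' (some (d, d)) = f (some (d, d)))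
      (h1 : num f' (j, j) = num f (j, j)) (h2 : num f' (j + 1, j + 1) = num f (j + 1, j + 1))
      (h3 : (f' (some (j, j))).2 = (f (some (j + 1, j + 1))).2)
      (h4 : (f' (some (j + 1, j + 1))).2 = (f (some (j, j))).2)
      (hne : (f' (some (j, j))).2 ≠ (f (some (j, j))).2) :
      DiagonalStep B f f' x (Equiv.swap (f' (some (j, j))).2 (f (some (j, j))).2)

theorem DiagonalStep.congr {B : Finset (ℤ × ℤ)} {f g f' : Cell → ℤ × Finset ℤ} {x : ℤ × ℤ}
    {σ : Equiv.Perm (Finset ℤ)} (D : DiagonalStep B f f' x σ)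
    (h : ∀ d, g (some (d, d)) = f (some (d, d))) : DiagonalStep B g f' x σ := by
  cases D with
  | same hx h' => exact .same hx fun d => by rw [h, h']
  | new hx h' => exact .new hx fun d hd => by rw [h, h' d hd]
  | lower j hx hj h' hlt =>
    rw [← h j]
    exact .lower j hx hj (fun d hd => by rw [h, h' d hd]) (by rw [num, num, h]; exact hlt)
  | cross j hx hj hj' h' h1 h2 h3 h4 hne =>
    rw [← h j]
    exact .cross j hx hj hj' (fun d hd hd' => by rw [h, h' d hd hd'])
      (by rw [num, num, h]; exact h1) (by rw [num, num, h]; exact h2) (by rw [h]; exact h3)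
      (by rw [h]; exact h4) (by rw [h]; exact hne)

/-- What the insertion of the letter `f none` into the tableau with contents `f` does: it adds the
box `x` and leads to the contents `f'`.  If the primes of the tableau and the letter indicate
membership of labels in `S`, then those of the new tableau indicate membership in the inverse image
of `S` under `σ`. -/
structure InsertionSpec (B : Finset (ℤ × ℤ)) (f : Cell → ℤ × Finset ℤ) (b : List (ℤ × Finset ℤ))
    (run : Tableau → Letter → Result) (f' : Cell → ℤ × Finset ℤ) (x : ℤ × ℤ)
    (σ : Equiv.Perm (Finset ℤ)) : Prop where
  not_mem : x ∉ B
  finished : Finished (insert x B) f' b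
  step : DiagonalStep B f f' x σ
  diagonal : ∀ d, (d, d) ∈ B → σ (f' (some (d, d))).2 = (f (some (d, d))).2
  tail : ∀ v ∈ b, σ v.2 = v.2
  empty : σ ∅ = ∅
  agrees : ∀ (S : Set (Finset ℤ)) (T : Tableau) (w : Letter), ∅ ∉ S → Agrees T B f S →
    LetterAgrees w (f none) S → (run T w).box = x ∧
      Agrees (run T w).tableau (insert x B) f' {θ | σ θ ∈ S} ∧
      (x.1 = x.2 → ((run T w).endsInColumn = true ↔ (f' (some x)).2 ∈ {θ | σ θ ∈ S}))

section RowLoop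

variable {B : Finset (ℤ × ℤ)} {f : Cell → ℤ × Finset ℤ} {b : List (ℤ × Finset ℤ)} {i : ℤ}

theorem RowState.place_spec (H : RowState B f b i) (fuel : ℕ)
    (hlt : ∀ k, (i, k) ∈ B → num f (i, k) < (f none).1) :
    ∃ f' x σ, InsertionSpec B f b (fun T w => insertLoop fuel T false i w) f' x σ := by
  obtain ⟨c, h1, h2, h3, h4⟩ := exists_firstEmpty_row B i
  have hF := H.place h1 h2 h3 hlt
  have hfill : ∀ z, z ≠ (i, c) → fill f (i, c) (some z) = f (some z) := fun z hz => by
    rw [fill, Function.update_of_ne]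
    simpa using hz
  have hdiag : ∀ d, (d, d) ∈ B → fill f (i, c) (some (d, d)) = f (some (d, d)) :=
    fun d hd => hfill _ fun e => h2 (e ▸ hd)
  have hx : fill f (i, c) (some (i, c)) = f none := by simp [fill]
  refine ⟨fill f (i, c), (i, c), 1, h2, hF, ?_, fun d hd => by rw [hdiag d hd]; rfl,
    fun _ _ => rfl, rfl, fun S T w _ A hw => ?_⟩
  · by_cases e : i = c
    · exact .new e hdiag
    · refine .same e fun d => hfill _ ?_
      simp only [ne_eq, Prod.mk.injEq]
      omega
  · simp only [Equiv.Perm.coe_one, id, Set.ofPred_mem_eq]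
    rw [insertLoop_place (A.smallest_row_none fun k hk => by
      simpa [hw.1] using (hlt k hk).le), Tableau.place, h4 T A.boxes]
    by_cases e : i = c
    · simp only [if_pos e]
      refine ⟨trivial, A.fill hw.1 ?_, fun _ => ?_⟩
      · simp [Letter.ofInt, e]
      · rw [hx]
        exact hw.2
    · simp only [if_neg e]
      refine ⟨trivial, A.fill hw.1 (by rw [hw.2]; simp [e]), fun h => absurd h e⟩

/-- The labels of the other cells are fixed by the exchange of two labels that are cycles. -/
theorem Spells.swap_apply {B : Finset Cell} {p : Cell → ℤ × ℤ} (H : Spells B p f b)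
    {u v z : Cell} (hu : u ∈ B) (hv : v ∈ B) (hz : z ∈ B) (hzu : z ≠ u) (hzv : z ≠ v)
    (hu' : (f u).2 ≠ ∅) (hv' : (f v).2 ≠ ∅) :
    Equiv.swap (f u).2 (f v).2 (f z).2 = (f z).2 :=
  Equiv.swap_apply_of_ne_of_ne (H.labels_ne hu hz hzu.symm hu').symm
    (H.labels_ne hv hz hzv.symm hv').symm

/-- The letter that leaves the diagonal has the prime of `w` rather than that of the replaced entry;
the transposition `σ` of their labels makes up for it. -/
theorem RowState.bump_diagonal_spec (H : RowState B f b i) (hm : (i, i) ∈ B)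
    (hw : (f none).1 < num f (i, i)) (n : ℕ) (hfuel : (B.card : ℤ) + 1 ≤ n + (i + 1)) :
    ∃ f' x σ, InsertionSpec B f b (fun T w => insertLoop (n + 1) T false i w) f' x σ := by
  obtain ⟨g, Hg, hgnum, hg1, hg2, hg3⟩ := H.bump_diagonal hm hw
  obtain ⟨f', x, h1, h2, h3, h4, h5⟩ := insertLoop_column n Hg hfuel
  have hS := H.shifted
  have hgi : num g (i, i) = (f none).1 := by rw [hgnum, Function.update_self]
  have hmc : some (i, i) ∈ cells B := by simpa using hm
  have hnc : none ∈ cells B := by simp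
  set σ : Equiv.Perm (Finset ℤ) := Equiv.swap (g (some (i, i))).2 (f (some (i, i))).2 with hσ
  have hfix : ∀ z ∈ B, z ≠ (i, i) → σ (f (some z)).2 = (f (some z)).2 := by
    intro z hz hne
    rcases hg3 with ⟨-, -, e⟩ | ⟨e1, e2, -, e3⟩
    · rw [hσ, e, Equiv.swap_self]
      rfl
    · rw [hσ, e3]
      exact H.spells.swap_apply hnc hmc (by simpa using hz) (by simp) (by simpa using hne) e1 e2
  have hnone : ∀ S : Set (Finset ℤ), σ (g none).2 ∈ S ↔ (f none).2 ∈ S := by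
    intro S
    rcases hg3 with ⟨e1, e2, e⟩ | ⟨e1, e2, e3, e4⟩
    · rw [hσ, e, Equiv.swap_self, e1, e2]
      rfl
    · rw [hσ, e3, e4, Equiv.swap_apply_right]
  refine ⟨f', x, σ, h1, h3, ?_, fun d hd => ?_, fun v hv => ?_, ?_, fun S T w _ A hl => ?_⟩
  · rw [hσ, ← h4 i]
    refine .lower i h2 hm (fun d hd => ?_) ?_
    · rw [h4, hg2]
      simpa using hd
    · rw [num, h4]
      rw [num] at hgi
      rw [hgi]
      exact hw
  · rw [h4]
    by_cases e : d = i
    · rw [e, hσ, Equiv.swap_apply_left]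
    · have hne : (d, d) ≠ (i, i) := by simpa using e
      rw [hg2 _ hne, hfix _ hd hne]
  · rcases hg3 with ⟨-, -, e⟩ | ⟨e1, e2, -, e3⟩
    · rw [hσ, e, Equiv.swap_self]
      rfl
    · rw [hσ, e3]
      exact Equiv.swap_apply_of_ne_of_ne (H.spells.labels_ne_tail hnc e1 v hv)
        (H.spells.labels_ne_tail hmc e2 v hv)
  · rcases hg3 with ⟨-, -, e⟩ | ⟨e1, e2, -, e3⟩
    · rw [hσ, e, Equiv.swap_self]
      rfl
    · rw [hσ, e3]
      exact Equiv.swap_apply_of_ne_of_ne e1.symm e2.symm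
  · have hlt : ∀ k, (i, k) ∈ B → ¬k < i := fun k hk => by
      have := hS _ _ hk
      omega
    rw [insertLoop_diagonal (m := (i, i))
      (A.smallest_row hS hm (by simpa [hl.1] using hw.le) fun k hk hki => absurd hki (hlt k hk))
      (A.smallest_row hS hm (by simpa [hl.1] using hw) fun k hk hki => absurd hki (hlt k hk)) rfl]
    have A' : Agrees (T.set (i, i) (Letter.ofInt w.num)) B g {θ | σ θ ∈ S} := by
      refine ⟨?_, fun z hz => ?_, fun z hz => ?_⟩
      · simp only [Tableau.set, A.boxes, Finset.insert_eq_of_mem hm]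
      · by_cases e : z = (i, i)
        · subst e
          rw [hgi]
          simpa [Tableau.set, Letter.ofInt] using hl.1
        · rw [num, hg2 z e, ← num]
          simpa [Tableau.set, e] using A.num_eq z hz
      · by_cases e : z = (i, i)
        · subst e
          simp [Tableau.set, Letter.ofInt]
        · rw [hg2 z e, Set.mem_ofPred_eq, hfix z hz e]
          simpa [Tableau.set, e] using A.primed_iff z hz
    have hl' : LetterAgrees ⟨(T.entry (i, i)).num, w.primed⟩ (g none) {θ | σ θ ∈ S} := by
      refine ⟨?_, ?_⟩
      · simp only
        rw [A.num_eq _ hm, hg1]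
      · rw [Set.mem_ofPred_eq, hnone]
        exact hl.2
    obtain ⟨g1, g2⟩ := h5 _ _ _ A' hl'
    exact ⟨g1, g2, fun h => absurd h h2⟩

/-- The entries involved have no primes: two of them are on the main diagonal, and the labels of the
other two letters are `∅`. -/
theorem RowState.cross_diagonal_spec (H : RowState B f b i) (hm : (i, i) ∈ B)
    (hw : num f (i, i) = (f none).1) (n : ℕ) (hfuel : (B.card : ℤ) + 1 ≤ n + (i + 2)) :
    ∃ f' x σ, InsertionSpec B f b (fun T w => insertLoop (n + 1 + 1) T false i w) f' x σ := by
  obtain ⟨g, Hg, hgnum, hg1, hg2, hA, hB, hE, hC, hgA, hgB⟩ := H.cross_diagonal hm hw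
  obtain ⟨hM, hw'⟩ := H.succ_mem hm hw
  obtain ⟨hD, hw''⟩ := H.diagonal_succ_mem hm hw
  obtain ⟨f', x, h1, h2, h3, h4, h5⟩ := insertLoop_column n Hg hfuel
  have hS := H.shifted
  have hmc : some (i, i) ∈ cells B := by simpa using hm
  have hDc : some (i + 1, i + 1) ∈ cells B := by simpa using hD
  have hne : (some (i + 1, i + 1) : Cell) ≠ some (i, i) := by simp
  have hAB := H.spells.labels_ne hDc hmc hne hB
  set σ : Equiv.Perm (Finset ℤ) := Equiv.swap (g (some (i, i))).2 (f (some (i, i))).2 with hσ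
  have hfix : ∀ z ∈ B, z ≠ (i, i) → z ≠ (i + 1, i + 1) → σ (f (some z)).2 = (f (some z)).2 := by
    intro z hz hne hne'
    rw [hσ, hgA]
    exact H.spells.swap_apply hDc hmc (by simpa using hz) (by simpa using hne')
      (by simpa using hne) hB hA
  have hempty : σ ∅ = ∅ := by
    rw [hσ, hgA]
    exact Equiv.swap_apply_of_ne_of_ne hB.symm hA.symm
  refine ⟨f', x, σ, h1, h3, ?_, fun d hd => ?_, fun v hv => ?_, hempty, fun S T w hS' A hl => ?_⟩
  · rw [hσ, ← h4 i]
    refine .cross i h2 hm hD (fun d hd hd' => ?_) ?_ ?_ ?_ ?_ ?_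
    · rw [h4, hg2 _ (by simpa using hd) (by simpa using hd')]
    · rw [← hgnum, num, h4, num]
    · rw [← hgnum, num, h4, num]
    · rw [h4, hgA]
    · rw [h4, hgB]
    · rw [h4, hgA]
      exact hAB
  · rw [h4]
    by_cases e : d = i
    · rw [e, hσ, Equiv.swap_apply_left]
    by_cases e' : d = i + 1
    · rw [e', hgB, hσ, hgA, Equiv.swap_apply_right]
    · have hne : (d, d) ≠ (i, i) := by simpa using e
      have hne' : (d, d) ≠ (i + 1, i + 1) := by simpa using e'
      rw [hg2 _ hne hne', hfix _ hd hne hne']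
  · rw [hσ, hgA]
    exact Equiv.swap_apply_of_ne_of_ne (H.spells.labels_ne_tail hDc hB v hv)
      (H.spells.labels_ne_tail hmc hA v hv)
  · have hlt : ∀ k, (i, k) ∈ B → ¬k < i := fun k hk => by
      have := hS _ _ hk
      omega
    -- neither the three boxes concerned nor the inserted letter have primes
    have n1 : (T.entry (i, i)).primed = false := by
      have := A.primed_iff _ hm
      simpa using this
    have n2 : (T.entry (i, i + 1)).primed = false := by
      have := A.primed_iff _ hM
      rw [hC] at this
      simpa [hS'] using this
    have n3 : (T.entry (i + 1, i + 1)).primed = false := by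
      have := A.primed_iff _ hD
      simpa using this
    have n4 : w.primed = false := by
      have := hl.2
      rw [hE] at this
      simpa [hS'] using this
    have unchanged : ∀ (U : Tableau) (y z : ℤ × ℤ), U.boxes = B → y ∈ B → z ∈ B → y ≠ z →
        (U.entry y).primed = false → (U.entry z).primed = false → U.switchPrimes y z = U := by
      intro U y z hU hy hz hyz h h'
      obtain ⟨UB, UE⟩ := U
      simp only at hU h h'
      subst hU
      have e1 : (⟨(UE y).num, (UE z).primed⟩ : Letter) = UE y := by rw [h', ← h]
      have e2 : (⟨(UE z).num, (UE y).primed⟩ : Letter) = UE z := by rw [h, ← h']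
      simp only [switchPrimes, Tableau.set, e1, e2, Function.update_eq_self,
        Finset.insert_eq_of_mem hy, Finset.insert_eq_of_mem hz]
    rw [insertLoop_switch (m := (i, i)) (M := (i, i + 1)) _ _ (by simp),
      unchanged T _ _ A.boxes hm hM (by simp) n1 n2]
    · simp only [decide_true, Bool.true_or]
      rw [insertLoop_switch (m := (i, i + 1)) (M := (i + 1, i + 1)) _ _ (by simp),
        unchanged T _ _ A.boxes hM hD (by simp) n2 n3, Bool.or_true,
        show i + 1 + 1 = i + 2 by ring]
      · have A' : Agrees T B g {θ | σ θ ∈ S} := by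
          refine ⟨A.boxes, fun z hz => by rw [hgnum]; exact A.num_eq z hz, fun z hz => ?_⟩
          rw [A.primed_iff z hz]
          by_cases e : z.1 = z.2
          · simp [e]
          · have e1 : z ≠ (i, i) := by rintro rfl; exact e rfl
            have e2 : z ≠ (i + 1, i + 1) := by rintro rfl; exact e rfl
            rw [hg2 z e1 e2, Set.mem_ofPred_eq, hfix z hz e1 e2]
        have hl' : LetterAgrees ⟨w.num + 1 + 1, w.primed⟩ (g none) {θ | σ θ ∈ S} := by
          refine ⟨by rw [hg1, ← hl.1]; simp only; ring, ?_⟩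
          rw [hg1, Set.mem_ofPred_eq, hempty]
          simp [n4, hS']
        obtain ⟨g1, g2⟩ := h5 _ _ _ A' hl'
        exact ⟨g1, g2, fun h => absurd h h2⟩
      · refine A.smallest_col hS hM (by simp [hl.1, hw']) fun k hk hki => ?_
        have := hS.le_or hM hk
        simp only [hl.1, decide_eq_true_eq]
        omega
      · refine A.smallest_col hS hD (by simp [hl.1, hw'']) fun k hk hki => ?_
        have := hS.le_or hM hk
        simp only [hl.1, decide_eq_true_eq]
        omega
    · exact A.smallest_row hS hm (by simp [hl.1, hw]) fun k hk hki => absurd hki (hlt k hk)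
    · refine A.smallest_row hS hM (by simp [hl.1, hw']) fun k hk hki => ?_
      have := hS.le_or hm hk
      simp only [hl.1, decide_eq_true_eq]
      omega

/-- An iteration off the main diagonal can be put in front of a description of those that follow. -/
theorem InsertionSpec.of_step {g f' : Cell → ℤ × Finset ℤ} {x : ℤ × ℤ}
    {σ : Equiv.Perm (Finset ℤ)} {run run' : Tableau → Letter → Result}
    (I : InsertionSpec B g b run f' x σ) (hg : ∀ d, g (some (d, d)) = f (some (d, d)))
    (h : ∀ (S : Set (Finset ℤ)) (T : Tableau) (w : Letter), Agrees T B f S →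
      LetterAgrees w (f none) S → ∃ T' w', run' T w = run T' w' ∧ Agrees T' B g S ∧
        LetterAgrees w' (g none) S) : InsertionSpec B f b run' f' x σ := by
  refine ⟨I.not_mem, I.finished, I.step.congr fun d => (hg d).symm,
    fun d hd => by rw [I.diagonal d hd, hg], I.tail, I.empty, fun S T w hS A hw => ?_⟩
  obtain ⟨T', w', e, A', hw'⟩ := h S T w A hw
  rw [e]
  exact I.agrees S T' w' hS A' hw'

/-- The insertion from row `i` on.  The bound on the number of iterations suffices, since iteration
`i` is preceded by `i - 1` others and a shifted diagram has at most as many columns as boxes. -/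
theorem insertLoop_row (fuel : ℕ) : ∀ {f : Cell → ℤ × Finset ℤ} {i : ℤ}, RowState B f b i →
    (B.card : ℤ) + 1 ≤ fuel + i →
    ∃ f' x σ, InsertionSpec B f b (fun T w => insertLoop fuel T false i w) f' x σ := by
  induction fuel with
  | zero =>
    intro f i H hfuel
    refine H.place_spec 0 fun k hk => ?_
    have h1 := H.shifted _ _ hk
    have h2 := H.shifted.col_le_card hk
    push_cast at hfuel
    omega
  | succ n ih =>
    intro f i H hfuel
    rcases exists_first B (fun c => (i, c)) (fun a b h => (Prod.mk.inj h).2)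
      (fun x => (f none).1 ≤ num f x) with ⟨c, hm, hw, hlt⟩ | hlt
    · have hlt' : ∀ k, (i, k) ∈ B → k < c → num f (i, k) < (f none).1 :=
        fun k hk hkr => not_le.1 (hlt k hk hkr)
      have hic := H.shifted _ _ hm
      rcases hic.2.1.lt_or_eq with hlt'' | rfl
      · by_cases e : num f (i, c) = (f none).1
        · obtain ⟨hM, hw'⟩ := H.succ_mem hm e
          obtain ⟨f', x, σ, I⟩ := ih (H.switch hm hlt'' e) (by push_cast at hfuel; omega)
          refine ⟨f', x, σ, I.of_step (fun d => ?_) fun S T w A hl => ?_⟩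
          · rw [switch, if_neg, if_neg] <;> simp only [Prod.mk.injEq] <;> omega
          · have hd : (decide ((i, c).1 = (i, c).2) || false) = false := by simp [hlt''.ne]
            refine ⟨T.switchPrimes (i, c) (i, c + 1), ⟨w.num + 1, w.primed⟩,
              (insertLoop_switch (m := (i, c)) (M := (i, c + 1)) ?_ ?_ (by simp)).trans
                (by rw [hd]), ?_⟩
            · refine A.smallest_row H.shifted hm (by simpa [hl.1] using hw) fun k hk hkr => ?_
              simpa [hl.1] using hlt' k hk hkr
            · refine A.smallest_row H.shifted hM (by simp [hl.1, hw']) fun k hk hkr => ?_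
              have := H.shifted.le_or hm hk
              simp only [hl.1, decide_eq_true_eq]
              omega
            · exact ⟨A.switch hm hM (by simp) (by simp only; omega) (by simp only; omega),
                by simp only [switch, hl.1], hl.2⟩
        · have hw' : (f none).1 < num f (i, c) := lt_of_le_of_ne hw (Ne.symm e)
          obtain ⟨f', x, σ, I⟩ := ih (H.bump hm hlt'' hlt' hw') (by push_cast at hfuel; omega)
          refine ⟨f', x, σ, I.of_step (fun d => ?_) fun S T w A hl => ?_⟩
          · rw [exchange_some, if_neg]
            simp only [Prod.mk.injEq]
            omega
          · refine ⟨_, _, insertLoop_bump (m := (i, c)) ?_ ?_ hlt''.ne,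
              A.exchange hm hlt''.ne hl⟩
            · refine A.smallest_row H.shifted hm (by simpa [hl.1] using hw) fun k hk hkr => ?_
              simpa [hl.1] using hlt' k hk hkr
            · refine A.smallest_row H.shifted hm (by simpa [hl.1] using hw') fun k hk hkr => ?_
              simpa [hl.1] using (hlt' k hk hkr).le
      · by_cases e : num f (i, i) = (f none).1
        · cases n with
          | zero =>
            -- there is a box in column `i + 1`, so that a further iteration is available
            have := H.shifted.col_le_card (H.succ_mem hm e).1
            push_cast at hfuel
            omega
          | succ n => exact H.cross_diagonal_spec hm e n (by push_cast at hfuel; omega)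
        · exact H.bump_diagonal_spec hm (lt_of_le_of_ne hw (Ne.symm e)) n
            (by push_cast at hfuel; omega)
    · exact H.place_spec _ fun k hk => not_le.1 (hlt k hk)

end RowLoop

/-- The insertion of the letter that follows the reading word of a tableau. -/
theorem insertLetter_spec {B : Finset (ℤ × ℤ)} {f : Cell → ℤ × Finset ℤ} {u : ℤ × Finset ℤ}
    {b : List (ℤ × Finset ℤ)} (F : Finished B f (u :: b)) (hu : f none = u) :
    ∃ f' x σ, InsertionSpec B f b (fun T w => T.insertLetter w) f' x σ := by
  have H : RowState B f b 1 := by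
    refine ⟨F.shifted, ?_, le_rfl, Or.inl rfl⟩
    obtain ⟨l, hl, H⟩ := F.spells (2 * 1 - 1, 0)
    refine ⟨l ++ [none], ⟨?_, fun v => ?_⟩, ?_⟩
    · rw [List.pairwise_append]
      refine ⟨hl.1, List.pairwise_singleton _ _, fun v hv v' hv' => ?_⟩
      rw [List.mem_singleton.1 hv']
      obtain ⟨z, hz, rfl⟩ := Finset.mem_map.1 ((hl.2 v).1 hv)
      have := F.shifted z.1 z.2 hz
      simp only [Function.Embedding.some_apply, rowPos, Precedes]
      omega
    · rw [List.mem_append, hl.2, List.mem_singleton]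
      cases v <;> simp
    · rw [List.map_append, List.append_assoc]
      simpa [hu] using H
  obtain ⟨f', x, σ, I⟩ := insertLoop_row (2 * B.card) H (by push_cast; omega)
  refine ⟨f', x, σ, I.of_step (fun _ => rfl) fun S T w A hw => ⟨T, w, ?_, A, hw⟩⟩
  rw [insertLetter, A.boxes]

/-! ### Cycle sequences -/

section Reading

variable {T : Tableau} {B : Finset (ℤ × ℤ)} {f : Cell → ℤ × Finset ℤ} {S : Set (Finset ℤ)}
  {b : List (ℤ × Finset ℤ)} {q : ℤ × ℤ} {l : List Cell}

/-- Arrangements by rows agree with the row reading order of the tableau. -/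
theorem Arranged.eq_map_readingOrder (h : Arranged (boxCells T.boxes) (rowPos q) l) :
    l = T.readingOrder.map some := by
  have hn : (T.readingOrder.map (some : ℤ × ℤ → Cell)).Nodup :=
    (Finset.sort_nodup _ _).map (Option.some_injective _)
  have hp : (T.readingOrder.map (some : ℤ × ℤ → Cell)).Pairwise
      fun u v => Precedes (rowPos q u) (rowPos q v) := by
    rw [List.pairwise_map]
    refine ((Finset.pairwise_sort T.boxes ReadsBefore).and (Finset.sort_nodup T.boxes _)).imp ?_
    rintro ⟨a, c⟩ ⟨a', c'⟩ ⟨h1, h2⟩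
    simp only [ne_eq, Prod.mk.injEq] at h2
    simp only [ReadsBefore] at h1
    simp only [rowPos, Precedes]
    omega
  refine List.Perm.eq_of_pairwise (fun u v _ _ h1 h2 => absurd h2 h1.asymm) h.1 hp
    ((List.perm_ext_iff_of_nodup h.nodup hn).2 fun u => ?_)
  rw [h.2]
  simp [boxCells, readingOrder]

/-- The labels in the tableau are its sets `γ_{ij}(T, b)`. -/
theorem Finished.boxGamma_eq (F : Finished B f b) (A : Agrees T B f S) {x : ℤ × ℤ} (hx : x ∈ B) :
    boxGamma T (b.map Prod.fst) x = (f (some x)).2 := by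
  obtain ⟨l, hl, H⟩ := F.spells (0, 0)
  rw [← A.boxes] at hl hx
  rw [hl.eq_map_readingOrder, List.map_map] at H
  have hword : unprime T.row ++ b.map Prod.fst =
      (T.readingOrder.map (f ∘ some) ++ b).map Prod.fst := by
    rw [List.map_append, unprime, row, List.map_map, List.map_map]
    congr 1
    refine List.map_congr_left fun y hy => ?_
    have : y ∈ B := by
      rw [← A.boxes]
      exact (Finset.mem_sort _).1 hy
    exact A.num_eq y this
  have hidx : T.readingOrder.idxOf x < T.readingOrder.length :=
    List.idxOf_lt_length_of_mem ((Finset.mem_sort _).2 hx)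
  rw [boxGamma, if_pos hx, hword,
    H.gamma_eq (by simp only [List.length_append, List.length_map]; omega)]
  rw [List.getElem_append_left (by simpa using hidx)]
  simp

theorem eq_Icc_card {R : Finset ℤ} (h1 : ∀ k ∈ R, 1 ≤ k)
    (h2 : ∀ k ∈ R, ∀ k', 1 ≤ k' → k' ≤ k → k' ∈ R) : R = Finset.Icc 1 (R.card : ℤ) := by
  rcases R.eq_empty_or_nonempty with rfl | hR
  · simp
  · have e : R = Finset.Icc 1 (R.max' hR) := by
      ext k
      rw [Finset.mem_Icc]
      exact ⟨fun h => ⟨h1 k h, R.le_max' k h⟩, fun h => h2 _ (R.max'_mem hR) k h.1 h.2⟩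
    have h3 := h1 _ (R.max'_mem hR)
    have : (R.card : ℤ) = R.max' hR := by
      conv_lhs => rw [e]
      rw [Int.card_Icc]
      omega
    rwa [this]

/-- The diagonal boxes are those of the rows `1, …, q`, where `q` is the number of rows. -/
theorem IsShifted.diagonal_mem_iff {N : ℤ × ℤ → ℤ} (hS : IsShifted B N) (k : ℤ) :
    (k, k) ∈ B ↔ 1 ≤ k ∧ k ≤ ((B.image Prod.fst).card : ℤ) := by
  have e : ∀ k, (k, k) ∈ B ↔ k ∈ B.image Prod.fst := by
    intro k
    rw [Finset.mem_image]
    refine ⟨fun h => ⟨_, h, rfl⟩, ?_⟩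
    rintro ⟨⟨r, c⟩, h, rfl⟩
    have := hS r c h
    exact hS.mem h this.1 le_rfl le_rfl this.2.1
  rw [e, ← Finset.mem_Icc, ← eq_Icc_card]
  · intro k hk
    exact (hS k k ((e k).2 hk)).1
  · intro k hk k' h1 h2
    exact (e k').1 (hS.mem ((e k).2 hk) h1 h2 le_rfl h2)

/-- The labels and numbers in the first `q` boxes of the main diagonal. -/
def diagonalColumns (f : Cell → ℤ × Finset ℤ) (q : ℕ) : List (Finset ℤ × ℤ) :=
  (List.range q).map fun k : ℕ =>
    ((f (some ((k : ℤ) + 1, (k : ℤ) + 1))).2, num f ((k : ℤ) + 1, (k : ℤ) + 1))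

theorem Finished.cycleSequence_eq (F : Finished B f b) (A : Agrees T B f S) :
    cycleSequence T (b.map Prod.fst) = diagonalColumns f (B.image Prod.fst).card := by
  -- the indices of the columns are integers, obtained from natural numbers through the list monad
  have e : ∀ n : ℕ, (do let k ← List.range n; pure (k : ℤ)) = (List.range n).map Nat.cast :=
    fun n => List.flatMap_pure_eq_map _ _
  rw [cycleSequence, diagonalColumns, numRows, A.boxes, e, List.map_map]
  refine List.map_congr_left fun k hk => ?_
  have hk' : (((k : ℤ) + 1, (k : ℤ) + 1) : ℤ × ℤ) ∈ B := by
    rw [F.shifted.diagonal_mem_iff]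
    have := List.mem_range.1 hk
    omega
  rw [Function.comp_apply, F.boxGamma_eq A hk', A.num_eq _ hk']

theorem getD_diagonalColumns {k n : ℕ} (h : k < n) (e : Finset ℤ × ℤ) :
    (diagonalColumns f n).getD k e =
      ((f (some ((k : ℤ) + 1, (k : ℤ) + 1))).2, num f ((k : ℤ) + 1, (k : ℤ) + 1)) := by
  simp [diagonalColumns, h]

theorem length_diagonalColumns (n : ℕ) : (diagonalColumns f n).length = n := by
  simp [diagonalColumns]

/-- The permutation read off from the two cycle sequences is the one that accounts for the change
of the diagonal. -/
theorem DiagonalStep.cycleSwap_eq {f' : Cell → ℤ × Finset ℤ} {x : ℤ × ℤ}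
    {σ : Equiv.Perm (Finset ℤ)} (D : DiagonalStep B f f' x σ) (hx : x ∉ B) {n n' : ℕ}
    (hn : ∀ k : ℤ, (k, k) ∈ B ↔ 1 ≤ k ∧ k ≤ n)
    (hn' : ∀ k : ℤ, (k, k) ∈ insert x B ↔ 1 ≤ k ∧ k ≤ n') :
    cycleSwap (diagonalColumns f n) (diagonalColumns f' n') = σ := by
  have hlen : x.1 ≠ x.2 → n' = n := by
    intro h
    have e : ∀ k : ℤ, (k, k) ∈ insert x B ↔ (k, k) ∈ B := fun k => by
      rw [Finset.mem_insert, or_iff_right]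
      rintro rfl
      exact h rfl
    have h1 := ((hn n').symm.trans (e _).symm).trans (hn' n')
    have h2 := ((hn n).symm.trans (e _).symm).trans (hn' n)
    omega
  cases D with
  | same h h' =>
    rw [hlen h, cycleSwap, if_pos (Or.inl _)]
    exact List.map_congr_left fun k _ => by rw [num, num, h']
  | new h h' =>
    rw [cycleSwap, if_pos (Or.inr _)]
    rw [length_diagonalColumns, length_diagonalColumns]
    intro e
    obtain ⟨r, c⟩ := x
    obtain rfl : r = c := h
    rw [hn, e, ← hn'] at hx
    exact hx (Finset.mem_insert_self _ _)
  | lower j h hj h' hlt =>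
    rw [hlen h]
    obtain ⟨h1, h2⟩ := (hn j).1 hj
    obtain ⟨k, rfl⟩ : ∃ k : ℕ, j = (k : ℤ) + 1 := ⟨(j - 1).toNat, by omega⟩
    have hk : k < n := by omega
    have hd : (diagonalColumns f' n).getD k (∅, 0) = _ := getD_diagonalColumns hk _
    have hc : (diagonalColumns f n).getD k (∅, 0) = _ := getD_diagonalColumns hk _
    rw [cycleSwap, if_neg]
    · have hfind : (List.range (diagonalColumns f n).length).find? (fun j => decide (
          ((diagonalColumns f' n).getD j (∅, 0)).2 < ((diagonalColumns f n).getD j (∅, 0)).2 ∨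
          (j + 1 < (diagonalColumns f n).length ∧
            ((diagonalColumns f n).getD (j + 1) (∅, 0)).1 =
              ((diagonalColumns f' n).getD j (∅, 0)).1 ∧
            ((diagonalColumns f' n).getD j (∅, 0)).1 ≠ ((diagonalColumns f n).getD j (∅, 0)).1 ∧
            ((diagonalColumns f n).getD j (∅, 0)).1 =
              ((diagonalColumns f' n).getD (j + 1) (∅, 0)).1))) = some k := by
        rw [List.find?_range_eq_some, length_diagonalColumns]
        refine ⟨?_, List.mem_range.2 hk, fun k' hk' => ?_⟩
        · rw [hd, hc]
          simp [hlt]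
        · rw [getD_diagonalColumns (hk'.trans hk), getD_diagonalColumns (hk'.trans hk), num, num,
            h' _ (by omega)]
          simp
      simp only [hfind, hd, hc]
    · rw [length_diagonalColumns, length_diagonalColumns]
      simp only [ne_eq, not_true_eq_false, or_false]
      intro e
      rw [← e, hc] at hd
      have := congrArg Prod.snd hd
      simp only at this
      omega
  | cross j h hj hj' h' e1 e2 e3 e4 hne =>
    rw [hlen h]
    obtain ⟨h1, h2⟩ := (hn j).1 hj
    obtain ⟨-, h3⟩ := (hn _).1 hj'
    obtain ⟨k, rfl⟩ : ∃ k : ℕ, j = (k : ℤ) + 1 := ⟨(j - 1).toNat, by omega⟩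
    have hk : k < n := by omega
    have hk1 : k + 1 < n := by omega
    have hd : (diagonalColumns f' n).getD k (∅, 0) = _ := getD_diagonalColumns hk _
    have hc : (diagonalColumns f n).getD k (∅, 0) = _ := getD_diagonalColumns hk _
    have hd1 : (diagonalColumns f' n).getD (k + 1) (∅, 0) = _ := getD_diagonalColumns hk1 _
    have hc1 : (diagonalColumns f n).getD (k + 1) (∅, 0) = _ := getD_diagonalColumns hk1 _
    push_cast at hd1 hc1
    rw [cycleSwap, if_neg]
    · have hfind : (List.range (diagonalColumns f n).length).find? (fun j => decide (
          ((diagonalColumns f' n).getD j (∅, 0)).2 < ((diagonalColumns f n).getD j (∅, 0)).2 ∨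
          (j + 1 < (diagonalColumns f n).length ∧
            ((diagonalColumns f n).getD (j + 1) (∅, 0)).1 =
              ((diagonalColumns f' n).getD j (∅, 0)).1 ∧
            ((diagonalColumns f' n).getD j (∅, 0)).1 ≠ ((diagonalColumns f n).getD j (∅, 0)).1 ∧
            ((diagonalColumns f n).getD j (∅, 0)).1 =
              ((diagonalColumns f' n).getD (j + 1) (∅, 0)).1))) = some k := by
        rw [List.find?_range_eq_some, length_diagonalColumns]
        refine ⟨?_, List.mem_range.2 hk, fun k' hk' => ?_⟩
        · rw [hd, hc, hd1, hc1]
          exact decide_eq_true (Or.inr ⟨hk1, e3.symm, hne, e4.symm⟩)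
        · rw [getD_diagonalColumns (hk'.trans hk), getD_diagonalColumns (hk'.trans hk), num, num,
            h' _ (by omega) (by omega)]
          simp
      simp only [hfind, hd, hc]
    · rw [length_diagonalColumns, length_diagonalColumns]
      simp only [ne_eq, not_true_eq_false, or_false]
      intro e
      rw [← e, hc] at hd
      exact hne (congrArg Prod.fst hd).symm

end Reading

/-! ### Induction on the number of letters -/

section Induction

theorem insertionPair_append (v : List Letter) (u : Letter) :
    insertionPair (v ++ [u]) = (((insertionPair v).1.insertLetter u).tableau,
      (insertionPair v).2.set ((insertionPair v).1.insertLetter u).box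
        ⟨(v.length : ℤ) + 1, ((insertionPair v).1.insertLetter u).endsInColumn⟩) := by
  simp [insertionPair, List.zipIdx_append]

/-- The situation after the insertion of the first `i` letters of `w`, where `W` is the labelled
form of `w`.  The contents of the boxes are `f`, and all primes, including those of the letters
that are still to be inserted, indicate membership of labels in `S`. -/
structure Inserted (w : List Letter) (W : List (ℤ × Finset ℤ)) (i : ℕ) (B : Finset (ℤ × ℤ))
    (f : Cell → ℤ × Finset ℤ) (S : Set (Finset ℤ)) : Prop where
  finished : Finished B f (W.drop i)
  agrees : Agrees (insertionPair (w.take i)).1 B f S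
  agrees_unprimed : Agrees (insertionPair (ofWord ((unprime w).take i))).1 B f ∅
  boxes : (insertionPair (w.take i)).2.boxes = B
  diagonal : ∀ d, (d, d) ∈ B →
    (((insertionPair (w.take i)).2.entry (d, d)).primed = true ↔ (f (some (d, d))).2 ∈ S)
  letters : ∀ (k : ℕ) (h : k < w.length) (h' : k < W.length), i ≤ k →
    (w[k].primed = true ↔ W[k].2 ∈ S)
  empty : ∅ ∉ S

variable {w : List Letter} {W : List (ℤ × Finset ℤ)} {i : ℕ} {B : Finset (ℤ × ℤ)}
  {f : Cell → ℤ × Finset ℤ} {S : Set (Finset ℤ)}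

/-- The letter outside of the boxes is irrelevant. -/
theorem Inserted.update (I : Inserted w W i B f S) (u : ℤ × Finset ℤ) :
    Inserted w W i B (Function.update f none u) S := by
  have e : ∀ x, Function.update f none u (some x) = f (some x) := fun x => by simp
  have en : num (Function.update f none u) = num f := funext fun x => by rw [num, num, e]
  refine ⟨⟨by rw [en]; exact I.finished.shifted, fun q => (I.finished.spells q).congr
    (fun _ _ => rfl) fun v hv => ?_⟩, ⟨I.agrees.boxes, ?_, ?_⟩, ⟨I.agrees_unprimed.boxes, ?_, ?_⟩,
    I.boxes, ?_, I.letters, I.empty⟩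
  · obtain ⟨x, -, rfl⟩ := Finset.mem_map.1 hv
    exact e x
  · rw [en]
    exact I.agrees.num_eq
  · simpa only [e] using I.agrees.primed_iff
  · rw [en]
    exact I.agrees_unprimed.num_eq
  · simpa only [e] using I.agrees_unprimed.primed_iff
  · simpa only [e] using I.diagonal

theorem Inserted.cseq_eq (I : Inserted w W i B f S) (hW : W.map Prod.fst = unprime w) :
    cseq (unprime w) i = diagonalColumns f (B.image Prod.fst).card := by
  rw [cseq, insertionTableau, ← I.finished.cycleSequence_eq I.agrees_unprimed, ← hW, List.map_drop]

/-- The insertion of one more letter, into the tableau with primes and into the one without. -/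
theorem Inserted.succ (I : Inserted w W i B f S) (hW : W.map Prod.fst = unprime w)
    (hi : i < w.length) :
    ∃ B' f', Inserted w W (i + 1) B' f'
      {θ | cycleSwap (cseq (unprime w) i) (cseq (unprime w) (i + 1)) θ ∈ S} := by
  have hlen : W.length = w.length := by simpa [unprime] using congrArg List.length hW
  have hiW : i < W.length := by omega
  have hnum : W[i].1 = w[i].num := by
    have h1 : (W.map Prod.fst)[i]? = (unprime w)[i]? := by rw [hW]
    simpa [unprime, hi, hiW] using h1
  have I := I.update W[i]
  have hf : Function.update f none W[i] none = W[i] := by simp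
  generalize Function.update f none W[i] = f at I hf
  have F := I.finished
  rw [List.drop_eq_getElem_cons hiW] at F
  obtain ⟨f', x, σ, J⟩ := insertLetter_spec F hf
  have hl : LetterAgrees w[i] (f none) S := by
    rw [hf]
    exact ⟨hnum.symm, I.letters i hi hiW le_rfl⟩
  have hl0 : LetterAgrees (Letter.ofInt w[i].num) (f none) ∅ := by
    rw [hf]
    exact ⟨hnum.symm, by simp [Letter.ofInt]⟩
  obtain ⟨a1, a2, a3⟩ := J.agrees S _ _ I.empty I.agrees hl
  obtain ⟨-, b2, -⟩ := J.agrees ∅ _ _ (Set.notMem_empty _) I.agrees_unprimed hl0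
  have htake : w.take (i + 1) = w.take i ++ [w[i]] := by simp
  have htake0 : ofWord ((unprime w).take (i + 1)) =
      ofWord ((unprime w).take i) ++ [Letter.ofInt w[i].num] := by
    have : i < (unprime w).length := by simpa [unprime] using hi
    rw [← List.take_append_getElem this]
    simp [ofWord, unprime]
  have K : Inserted w W (i + 1) (insert x B) f' {θ | σ θ ∈ S} := by
    refine ⟨J.finished, ?_, ?_, ?_, fun d hd => ?_, fun k h h' hk => ?_, ?_⟩
    · rw [htake, insertionPair_append]
      exact a2
    · rw [htake0, insertionPair_append]
      exact b2
    · rw [htake, insertionPair_append, a1]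
      simp only [Tableau.set, I.boxes]
    · rw [htake, insertionPair_append, a1]
      by_cases e : (d, d) = x
      · have := a3 (by rw [← e])
        rw [← e] at this
        simpa [Tableau.set, e] using this
      · have hd' : (d, d) ∈ B := Finset.mem_of_mem_insert_of_ne hd e
        rw [Set.mem_ofPred_eq, J.diagonal d hd', ← I.diagonal d hd']
        simp [Tableau.set, e]
    · have hm : W[k] ∈ W.drop (i + 1) :=
        List.mem_drop_iff_getElem.2 ⟨k - (i + 1), by omega, by congr 1; omega⟩
      rw [Set.mem_ofPred_eq, J.tail _ hm]
      exact I.letters k h h' (by omega)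
    · rw [Set.mem_ofPred_eq, J.empty]
      exact I.empty
  have hσ : cycleSwap (cseq (unprime w) i) (cseq (unprime w) (i + 1)) = σ := by
    rw [I.cseq_eq hW, K.cseq_eq hW]
    exact J.step.cycleSwap_eq J.not_mem F.shifted.diagonal_mem_iff
      K.finished.shifted.diagonal_mem_iff
  rw [hσ]
  exact ⟨_, _, K⟩

/-- The sets of labels after `i` insertions are the inverse images of the initial one under `τ_1 ⋯
τ_i`. -/
theorem exists_inserted (hW : W.map Prod.fst = unprime w) (H : IsLabelled 1 W) (hS : ∅ ∉ S)
    (hw : ∀ (k : ℕ) (h : k < w.length) (h' : k < W.length), w[k].primed = true ↔ W[k].2 ∈ S)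
    (i : ℕ) (hi : i ≤ w.length) :
    ∃ B f, Inserted w W i B f {θ | ((List.range i).map fun i =>
      cycleSwap (cseq (unprime w) i) (cseq (unprime w) (i + 1))).prod θ ∈ S} := by
  induction i with
  | zero =>
    have A : ∀ S, Agrees (insertionPair []).1 ∅ (fun _ => (0, ∅)) S := fun S =>
      ⟨rfl, by simp, by simp⟩
    exact ⟨∅, fun _ => (0, ∅), ⟨fun _ _ h => by simp at h, fun q => ⟨[], ⟨List.Pairwise.nil,
      by simp [boxCells]⟩, by simpa using H⟩⟩, A _, A _, rfl, by simp,
      fun k h h' _ => hw k h h', hS⟩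
  | succ i ih =>
    obtain ⟨B, f, I⟩ := ih (by omega)
    obtain ⟨B', f', I'⟩ := I.succ hW (by omega)
    refine ⟨B', f', ?_⟩
    rw [List.range_succ, List.map_append, List.prod_append, List.map_singleton,
      List.prod_singleton]
    exact I'

/-- The labels of the primed letters are exactly the marked cycles. -/
theorem primed_iff_mem_marked {z : Equiv.Perm ℤ} (hw : IsPrimedInvolutionWord z w)
    (hW : W.map Prod.fst = unprime w) (H : IsLabelled 1 W) {k : ℕ} (h : k < w.length)
    (h' : k < W.length) : w[k].primed = true ↔ W[k].2 ∈ marked w := by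
  have hlen : W.length = w.length := by simpa [unprime] using congrArg List.length hW
  have hg : ∀ (k : ℕ) (h' : k < W.length), gamma (unprime w) k = W[k].2 := fun k h' => by
    rw [← hW, H.gamma_eq h']
  refine ⟨fun hp => ⟨k, h, hp, hg k h'⟩, ?_⟩
  rintro ⟨k', h1, hp, e⟩
  have h2 : k' < W.length := by omega
  rw [hg k' h2] at e
  have hne : W[k'].2 ≠ ∅ := (H.isCommutation_iff h2).1 (hW ▸ hw.2 k' h1 hp)
  have hpair := List.pairwise_iff_getElem.1 (IsLabelled.pairwise one_involutive H)
  rcases lt_trichotomy k k' with hlt | rfl | hlt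
  · exact absurd e.symm (hpair k k' h' h2 hlt (e ▸ hne))
  · exact hp
  · exact absurd e (hpair k' k h2 h' hlt hne)

theorem empty_notMem_marked {z : Equiv.Perm ℤ} (hw : IsPrimedInvolutionWord z w)
    (hW : W.map Prod.fst = unprime w) (H : IsLabelled 1 W) : ∅ ∉ marked w := by
  rintro ⟨k, h, hp, e⟩
  have hlen : W.length = w.length := by simpa [unprime] using congrArg List.length hW
  have hk : k < W.length := by omega
  rw [← hW, H.gamma_eq hk] at e
  exact (H.isCommutation_iff hk).1 (hW ▸ hw.2 k h hp) e

end Induction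

end ShiftedEG

theorem proposition4p8 (z : Equiv.Perm ℤ) (w : List ShiftedEG.Letter)
    (hw : ShiftedEG.IsPrimedInvolutionWord z w)
    (a : List ℤ) (ha : a = ShiftedEG.unprime w)
    (i j : ℤ) (θ : Finset ℤ)
    (hθ : θ = ShiftedEG.boxGamma
      (ShiftedEG.insertionTableau (ShiftedEG.ofWord a)) [] (i, j)) :
    (i ≠ j → ((ShiftedEG.insertionTableau w).IsPrimedAt (i, j) ↔
      θ ≠ ∅ ∧ ShiftedEG.tau a θ ∈ ShiftedEG.marked w)) ∧
    (i = j → ((ShiftedEG.recordingTableau w).IsPrimedAt (i, j) ↔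
      θ ≠ ∅ ∧ ShiftedEG.tau a θ ∈ ShiftedEG.marked w)) := by
  open ShiftedEG in
  subst ha
  have H := hw.1.isLabelled
  have hW := map_fst_label 1 (unprime w)
  generalize label 1 (unprime w) = W at H hW
  have hlen : (unprime w).length = w.length := by simp [unprime]
  have hlenW : W.length = w.length := by simpa [unprime] using congrArg List.length hW
  obtain ⟨B, f, I⟩ := exists_inserted hW H (empty_notMem_marked hw hW H)
    (fun k h h' => primed_iff_mem_marked hw hW H h h') w.length le_rfl
  rw [← hlen] at I
  change Inserted w W _ B f {θ | tau (unprime w) θ ∈ marked w} at I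
  have htake : w.take (unprime w).length = w := by rw [hlen, List.take_length]
  have hA0 := I.agrees_unprimed
  have hA := I.agrees
  have hQ := I.boxes
  have hD := I.diagonal
  rw [List.take_length] at hA0
  rw [htake] at hA hQ hD
  have hF := I.finished
  rw [List.drop_eq_nil_of_le (by omega)] at hF
  have hbox : (i, j) ∈ B → θ = (f (some (i, j))).2 := fun h => by
    rw [hθ]
    exact hF.boxGamma_eq hA0 h
  have hnot : (i, j) ∉ B → θ = ∅ := fun h => by
    rw [hθ, boxGamma, if_neg]
    rwa [insertionTableau, hA0.boxes]
  have hne : tau (unprime w) θ ∈ marked w → θ ≠ ∅ := by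
    rintro h rfl
    exact I.empty h
  refine ⟨fun hij => ⟨?_, ?_⟩, fun hij => ⟨?_, ?_⟩⟩
  · rintro ⟨h1, h2⟩
    rw [insertionTableau, hA.boxes] at h1
    have h3 := ((hA.primed_iff _ h1).1 h2).2
    rw [← hbox h1] at h3
    exact ⟨hne h3, h3⟩
  · rintro ⟨h1, h2⟩
    have h3 : (i, j) ∈ B := by
      by_contra h
      exact h1 (hnot h)
    rw [hbox h3] at h2
    exact ⟨by rwa [insertionTableau, hA.boxes], (hA.primed_iff _ h3).2 ⟨hij, h2⟩⟩
  · subst hij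
    rintro ⟨h1, h2⟩
    rw [recordingTableau, hQ] at h1
    have h3 := (hD _ h1).1 h2
    rw [← hbox h1] at h3
    exact ⟨hne h3, h3⟩
  · subst hij
    rintro ⟨h1, h2⟩
    have h3 : (i, i) ∈ B := by
      by_contra h
      exact h1 (hnot h)
    rw [hbox h3] at h2
    exact ⟨by rwa [recordingTableau, hQ], (hD _ h3).2 h2⟩
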